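/- Fix an integer $m\ge 2$. Let $G_0(re^{\iota t})=r^{1/m}e^{\iota t/m}$ for $t\in[0,2\pi)$, $G_l=e^{2\pi\iota l/m}G_0$ for $0\le l<m$, and $\theta_0=e^{\pi\iota/m}$. Let $\mathcal D\subset\mathbb C$ be the preimage of $[-1,1]\times[-1,1]$ under $\omega\mapsto\omega^m$. For continuous $f:\mathcal D\to\mathbb C$ put \[\varphi_{f,l}(s)=\int_{-1}^1\frac{f(G_l(u+\iota s))}{(u^2+s^2)^{\frac{m-1}{m}}}\,du,\qquad s\in[-1,0)\cup(0,1].\] For $k\ge 0$, $0\le j\le k\wedge(m-1)$ and $f\in C^k(\mathcal D)$ (in the real sense) let \[\partial^k_j(f)=\sum_{0\le i\le\frac{k-j}{m}}\frac{\binom{k}{j+im}\binom{\frac{(m-1)-j}{m}-1}{i}}{\binom{\frac{(k-j)-(m-1)}{m}}{i}}\,\frac{\partial^kf}{\partial\omega^{j+im}\,\partial\overline\omega^{\,k-j-im}}(0),\] where $\binom{x}{i}=\frac{x(x-1)\cdots(x-i+1)}{i!}$. For real $x,y$ that are not integers let \[\mathfrak B(x,y)=\frac{\pi e^{\iota\frac{\pi}{2}(y-x)}}{2^{x+y-2}}\,\frac{\Gamma(x+y-1)}{\Gamma(x)\Gamma(y)},\]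 where the numerator is read with the convention $\Gamma(0):=1$, $\Gamma(-N):=\frac{1}{(-1)(-2)\cdots(-N)}$ for $N\ge1$. For $0\le l<2m$ let \[\mathscr C^k_l(f)=\sum_{\substack{0\le j\le k\wedge(m-2)\\ j\not\equiv k-(m-1)\ (\mathrm{mod}\ m)}}\theta_0^{\,l(2j-k)}\,\mathfrak B\!\left(\tfrac{(m-1)-j}{m},\tfrac{(m-1)-(k-j)}{m}\right)\partial^k_j(f).\] For an integer $n\ge 0$ and $0\le b<1$, $C^{n+\mathrm P_b}([-1,0)\cup(0,1])$ is the space of $\varphi\in C^{n+1}([-1,0)\cup(0,1])$ such that $p_b(D^n\varphi):=\sup_{s}|s|^{1+b}|D^{n+1}\varphi(s)|<\infty$ and both limits $\lim_{s\to0^\pm}|s|^{1+b}D^{n+1}\varphi(s)$ exist, with the norm $\|\varphi\|_{C^{n+\mathrm P_b}}=\sum_{i=0}^n\|D^i\varphi\|_{L^1}+p_b(D^n\varphi)$. The norm of $C^N(\mathcal D)$ is the sum over $0\le j\le N$ of the suprema over $\mathcal D$ of the norms of the $j$-th real derivatives. **Theorem.** Let $k\ge 0$, $n=\left\lceil\frac{k-(m-2)}{m}\right\rceil$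 and $b=n-\frac{k-(m-2)}{m}$. There is a constant $C>0$, depending only on $m$ and $k$, such that the following holds for every $0\le l<m$ and every $f\in C^{k\vee(n+1)}(\mathcal D)$ with $\partial^j_i(f)=0$ for all $0\le j<k$ and all $0\le i\le j\wedge(m-2)$ with $i\not\equiv j-(m-1)\pmod m$. We have $\varphi_{f,l}\in C^{n+\mathrm P_b}([-1,0)\cup(0,1])$ and \[\|\varphi_{f,l}\|_{C^{n+\mathrm P_b}([-1,0)\cup(0,1])}\le C\,\|f\|_{C^{k\vee(n+1)}(\mathcal D)}.\] Moreover, \[\lim_{s\to0^+}|s|^{b+1}D^{n+1}\varphi_{f,l}(s)=(-1)^{n+1}\frac{(n+1)!}{k!}\binom{b}{n+1}\mathscr C^k_{2l}(f),\] \[\lim_{s\to0^-}|s|^{b+1}D^{n+1}\varphi_{f,l}(s)=\frac{(n+1)!}{k!}\binom{b}{n+1}\mathscr C^k_{2l+1}(f),\] where, in these two formulas only, $\binom{0}{n+1}:=\lim_{x\to0}\frac1x\binom{x}{n+1}=\frac{(-1)^n}{n+1}$ when $b=0$. -/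

import Mathlib

open Filter Topology MeasureTheory Set
open scoped ENNReal Nat

noncomputable section

namespace Saddle

/-- The argument of a complex number normalised to lie in `[0, 2π)`. -/
def argPos (z : ℂ) : ℝ := if z.arg < 0 then z.arg + 2 * Real.pi else z.arg

/-- The principal branch of the `m`-th root: `r e^{it} ↦ r^{1/m} e^{it/m}` for `t ∈ [0, 2π)`. -/
def rootZero (m : ℕ) (z : ℂ) : ℂ :=
  ((‖z‖ ^ (1 / (m : ℝ)) : ℝ) : ℂ) * Complex.exp (Complex.I * ((argPos z / m : ℝ) : ℂ))

/-- The `l`-th branch `θ^l G₀` of the `m`-th root, where `θ = e^{2πi/m}`. -/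
def root (m l : ℕ) (z : ℂ) : ℂ :=
  Complex.exp (2 * Real.pi * Complex.I / m) ^ l * rootZero m z

/-- The preimage of the square `[-1,1] × [-1,1]` under `ω ↦ ω^m`. -/
def domain (m : ℕ) : Set ℂ :=
  {w | (w ^ m).re ∈ Icc (-1 : ℝ) 1 ∧ (w ^ m).im ∈ Icc (-1 : ℝ) 1}

/-- The `C^N` norm on the domain: the sum over `j ≤ N` of the supremum norms of the `j`-th
(real) derivatives. -/
def ckNorm (m N : ℕ) (f : ℂ → ℂ) : ℝ≥0∞ :=
  ∑ j ∈ Finset.range (N + 1),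
    ⨆ w ∈ domain m, ‖iteratedFDerivWithin ℝ j f (domain m) w‖ₑ

/-- `φ_{f,l}(s) = ∫_{-1}^1 f(G_l(u + is)) / (u² + s²)^{(m-1)/m} du`, of interest for `s ≠ 0`. -/
def phi (m l : ℕ) (f : ℂ → ℂ) (s : ℝ) : ℂ :=
  ∫ u in (-1 : ℝ)..1,
    f (root m l ⟨u, s⟩) / (((u ^ 2 + s ^ 2) ^ (((m : ℝ) - 1) / m) : ℝ) : ℂ)

/-- The Wirtinger derivative `∂/∂ω = (∂/∂x - i ∂/∂y) / 2`. -/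
def dOmega (f : ℂ → ℂ) (w : ℂ) : ℂ :=
  (fderiv ℝ f w 1 - Complex.I * fderiv ℝ f w Complex.I) / 2

/-- The Wirtinger derivative `∂/∂ω̄ = (∂/∂x + i ∂/∂y) / 2`. -/
def dOmegaBar (f : ℂ → ℂ) (w : ℂ) : ℂ :=
  (fderiv ℝ f w 1 + Complex.I * fderiv ℝ f w Complex.I) / 2

/-- `∂^{p+q} f / ∂ω^p ∂ω̄^q` at the origin. -/
def mixedPartial (p q : ℕ) (f : ℂ → ℂ) : ℂ := (dOmega^[p] (dOmegaBar^[q] f)) 0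

/-- The generalised binomial coefficient `x (x-1) ⋯ (x-n+1) / n!`. -/
def gbinom (x : ℝ) (n : ℕ) : ℝ := (∏ i ∈ Finset.range n, (x - i)) / (n ! : ℝ)

/-- The binomial coefficient with the convention
`binom(0, n) := lim_{x → 0} binom(x, n) / x = (-1)^{n-1} / n` (for `n ≥ 1`). -/
def cbinom (x : ℝ) (n : ℕ) : ℝ := if x = 0 then (-1) ^ (n - 1) / (n : ℝ) else gbinom x n

/-- The functional `∂^k_j`. -/
def invDist (m k j : ℕ) (f : ℂ → ℂ) : ℂ :=
  ∑ n ∈ Finset.range ((k - j) / m + 1),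
    (((k.choose (j + n * m) : ℝ) * gbinom (((m : ℝ) - 1 - j) / m - 1) n /
        gbinom (((k : ℝ) - j - (m - 1)) / m) n : ℝ) : ℂ) *
      mixedPartial (j + n * m) (k - j - n * m) f

open Classical in
/-- The Gamma function, extended to the poles by `Γ(0) = 1` and
`Γ(-N) = 1 / ((-1)(-2)⋯(-N))`. -/
def gammaExt (x : ℝ) : ℝ :=
  if ∃ N : ℕ, x = -(N : ℝ) then ∏ i ∈ Finset.range ⌊-x⌋₊, (-((i : ℝ) + 1))⁻¹
  else Real.Gamma x

open Classical in
/-- The Beta-like function: `0` if `x` or `y` is a non-positive integer, and otherwise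
`π e^{iπ(y-x)/2} 2^{2-x-y} Γ(x+y-1) / (Γ(x) Γ(y))`, with the extended Gamma function in the
numerator. -/
def betaLike (x y : ℝ) : ℂ :=
  if (∃ N : ℕ, x = -(N : ℝ)) ∨ (∃ N : ℕ, y = -(N : ℝ)) then 0
  else (Real.pi : ℂ) * Complex.exp (Complex.I * ((Real.pi / 2 * (y - x) : ℝ) : ℂ)) /
      (((2 : ℝ) ^ (x + y - 2) : ℝ) : ℂ) *
    ((gammaExt (x + y - 1) / (Real.Gamma x * Real.Gamma y) : ℝ) : ℂ)

/-- The functional `𝒞^k_l`, with `θ₀ = e^{πi/m}`. -/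
def angDist (m k l : ℕ) (f : ℂ → ℂ) : ℂ :=
  ∑ j ∈ (Finset.range (min k (m - 2) + 1)).filter
      (fun j : ℕ => ¬ ((j : ℤ) ≡ (k : ℤ) - ((m : ℤ) - 1) [ZMOD (m : ℤ)])),
    Complex.exp (Real.pi * Complex.I / m) ^ ((l : ℤ) * (2 * (j : ℤ) - (k : ℤ))) *
      betaLike (((m : ℝ) - 1 - j) / m) (((m : ℝ) - 1 - ((k : ℝ) - j)) / m) *
      invDist m k j f

/-- The set `[-1,0) ∪ (0,1]`. -/
def punctured : Set ℝ := Ico (-1) 0 ∪ Ioc 0 1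

/-- The seminorm `p_b(D^n φ) = sup |s|^{1+b} |D^{n+1} φ(s)|` over `[-1,0) ∪ (0,1]`. -/
def pSemi (n : ℕ) (b : ℝ) (g : ℝ → ℂ) : ℝ≥0∞ :=
  ⨆ s ∈ punctured,
    ENNReal.ofReal (|s| ^ (1 + b)) * ‖iteratedDerivWithin (n + 1) g punctured s‖ₑ

/-- The norm of `C^{n+P_b}([-1,0) ∪ (0,1])`. -/
def pNorm (n : ℕ) (b : ℝ) (g : ℝ → ℂ) : ℝ≥0∞ :=
  (∑ i ∈ Finset.range (n + 1), ∫⁻ s in punctured, ‖iteratedDerivWithin i g punctured s‖ₑ) +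
    pSemi n b g

/-- Membership in `C^{n+P_b}([-1,0) ∪ (0,1])`. -/
structure MemP (n : ℕ) (b : ℝ) (g : ℝ → ℂ) : Prop where
  contDiffOn : ContDiffOn ℝ ((n + 1 : ℕ) : ℕ∞) g punctured
  pSemi_lt_top : pSemi n b g < ⊤
  limit_right : ∃ c : ℂ,
    Tendsto (fun s : ℝ => ((|s| ^ (1 + b) : ℝ) : ℂ) * iteratedDerivWithin (n + 1) g punctured s)
      (𝓝[>] 0) (𝓝 c)
  limit_left : ∃ c : ℂ,
    Tendsto (fun s : ℝ => ((|s| ^ (1 + b) : ℝ) : ℂ) * iteratedDerivWithin (n + 1) g punctured s)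
      (𝓝[<] 0) (𝓝 c)

/-- `n = ⌈(k-(m-2))/m⌉`. For `m ≥ 2` the argument exceeds `-1`, so the ceiling is a natural
number. -/
def nIdx (m k : ℕ) : ℕ := ⌈((k : ℝ) - ((m : ℝ) - 2)) / m⌉₊

/-- `b = n - (k-(m-2))/m ∈ [0,1)`. -/
def bIdx (m k : ℕ) : ℝ := (nIdx m k : ℝ) - ((k : ℝ) - ((m : ℝ) - 2)) / m

end Saddle

end

noncomputable section

namespace Saddle

open Complex ComplexConjugate FourierTransform

/-! With w = G_l(z) and z = u + is one has |z| = |w|^m, so φ(s) is the integral over u of f(w)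
w^{-(m-1)} w̄^{-(m-1)}. Since dw/ds = (i/m) w^{-(m-1)}, integrands of the form F(w) w^{-a} w̄^{-b}
are stable under d/ds, and every differentiation lowers the degree of homogeneity in |w| by m. The
proof splits f into its Taylor polynomial of order k at 0 and a remainder.

The remainder has mixed derivatives of size |w|^{k-p-q}. After n+1 differentiations the integrand is
of size |w|^{k-2(m-1)-m(n+1)} = |z|^{-(2+b)}, whose integral in u is O(|s|^{-(1+b)}). As the
remainder is in fact o(|w|^{k-p-q}) at 0, it contributes nothing to the limits
(`JetBound.norm_jetInt_le`, `JetBound.tendsto_jetInt`).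

A monomial w^r w̄^t becomes, up to a phase, z^{-x} z̄^{-y} with x = (m-1-r)/m and y = (m-1-t)/m.
Differentiating its integral over [-1,1] + is in s raises x by one, apart from bounded boundary
terms. After enough differentiations the integral over the whole line converges and scales exactly
in s, so the N-th derivative is a constant times s^{1-x-y-N} plus a bounded error
(`segDeriv_asymp`). The constant is the complete line integral, a multiple of Γ(x+y+N-1)/(Γ(x)Γ(y)).
It is computed by Parseval from the Fourier transforms of Gamma densities when x, y > 1, and carried
to x + y > 1 by integration by parts (`lineInt_eq`).

The terms of total order j share the power of s. Those with 1/Γ(x) = 0 or 1/Γ(y) = 0 disappear. The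
others are grouped by r mod m: within a class the phase and the sum x + y are constant, and the
functional equation of 1/Γ turns the class into the single functional ∂^j_i (`orderCoef_eq`). Hence
the hypotheses for j < k remove exactly the powers more singular than |s|^{-(1+b)}, and order k
gives the limits through 𝒞^k (`exists_polyInt_asymp`, `orderCoef_top`). The lower half plane is
reflected to the upper one by z ↦ -z, which accounts for the odd index 2l+1 and for the different
sign.

Finally, the bound on the derivative of order n+1, together with bounds at |s| = 1 for the lower
ones, is integrated downwards to give the L¹ norms (`exists_pNorm_le`). -/

/-! ### Powers z^{-x} z̄^{-y} and their integral over the line Im z = 1. -/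

/-- The function `z ^ (-x) * conj z ^ (-y)`, of interest on the upper half plane. -/
def upow (x y : ℝ) (z : ℂ) : ℂ := z ^ (-(x : ℂ)) * (conj z) ^ (-(y : ℂ))

lemma conj_mem_slitPlane {z : ℂ} (hz : z ∈ slitPlane) : conj z ∈ slitPlane := by
  rw [mem_slitPlane_iff] at hz ⊢
  simpa using hz

lemma norm_upow (x y : ℝ) {z : ℂ} (hz : z ≠ 0) : ‖upow x y z‖ = ‖z‖ ^ (-(x + y)) := by
  have h : 0 < ‖z‖ := norm_pos_iff.2 hz
  rw [upow, norm_mul, ← ofReal_neg, ← ofReal_neg, norm_cpow_real, norm_cpow_real,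
    RCLike.norm_conj, ← Real.rpow_add h]
  congr 1; ring

lemma ofReal_mul_cpow {s : ℝ} (hs : 0 < s) {z : ℂ} (hz : z ≠ 0) (c : ℂ) :
    ((s : ℂ) * z) ^ c = (s : ℂ) ^ c * z ^ c := by
  have hs' : (s : ℂ) ≠ 0 := ofReal_ne_zero.2 hs.ne'
  rw [cpow_def_of_ne_zero (mul_ne_zero hs' hz), cpow_def_of_ne_zero hs', cpow_def_of_ne_zero hz,
    log_ofReal_mul hs hz, ← Complex.exp_add, ofReal_log hs.le]
  ring_nf

lemma upow_ofReal_mul (x y : ℝ) {s : ℝ} (hs : 0 < s) {z : ℂ} (hz : z ≠ 0) :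
    upow x y (s * z) = ((s ^ (-(x + y)) : ℝ) : ℂ) * upow x y z := by
  have hs' : (s : ℂ) ≠ 0 := ofReal_ne_zero.2 hs.ne'
  have hz' : conj z ≠ 0 := by simpa using hz
  rw [upow, upow, map_mul, conj_ofReal, ofReal_mul_cpow hs hz, ofReal_mul_cpow hs hz',
    ofReal_cpow hs.le]
  have : (s : ℂ) ^ ((-(x + y) : ℝ) : ℂ) = (s : ℂ) ^ (-(x : ℂ)) * (s : ℂ) ^ (-(y : ℂ)) := by
    rw [← cpow_add _ _ hs']; congr 1; push_cast; ring
  rw [this]; ring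

lemma mul_upow_left (x y : ℝ) {z : ℂ} (hz : z ≠ 0) : z * upow (x + 1) y z = upow x y z := by
  rw [upow, upow, ← mul_assoc]
  congr 1
  rw [show (-((x + 1 : ℝ) : ℂ)) = -(x : ℂ) - 1 by push_cast; ring, cpow_sub _ _ hz, cpow_one]
  field_simp

lemma mul_upow_right (x y : ℝ) {z : ℂ} (hz : z ≠ 0) :
    conj z * upow x (y + 1) z = upow x y z := by
  have hz' : conj z ≠ 0 := by simpa using hz
  rw [upow, upow, mul_left_comm]
  congr 1
  rw [show (-((y + 1 : ℝ) : ℂ)) = -(y : ℂ) - 1 by push_cast; ring, cpow_sub _ _ hz', cpow_one]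
  field_simp

lemma hasDerivAt_upow (x y : ℝ) {γ : ℝ → ℂ} {γ' : ℂ} {t : ℝ} (hγ : HasDerivAt γ γ' t)
    (ht : γ t ∈ slitPlane) :
    HasDerivAt (fun r => upow x y (γ r))
      (-x * upow (x + 1) y (γ t) * γ' - y * upow x (y + 1) (γ t) * conj γ') t := by
  have h1 : HasDerivAt (fun r => (γ r) ^ (-(x : ℂ)))
      (-(x : ℂ) * (γ t) ^ (-(x : ℂ) - 1) * γ') t := by
    have := ((hasDerivAt_id (γ t)).cpow_const (c := -(x : ℂ)) ht).comp t hγ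
    simpa [Function.comp_def] using this
  have hc : HasDerivAt (fun r => conj (γ r)) (conj γ') t :=
    (conjCLE.toContinuousLinearMap.hasFDerivAt.comp_hasDerivAt t hγ)
  have h2 : HasDerivAt (fun r => (conj (γ r)) ^ (-(y : ℂ)))
      (-(y : ℂ) * (conj (γ t)) ^ (-(y : ℂ) - 1) * conj γ') t := by
    have := ((hasDerivAt_id (conj (γ t))).cpow_const (c := -(y : ℂ))
      (conj_mem_slitPlane ht)).comp t hc
    simpa [Function.comp_def] using this
  refine (h1.mul h2).congr_deriv ?_
  simp only [upow]
  rw [show (-((x + 1 : ℝ) : ℂ)) = -(x : ℂ) - 1 by push_cast; ring,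
    show (-((y + 1 : ℝ) : ℂ)) = -(y : ℂ) - 1 by push_cast; ring]
  ring

lemma continuousOn_upow (x y : ℝ) : ContinuousOn (upow x y) slitPlane := by
  intro z hz
  have h1 : ContinuousAt (fun z : ℂ => z ^ (-(x : ℂ))) z :=
    continuousAt_id.cpow continuousAt_const hz
  have h2 : ContinuousAt (fun z : ℂ => (conj z) ^ (-(y : ℂ))) z :=
    (continuous_conj.continuousAt).cpow continuousAt_const (conj_mem_slitPlane hz)
  exact (h1.mul h2).continuousWithinAt

lemma mem_slitPlane_of_im_pos {z : ℂ} (hz : 0 < z.im) : z ∈ slitPlane :=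
  mem_slitPlane_iff.2 (Or.inr hz.ne')

lemma norm_sq_add_I (v : ℝ) : ‖(v : ℂ) + I‖ ^ 2 = 1 + ‖v‖ ^ 2 := by
  rw [← normSq_eq_norm_sq, normSq_apply]; simp; ring

lemma add_I_mem (v : ℝ) : (v : ℂ) + I ∈ slitPlane := mem_slitPlane_of_im_pos (by simp)

lemma norm_upow_add_I (x y v : ℝ) :
    ‖upow x y (v + I)‖ = (1 + ‖v‖ ^ 2) ^ (-(x + y) / 2) := by
  rw [norm_upow x y (slitPlane_ne_zero (add_I_mem v)), ← norm_sq_add_I,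
    ← Real.rpow_natCast, ← Real.rpow_mul (norm_nonneg _)]
  congr 1; push_cast; ring

lemma continuous_upow_add_I (x y : ℝ) : Continuous fun v : ℝ => upow x y (v + I) :=
  (continuousOn_upow x y).comp_continuous (by fun_prop) add_I_mem

lemma integrable_upow {x y : ℝ} (h : 1 < x + y) : Integrable fun v : ℝ => upow x y (v + I) := by
  have := integrable_rpow_neg_one_add_norm_sq (E := ℝ) (μ := volume) (r := x + y) (by simpa using h)
  refine this.mono' (continuous_upow_add_I x y).aestronglyMeasurable (ae_of_all _ fun v => ?_)
  rw [norm_upow_add_I]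

/-- The complete integral of `upow x y` over the line `Im z = 1`. -/
def lineInt (x y : ℝ) : ℂ := ∫ v : ℝ, upow x y (v + I)

lemma tendsto_upow_add_I {x y : ℝ} (h : 0 < x + y) (l : Filter ℝ)
    (hl : Tendsto (fun v : ℝ => ‖v‖) l atTop) :
    Tendsto (fun v : ℝ => upow x y (v + I)) l (𝓝 0) := by
  rw [tendsto_zero_iff_norm_tendsto_zero]
  simp_rw [norm_upow_add_I, neg_div]
  refine (tendsto_rpow_neg_atTop (by linarith : 0 < (x + y) / 2)).comp ?_
  exact tendsto_atTop_add_const_left _ _ ((tendsto_pow_atTop two_ne_zero).comp hl)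

/-- Integration by parts: z̄ = z - 2i on the line, so the derivative of `upow x (y - 1)` is a
combination of `upow x y` and `upow (x + 1) y`. The boundary terms vanish because x + y - 1 > 0. -/
lemma lineInt_succ_left {x y : ℝ} (h : 1 < x + y) :
    ((x + y - 1 : ℝ) : ℂ) * lineInt x y = 2 * I * x * lineInt (x + 1) y := by
  have hd : ∀ v : ℝ, HasDerivAt (fun v : ℝ => upow x (y - 1) (v + I))
      ((1 - x - y : ℝ) * upow x y (v + I) + 2 * I * x * upow (x + 1) y (v + I)) v := by
    intro v
    have h0 : HasDerivAt (fun v : ℝ => (v : ℂ) + I) 1 v :=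
      (ofRealCLM.hasDerivAt (x := v)).add_const I
    refine (hasDerivAt_upow x (y - 1) h0 (add_I_mem v)).congr_deriv ?_
    have hne := slitPlane_ne_zero (add_I_mem v)
    have e1 := mul_upow_right (x + 1) (y - 1) hne
    have e2 := mul_upow_left x y hne
    rw [sub_add_cancel] at e1 ⊢
    rw [← e1, ← e2]
    simp
    ring
  have hi := integral_of_hasDerivAt_of_tendsto hd
    (((integrable_upow h).const_mul _).add
      ((integrable_upow (by linarith : 1 < x + 1 + y)).const_mul _))
    (tendsto_upow_add_I (by linarith : 0 < x + (y - 1)) atBot tendsto_abs_atBot_atTop)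
    (tendsto_upow_add_I (by linarith : 0 < x + (y - 1)) atTop tendsto_norm_atTop_atTop)
  rw [integral_add ((integrable_upow h).const_mul _)
      ((integrable_upow (by linarith : 1 < x + 1 + y)).const_mul _),
    integral_const_mul, integral_const_mul] at hi
  change _ * lineInt x y + _ * lineInt (x + 1) y = 0 - 0 at hi
  push_cast at hi ⊢
  linear_combination -hi

/-- The mirror image of the previous recurrence, now with z = z̄ + 2i. -/
lemma lineInt_succ_right {x y : ℝ} (h : 1 < x + y) :
    ((x + y - 1 : ℝ) : ℂ) * lineInt x y = -(2 * I * y * lineInt x (y + 1)) := by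
  have hd : ∀ v : ℝ, HasDerivAt (fun v : ℝ => upow (x - 1) y (v + I))
      ((1 - x - y : ℝ) * upow x y (v + I) + -(2 * I * y) * upow x (y + 1) (v + I)) v := by
    intro v
    have h0 : HasDerivAt (fun v : ℝ => (v : ℂ) + I) 1 v :=
      (ofRealCLM.hasDerivAt (x := v)).add_const I
    refine (hasDerivAt_upow (x - 1) y h0 (add_I_mem v)).congr_deriv ?_
    have hne := slitPlane_ne_zero (add_I_mem v)
    have e1 := mul_upow_left (x - 1) (y + 1) hne
    have e2 := mul_upow_right x y hne
    rw [sub_add_cancel] at e1 ⊢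
    rw [← e1, ← e2]
    simp
    ring
  have hi := integral_of_hasDerivAt_of_tendsto hd
    (((integrable_upow h).const_mul _).add
      ((integrable_upow (by linarith : 1 < x + (y + 1))).const_mul _))
    (tendsto_upow_add_I (by linarith : 0 < x - 1 + y) atBot tendsto_abs_atBot_atTop)
    (tendsto_upow_add_I (by linarith : 0 < x - 1 + y) atTop tendsto_norm_atTop_atTop)
  rw [integral_add ((integrable_upow h).const_mul _)
      ((integrable_upow (by linarith : 1 < x + (y + 1))).const_mul _),
    integral_const_mul, integral_const_mul] at hi
  change _ * lineInt x y + _ * lineInt x (y + 1) = 0 - 0 at hi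
  push_cast at hi ⊢
  linear_combination -hi

/-! ### Closed form of the line integral through Fourier transforms of Gamma densities. -/

/-- The integrand `t ^ a * exp (-(1 + i w) t)`. -/
def gammaKernel (a w t : ℝ) : ℂ := ((t ^ a : ℝ) : ℂ) * cexp (-((1 + I * w) * t))

lemma norm_gammaKernel (a w : ℝ) {t : ℝ} (ht : 0 ≤ t) :
    ‖gammaKernel a w t‖ = t ^ a * Real.exp (-t) := by
  rw [gammaKernel, norm_mul, norm_real, norm_exp, Real.norm_of_nonneg (Real.rpow_nonneg ht _)]
  simp

lemma continuousOn_gammaKernel (a w : ℝ) : ContinuousOn (gammaKernel a w) (Ioi 0) := by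
  refine ContinuousOn.mul ?_ (by fun_prop)
  exact continuous_ofReal.comp_continuousOn
    (continuousOn_id.rpow_const fun t ht => Or.inl (ne_of_gt ht))

lemma integrableOn_rpow_mul_exp {a : ℝ} (ha : -1 < a) :
    IntegrableOn (fun t : ℝ => t ^ a * Real.exp (-t)) (Ioi 0) := by
  simpa using integrableOn_rpow_mul_exp_neg_rpow ha one_pos

lemma integrableOn_gammaKernel {a : ℝ} (ha : -1 < a) (w : ℝ) :
    IntegrableOn (gammaKernel a w) (Ioi 0) := by
  refine Integrable.mono' (integrableOn_rpow_mul_exp ha)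
    ((continuousOn_gammaKernel a w).aestronglyMeasurable measurableSet_Ioi) ?_
  filter_upwards [ae_restrict_mem measurableSet_Ioi] with t ht
  rw [norm_gammaKernel a w (le_of_lt ht)]

lemma one_add_I_mul_mem (w : ℝ) : 1 + I * (w : ℂ) ∈ slitPlane :=
  mem_slitPlane_iff.2 (Or.inl (by simp))

lemma gammaKernel_recurrence {x : ℝ} (hx : 0 < x) (w : ℝ) :
    (1 + I * w) * ∫ t in Ioi 0, gammaKernel x w t =
      x * ∫ t in Ioi 0, gammaKernel (x - 1) w t := by
  have hd : ∀ t ∈ Ioi (0 : ℝ), HasDerivAt (gammaKernel x w)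
      (x * gammaKernel (x - 1) w t - (1 + I * w) * gammaKernel x w t) t := by
    intro t ht
    have h1 : HasDerivAt (fun t : ℝ => ((t ^ x : ℝ) : ℂ)) ((x * t ^ (x - 1) : ℝ) : ℂ) t :=
      (Real.hasDerivAt_rpow_const (Or.inl (ne_of_gt ht))).ofReal_comp
    have h2 : HasDerivAt (fun t : ℝ => cexp (-((1 + I * w) * t)))
        (cexp (-((1 + I * w) * t)) * (-((1 + I * w) * 1))) t :=
      (((ofRealCLM.hasDerivAt (x := t)).const_mul (1 + I * (w : ℂ))).neg).cexp
    refine (h1.mul h2).congr_deriv ?_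
    simp only [gammaKernel]; push_cast; ring
  have h0 : ContinuousWithinAt (gammaKernel x w) (Ici 0) 0 := by
    have h1 : ContinuousAt (fun t : ℝ => ((t ^ x : ℝ) : ℂ)) 0 :=
      continuous_ofReal.continuousAt.comp (Real.continuousAt_rpow_const _ _ (Or.inr hx.le))
    have h2 : ContinuousAt (fun t : ℝ => cexp (-((1 + I * w) * t))) 0 := by fun_prop
    exact (h1.mul h2).continuousWithinAt
  have hinf : Tendsto (gammaKernel x w) atTop (𝓝 0) := by
    rw [tendsto_zero_iff_norm_tendsto_zero]
    refine (tendsto_rpow_mul_exp_neg_mul_atTop_nhds_zero x 1 one_pos).congr' ?_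
    filter_upwards [eventually_ge_atTop 0] with t ht
    rw [norm_gammaKernel x w ht]; simp
  have i1 := (integrableOn_gammaKernel (by linarith : -1 < x - 1) w).const_mul (x : ℂ)
  have i2 := (integrableOn_gammaKernel (by linarith : -1 < x) w).const_mul (1 + I * (w : ℂ))
  have hi := integral_Ioi_of_hasDerivAt_of_tendsto h0 hd (i1.sub i2) hinf
  rw [integral_sub i1 i2, integral_const_mul, integral_const_mul] at hi
  have h00 : gammaKernel x w 0 = 0 := by simp [gammaKernel, Real.zero_rpow hx.ne']
  rw [h00] at hi
  linear_combination -hi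

lemma hasDerivAt_integral_gammaKernel {x : ℝ} (hx : 0 < x) (w : ℝ) :
    HasDerivAt (fun w => ∫ t in Ioi 0, gammaKernel (x - 1) w t)
      (-I * ∫ t in Ioi 0, gammaKernel x w t) w := by
  have key := (hasDerivAt_integral_of_dominated_loc_of_deriv_le
    (μ := volume.restrict (Ioi (0 : ℝ)))
    (F := fun w t => gammaKernel (x - 1) w t) (F' := fun w t => -I * gammaKernel x w t)
    (x₀ := w) (s := univ) (bound := fun t => t ^ x * Real.exp (-t)) univ_mem
    (Eventually.of_forall fun w' =>
      (integrableOn_gammaKernel (by linarith : -1 < x - 1) w').aestronglyMeasurable)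
    (integrableOn_gammaKernel (by linarith : -1 < x - 1) w)
    ((integrableOn_gammaKernel (by linarith : -1 < x) w).const_mul (-I)).aestronglyMeasurable
    ?_ (integrableOn_rpow_mul_exp (by linarith)) ?_).2
  · rwa [integral_const_mul] at key
  · filter_upwards [ae_restrict_mem measurableSet_Ioi] with t ht w' _
    rw [norm_mul, norm_neg, norm_I, one_mul, norm_gammaKernel x w' (le_of_lt ht)]
  · filter_upwards [ae_restrict_mem measurableSet_Ioi] with t ht w' _
    have h2 : HasDerivAt (fun w : ℝ => cexp (-((1 + I * w) * t)))
        (cexp (-((1 + I * w') * t)) * (-((I * 1) * t))) w' :=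
      ((((ofRealCLM.hasDerivAt (x := w')).const_mul I).const_add 1).mul_const (t : ℂ)).neg.cexp
    refine (h2.const_mul ((t ^ (x - 1) : ℝ) : ℂ)).congr_deriv ?_
    have : t ^ x = t ^ (x - 1) * t := by
      rw [Real.rpow_sub_one (ne_of_gt ht)]; field_simp [ne_of_gt (mem_Ioi.1 ht)]
    simp only [gammaKernel, this]; push_cast; ring

/-- The product of the integral with (1 + iw)^x has zero derivative in w: differentiating under the
integral raises the exponent of t, and the integration by parts `gammaKernel_recurrence` lowers it
again. At w = 0 the value is Euler's integral. -/
lemma integral_gammaKernel {x : ℝ} (hx : 0 < x) (w : ℝ) :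
    ∫ t in Ioi 0, gammaKernel (x - 1) w t = Real.Gamma x * (1 + I * w) ^ (-(x : ℂ)) := by
  have hd : ∀ w : ℝ, HasDerivAt
      (fun w : ℝ => (∫ t in Ioi 0, gammaKernel (x - 1) w t) * (1 + I * w) ^ (x : ℂ)) 0 w := by
    intro w
    have h1 : HasDerivAt (fun w : ℝ => 1 + I * (w : ℂ)) (I * 1) w :=
      ((ofRealCLM.hasDerivAt (x := w)).const_mul I).const_add 1
    have h2 : HasDerivAt (fun w : ℝ => (1 + I * (w : ℂ)) ^ (x : ℂ))
        (x * (1 + I * (w : ℂ)) ^ ((x : ℂ) - 1) * (I * 1)) w := by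
      have := ((hasDerivAt_id (1 + I * (w : ℂ))).cpow_const (c := (x : ℂ))
        (one_add_I_mul_mem w)).comp w h1
      simpa [Function.comp_def] using this
    refine ((hasDerivAt_integral_gammaKernel hx w).mul h2).congr_deriv ?_
    have hne := slitPlane_ne_zero (one_add_I_mul_mem w)
    have e : (1 + I * (w : ℂ)) ^ (x : ℂ) =
        (1 + I * (w : ℂ)) ^ ((x : ℂ) - 1) * (1 + I * (w : ℂ)) := by
      rw [cpow_sub _ _ hne, cpow_one]; field_simp
    rw [e]
    linear_combination (-I * (1 + I * (w : ℂ)) ^ ((x : ℂ) - 1)) * gammaKernel_recurrence hx w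
  have hc := is_const_of_deriv_eq_zero (fun w => (hd w).differentiableAt)
    (fun w => (hd w).deriv) w 0
  have h0 : ∫ t in Ioi 0, gammaKernel (x - 1) 0 t = Real.Gamma x := by
    rw [Real.Gamma_eq_integral hx, ← integral_complex_ofReal]
    refine setIntegral_congr_fun measurableSet_Ioi fun t ht => ?_
    simp [gammaKernel]; ring
  simp only [h0, ofReal_zero, mul_zero, add_zero, one_cpow, mul_one] at hc
  rw [← hc, mul_assoc, ← cpow_add _ _ (slitPlane_ne_zero (one_add_I_mul_mem w))]
  simp

/-- The unnormalised Gamma density on the line. -/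
def gammaDens (x t : ℝ) : ℂ := if 0 < t then gammaKernel (x - 1) 0 t else 0

lemma gammaDens_eq_indicator (x : ℝ) : gammaDens x = (Ioi 0).indicator (gammaKernel (x - 1) 0) := by
  ext t; simp [gammaDens, indicator]

lemma integrable_gammaDens {x : ℝ} (hx : 0 < x) : Integrable (gammaDens x) := by
  rw [gammaDens_eq_indicator, integrable_indicator_iff measurableSet_Ioi]
  exact integrableOn_gammaKernel (by linarith) 0

lemma continuous_gammaDens {x : ℝ} (hx : 1 < x) : Continuous (gammaDens x) := by
  have h : gammaDens x = fun t : ℝ => (((max t 0) ^ (x - 1) : ℝ) : ℂ) * cexp (-t) := by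
    ext t
    unfold gammaDens gammaKernel
    split_ifs with h
    · simp [max_eq_left h.le]
    · simp [max_eq_right (not_lt.1 h), Real.zero_rpow (by linarith : x - 1 ≠ 0)]
  rw [h]
  have : Continuous fun t : ℝ => (max t 0) ^ (x - 1) :=
    (continuous_id.max continuous_const).rpow_const fun t => Or.inr (by linarith)
  exact (continuous_ofReal.comp this).mul (by fun_prop)

lemma fourier_gammaDens {x : ℝ} (hx : 0 < x) (w : ℝ) :
    𝓕 (gammaDens x) w = Real.Gamma x * (1 + I * ((2 * Real.pi * w : ℝ) : ℂ)) ^ (-(x : ℂ)) := by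
  rw [← integral_gammaKernel hx, Real.fourier_real_eq_integral_exp_smul, gammaDens_eq_indicator,
    ← integral_indicator measurableSet_Ioi]
  congr 1; ext t
  by_cases h : t ∈ Ioi (0 : ℝ)
  · rw [indicator_of_mem h, indicator_of_mem h]
    simp only [gammaKernel, smul_eq_mul]
    rw [mul_left_comm, ← Complex.exp_add]
    congr 2; push_cast; ring
  · rw [indicator_of_notMem h, indicator_of_notMem h, smul_zero]

lemma one_add_I_mul_cpow_integrable {x : ℝ} (hx : 1 < x) :
    Integrable fun w : ℝ => (1 + I * (w : ℂ)) ^ (-(x : ℂ)) := by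
  have := integrable_rpow_neg_one_add_norm_sq (E := ℝ) (μ := volume) (r := x) (by simpa using hx)
  have hc : Continuous fun w : ℝ => (1 + I * (w : ℂ)) ^ (-(x : ℂ)) :=
    Continuous.cpow (by fun_prop) continuous_const one_add_I_mul_mem
  refine this.mono' hc.aestronglyMeasurable (ae_of_all _ fun v => le_of_eq ?_)
  have e : ‖1 + I * (v : ℂ)‖ ^ 2 = 1 + ‖v‖ ^ 2 := by
    rw [← normSq_eq_norm_sq, normSq_apply]; simp; ring
  rw [← ofReal_neg, norm_cpow_real, ← e, ← Real.rpow_natCast, ← Real.rpow_mul (norm_nonneg _)]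
  congr 1; push_cast; ring

/-- Parseval in bilinear form: the transform is moved from one factor to the other and undone there
by Fourier inversion. For y > 1 the density is continuous and its transform integrable, so inversion
holds at every point. -/
lemma integral_fourier_gammaDens {x y : ℝ} (hx : 1 < x) (hy : 1 < y) :
    ∫ w : ℝ, 𝓕 (gammaDens x) w * 𝓕 (gammaDens y) (-w) = ∫ t : ℝ, gammaDens x t * gammaDens y t := by
  have hF : Integrable (𝓕 (gammaDens y)) := by
    have : 𝓕 (gammaDens y) = fun w => Real.Gamma y * (1 + I * ((2 * Real.pi * w : ℝ) : ℂ)) ^ (-(y : ℂ)) :=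
      funext fun w => fourier_gammaDens (by linarith) w
    rw [this]
    exact ((one_add_I_mul_cpow_integrable hy).comp_mul_left' (by positivity)).const_mul _
  have hG : Integrable (fun w => 𝓕 (gammaDens y) (-w)) := hF.comp_neg
  have h1 : (fun w => 𝓕 (gammaDens y) (-w)) = 𝓕⁻ (gammaDens y) := by
    ext w; rw [Real.fourierInv_eq_fourier_neg]
  have key := VectorFourier.integral_fourierIntegral_smul_eq_flip (L := innerₗ ℝ) (F := ℂ)
    (μ := volume) (ν := volume)
    Real.continuous_fourierChar continuous_inner (integrable_gammaDens (by linarith : 0 < x)) hG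
  have h2 : 𝓕 (fun w => 𝓕 (gammaDens y) (-w)) = gammaDens y := by
    rw [h1]
    exact (continuous_gammaDens hy).fourier_fourierInv_eq (integrable_gammaDens (by linarith)) hF
  simp only [smul_eq_mul, flip_innerₗ] at key
  change ∫ w : ℝ, 𝓕 (gammaDens x) w * 𝓕 (gammaDens y) (-w) =
    ∫ t : ℝ, gammaDens x t * 𝓕 (fun w => 𝓕 (gammaDens y) (-w)) t at key
  rw [key, h2]

lemma integral_gammaDens_mul {x y : ℝ} (hxy : 1 < x + y) :
    ∫ t : ℝ, gammaDens x t * gammaDens y t =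
      ((2 ^ (1 - x - y) * Real.Gamma (x + y - 1) : ℝ) : ℂ) := by
  have h := Real.integral_rpow_mul_exp_neg_mul_Ioi (by linarith : 0 < x + y - 1) two_pos
  have e : ((1 : ℝ) / 2) ^ (x + y - 1) = 2 ^ (1 - x - y) := by
    rw [one_div, Real.inv_rpow two_pos.le, ← Real.rpow_neg two_pos.le]; congr 1; ring
  rw [← e, ← h, ← integral_complex_ofReal, ← integral_indicator measurableSet_Ioi]
  congr 1; ext t
  by_cases ht : 0 < t
  · rw [indicator_of_mem (mem_Ioi.2 ht)]
    simp only [gammaDens, gammaKernel, ht, if_true]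
    have e1 : t ^ (x + y - 1 - 1) = t ^ (x - 1) * t ^ (y - 1) := by
      rw [← Real.rpow_add ht]; congr 1; ring
    have e2 : cexp (-(2 * t)) = cexp (-t) * cexp (-t) := by rw [← Complex.exp_add]; congr 1; ring
    rw [e1]; push_cast; rw [e2]; simp; ring
  · rw [indicator_of_notMem (by simpa using ht)]
    simp [gammaDens, ht]

lemma I_mul_cpow {z : ℂ} (hz : 0 < z.re) (c : ℂ) :
    (I * z) ^ c = cexp (Real.pi / 2 * I * c) * z ^ c := by
  have hz0 : z ≠ 0 := fun h => by simp [h] at hz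
  have h1 := abs_arg_lt_pi_div_two_iff.2 (Or.inl hz)
  rw [abs_lt] at h1
  have hl : log (I * z) = Real.pi / 2 * I + log z := by
    rw [log_mul I_ne_zero hz0, log_I]
    rw [arg_I]
    constructor <;> linarith [Real.pi_pos]
  rw [cpow_def_of_ne_zero (mul_ne_zero I_ne_zero hz0), cpow_def_of_ne_zero hz0, hl,
    ← Complex.exp_add]
  ring_nf

/-- Since v + i = i(1 - iv), the powers of i combine to the phase e^{iπ(y-x)/2}; what remains is, up
to Gamma factors and scaling, a product of two transforms of Gamma densities. -/
lemma upow_add_I (x y v : ℝ) :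
    upow x y (v + I) = cexp (I * ((Real.pi / 2 * (y - x) : ℝ) : ℂ)) *
      ((1 + I * ((-v : ℝ) : ℂ)) ^ (-(x : ℂ)) * (1 + I * (v : ℂ)) ^ (-(y : ℂ))) := by
  have e1 : (v : ℂ) + I = I * (1 + I * ((-v : ℝ) : ℂ)) := by
    push_cast; linear_combination (v : ℂ) * I_mul_I
  have hre : 0 < (1 + I * ((-v : ℝ) : ℂ)).re := by simp
  have hm := one_add_I_mul_mem (-v)
  have hm' := one_add_I_mul_mem v
  have e2 : (1 + I * (v : ℂ)) ^ (-(y : ℂ)) =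
      conj ((1 + I * ((-v : ℝ) : ℂ)) ^ (-(y : ℂ))) := by
    have : (1 + I * (v : ℂ)) = conj (1 + I * ((-v : ℝ) : ℂ)) := by simp
    rw [this, conj_cpow _ _ (mem_slitPlane_iff_arg.1 hm).1]
    simp
  rw [e2, upow, conj_cpow _ _ (mem_slitPlane_iff_arg.1 (add_I_mem v)).1, e1]
  simp only [map_neg, conj_ofReal]
  rw [I_mul_cpow hre, I_mul_cpow hre, map_mul, ← exp_conj]
  have e3 : cexp (I * ((Real.pi / 2 * (y - x) : ℝ) : ℂ)) =
      cexp (Real.pi / 2 * I * (-x)) * cexp (conj (Real.pi / 2 * I * (-(y : ℂ)))) := by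
    rw [← Complex.exp_add]; congr 1
    simp [conj_ofNat]; ring
  rw [e3]; ring

/-- The value of the complete integral. -/
def betaVal (x y : ℝ) : ℂ :=
  Real.pi * cexp (I * ((Real.pi / 2 * (y - x) : ℝ) : ℂ)) *
    ((2 ^ (2 - x - y) * Real.Gamma (x + y - 1) * ((Real.Gamma x)⁻¹ * (Real.Gamma y)⁻¹) : ℝ) : ℂ)

lemma lineInt_eq_of_one_lt {x y : ℝ} (hx : 1 < x) (hy : 1 < y) : lineInt x y = betaVal x y := by
  have h := (integral_fourier_gammaDens hx hy).trans (integral_gammaDens_mul (by linarith))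
  have hG : (Real.Gamma x : ℂ) ≠ 0 := ofReal_ne_zero.2 (Real.Gamma_pos_of_pos (by linarith)).ne'
  have hG' : (Real.Gamma y : ℂ) ≠ 0 := ofReal_ne_zero.2 (Real.Gamma_pos_of_pos (by linarith)).ne'
  set g : ℝ → ℂ := fun v => (1 + I * (v : ℂ)) ^ (-(x : ℂ)) * (1 + I * ((-v : ℝ) : ℂ)) ^ (-(y : ℂ))
    with hg
  have e1 : ∀ w : ℝ, 𝓕 (gammaDens x) w * 𝓕 (gammaDens y) (-w) =
      (Real.Gamma x * Real.Gamma y) * g ((2 * Real.pi) * w) := by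
    intro w
    rw [fourier_gammaDens (by linarith), fourier_gammaDens (by linarith), hg]
    simp only [mul_neg]; ring
  simp_rw [e1] at h
  rw [integral_const_mul, Measure.integral_comp_mul_left, abs_of_pos (by positivity)] at h
  have e2 : lineInt x y = cexp (I * ((Real.pi / 2 * (y - x) : ℝ) : ℂ)) * ∫ v, g v := by
    rw [lineInt, ← integral_neg_eq_self, ← integral_const_mul]
    congr 1; ext v
    rw [upow_add_I, hg]; simp
  have e3 : (2 : ℝ) ^ (2 - x - y) = 2 * 2 ^ (1 - x - y) := by
    rw [show 2 - x - y = 1 + (1 - x - y) by ring, Real.rpow_add two_pos, Real.rpow_one]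
  have hpi : (Real.pi : ℂ) ≠ 0 := ofReal_ne_zero.2 Real.pi_ne_zero
  rw [e2, betaVal, e3]
  rw [real_smul] at h
  push_cast at h ⊢
  field_simp at h ⊢
  linear_combination h

/-- `Real.Gamma` takes the value 0 at its poles, so its inverse is the entire function 1/Γ and the
functional equation has no exceptional points. All formulas below therefore use inverses of Gamma.
-/
lemma inv_Gamma_eq (x : ℝ) : (Real.Gamma x)⁻¹ = x * (Real.Gamma (x + 1))⁻¹ := by
  rcases eq_or_ne x 0 with rfl | h
  · simp
  · rw [Real.Gamma_add_one h]
    field_simp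

lemma betaVal_succ_left {x y : ℝ} (h : 1 < x + y) :
    ((x + y - 1 : ℝ) : ℂ) * betaVal x y = 2 * I * x * betaVal (x + 1) y := by
  have e1 : cexp (I * ((Real.pi / 2 * (y - (x + 1)) : ℝ) : ℂ)) =
      -I * cexp (I * ((Real.pi / 2 * (y - x) : ℝ) : ℂ)) := by
    rw [show I * ((Real.pi / 2 * (y - (x + 1)) : ℝ) : ℂ) =
      I * ((Real.pi / 2 * (y - x) : ℝ) : ℂ) + -(Real.pi / 2 * I) by push_cast; ring,
      Complex.exp_add, Complex.exp_neg, exp_pi_div_two_mul_I, inv_I]; ring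
  have e2 : (2 : ℝ) ^ (2 - x - y) = 2 * 2 ^ (2 - (x + 1) - y) := by
    rw [show 2 - x - y = 1 + (2 - (x + 1) - y) by ring, Real.rpow_add two_pos, Real.rpow_one]
  have e3 : Real.Gamma (x + 1 + y - 1) = (x + y - 1) * Real.Gamma (x + y - 1) := by
    rw [← Real.Gamma_add_one (by linarith)]; congr 1; ring
  rw [betaVal, betaVal, e1, e2, e3, inv_Gamma_eq x]
  push_cast
  ring_nf
  simp only [I_sq]
  ring

lemma betaVal_succ_right {x y : ℝ} (h : 1 < x + y) :
    ((x + y - 1 : ℝ) : ℂ) * betaVal x y = -(2 * I * y * betaVal x (y + 1)) := by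
  have e1 : cexp (I * ((Real.pi / 2 * (y + 1 - x) : ℝ) : ℂ)) =
      I * cexp (I * ((Real.pi / 2 * (y - x) : ℝ) : ℂ)) := by
    rw [show I * ((Real.pi / 2 * (y + 1 - x) : ℝ) : ℂ) =
      I * ((Real.pi / 2 * (y - x) : ℝ) : ℂ) + (Real.pi / 2 * I) by push_cast; ring,
      Complex.exp_add, exp_pi_div_two_mul_I]; ring
  have e2 : (2 : ℝ) ^ (2 - x - y) = 2 * 2 ^ (2 - x - (y + 1)) := by
    rw [show 2 - x - y = 1 + (2 - x - (y + 1)) by ring, Real.rpow_add two_pos, Real.rpow_one]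
  have e3 : Real.Gamma (x + (y + 1) - 1) = (x + y - 1) * Real.Gamma (x + y - 1) := by
    rw [← Real.Gamma_add_one (by linarith)]; congr 1; ring
  rw [betaVal, betaVal, e1, e2, e3, inv_Gamma_eq y]
  push_cast
  ring_nf
  simp only [I_sq]
  ring

/-- Both sides obey the same two recurrences, with the nonzero factor x + y - 1. They propagate the
identity from x, y > 1 to the half plane x + y > 1; n counts the unit steps. -/
lemma lineInt_eq_aux (n : ℕ) : ∀ x y : ℝ, 1 < x + y → 1 < x + n → 1 < y + n →
    lineInt x y = betaVal x y := by
  induction n with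
  | zero => intro x y _ hx hy; exact lineInt_eq_of_one_lt (by simpa using hx) (by simpa using hy)
  | succ n ih =>
    intro x y h hx hy
    push_cast at hx hy
    have h1 : lineInt (x + 1) y = betaVal (x + 1) y := by
      have hne : ((x + 1 + y - 1 : ℝ) : ℂ) ≠ 0 := ofReal_ne_zero.2 (by linarith)
      apply mul_left_cancel₀ hne
      rw [lineInt_succ_right (by linarith), betaVal_succ_right (by linarith),
        ih (x + 1) (y + 1) (by linarith) (by linarith) (by linarith)]
    have hne : ((x + y - 1 : ℝ) : ℂ) ≠ 0 := ofReal_ne_zero.2 (by linarith)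
    apply mul_left_cancel₀ hne
    rw [lineInt_succ_left h, betaVal_succ_left h, h1]

theorem lineInt_eq {x y : ℝ} (h : 1 < x + y) : lineInt x y = betaVal x y := by
  obtain ⟨n, hn⟩ := exists_nat_gt (max (1 - x) (1 - y))
  exact lineInt_eq_aux n x y h (by linarith [le_max_left (1 - x) (1 - y)])
    (by linarith [le_max_right (1 - x) (1 - y)])

/-! ### Differentiation under the integral sign, including one-sided derivatives at end points. -/

/-- A set of reals which around each of its points looks like a nontrivial closed interval. -/
def LocIcc (S : Set ℝ) : Prop :=
  ∀ s ∈ S, ∃ a b : ℝ, a < b ∧ s ∈ Icc a b ∧ Icc a b ⊆ S ∧ Icc a b ∈ 𝓝[S] s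

lemma locIcc_Ioi : LocIcc (Ioi 0) := by
  intro s hs
  have hs' : 0 < s := hs
  refine ⟨s / 2, 2 * s, by linarith, ⟨by linarith, by linarith⟩, fun t ht => ?_, ?_⟩
  · exact lt_of_lt_of_le (by linarith) ht.1
  · exact mem_nhdsWithin_of_mem_nhds (Icc_mem_nhds (by linarith) (by linarith))

lemma locIcc_punctured : LocIcc punctured := by
  rintro s (hs | hs)
  · refine ⟨-1, s / 2, by linarith [hs.1, hs.2], ⟨hs.1, by linarith [hs.2]⟩,
      fun t ht => Or.inl ⟨ht.1, by linarith [ht.2, hs.2]⟩, ?_⟩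
    filter_upwards [self_mem_nhdsWithin,
      mem_nhdsWithin_of_mem_nhds (Iio_mem_nhds (by linarith [hs.2] : s < s / 2))] with t ht ht'
    refine ⟨?_, le_of_lt ht'⟩
    rcases ht with h | h
    · exact h.1
    · linarith [h.1]
  · refine ⟨s / 2, 1, by linarith [hs.1, hs.2], ⟨by linarith [hs.1], hs.2⟩,
      fun t ht => Or.inr ⟨by linarith [ht.1, hs.1], ht.2⟩, ?_⟩
    filter_upwards [self_mem_nhdsWithin,
      mem_nhdsWithin_of_mem_nhds (Ioi_mem_nhds (by linarith [hs.1] : s / 2 < s))] with t ht ht'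
    refine ⟨le_of_lt ht', ?_⟩
    rcases ht with h | h
    · linarith [h.2]
    · exact h.2

/-- The extension of a function from a rectangle by projection. -/
def rectExt (a b : ℝ) (F : ℝ → ℝ → ℂ) (s u : ℝ) : ℂ :=
  F (max a (min b s)) (max (-1) (min 1 u))

lemma rectExt_eq {a b : ℝ} (F : ℝ → ℝ → ℂ) {s u : ℝ} (hs : s ∈ Icc a b)
    (hu : u ∈ Icc (-1 : ℝ) 1) : rectExt a b F s u = F s u := by
  rw [rectExt, min_eq_right hs.2, max_eq_right hs.1, min_eq_right hu.2, max_eq_right hu.1]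

lemma continuous_rectExt {a b : ℝ} (hab : a < b) {F : ℝ → ℝ → ℂ}
    (hF : ContinuousOn (fun p : ℝ × ℝ => F p.1 p.2) (Icc a b ×ˢ Icc (-1) 1)) :
    Continuous (fun p : ℝ × ℝ => rectExt a b F p.1 p.2) := by
  have : Continuous fun p : ℝ × ℝ => (max a (min b p.1), max (-1 : ℝ) (min 1 p.2)) := by fun_prop
  refine hF.comp_continuous this fun p => ⟨⟨le_max_left _ _, ?_⟩, ⟨le_max_left _ _, ?_⟩⟩
  · exact max_le hab.le (min_le_left _ _)
  · exact max_le (by norm_num) (min_le_left _ _)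

lemma intervalIntegral_rectExt {a b : ℝ} (F : ℝ → ℝ → ℂ) {s : ℝ} (hs : s ∈ Icc a b) :
    ∫ u in (-1 : ℝ)..1, rectExt a b F s u = ∫ u in (-1 : ℝ)..1, F s u := by
  refine intervalIntegral.integral_congr fun u hu => ?_
  rw [uIcc_of_le (by norm_num)] at hu
  exact rectExt_eq F hs hu

lemma continuousOn_Icc_param {a b : ℝ} (hab : a < b) {F : ℝ → ℝ → ℂ}
    (hF : ContinuousOn (fun p : ℝ × ℝ => F p.1 p.2) (Icc a b ×ˢ Icc (-1) 1)) :
    ContinuousOn (fun s => ∫ u in (-1 : ℝ)..1, F s u) (Icc a b) := by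
  have := intervalIntegral.continuous_parametric_intervalIntegral_of_continuous' (μ := volume)
    (f := rectExt a b F) (continuous_rectExt hab hF) (-1) 1
  exact this.continuousOn.congr fun s hs => (intervalIntegral_rectExt F hs).symm

/-- The fundamental theorem of calculus in s followed by Fubini exhibits the integral as a primitive
of the integral of F', which handles the end points a and b as well. Projection onto the rectangle
supplies integrands continuous on the whole plane. -/
lemma hasDerivWithinAt_Icc_param {a b : ℝ} (hab : a < b) {F F' : ℝ → ℝ → ℂ}
    (hF : ContinuousOn (fun p : ℝ × ℝ => F p.1 p.2) (Icc a b ×ˢ Icc (-1) 1))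
    (hF' : ContinuousOn (fun p : ℝ × ℝ => F' p.1 p.2) (Icc a b ×ˢ Icc (-1) 1))
    (hd : ∀ u ∈ Icc (-1 : ℝ) 1, ∀ s ∈ Icc a b,
      HasDerivWithinAt (fun s => F s u) (F' s u) (Icc a b) s) {s : ℝ} (hs : s ∈ Icc a b) :
    HasDerivWithinAt (fun s => ∫ u in (-1 : ℝ)..1, F s u) (∫ u in (-1 : ℝ)..1, F' s u)
      (Icc a b) s := by
  have hc := continuous_rectExt hab hF
  have hc' := continuous_rectExt hab hF'
  have hi := intervalIntegral.continuous_parametric_intervalIntegral_of_continuous' (μ := volume)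
    (f := rectExt a b F') hc' (-1) 1
  have hint : ∀ t : ℝ, IntervalIntegrable (fun u => rectExt a b F t u) volume (-1) 1 := fun t =>
    (hc.comp (Continuous.prodMk_right t)).intervalIntegrable _ _
  have key : ∀ t ∈ Icc a b, (∫ u in (-1 : ℝ)..1, F t u) = (∫ u in (-1 : ℝ)..1, F a u) +
      ∫ r in a..t, ∫ u in (-1 : ℝ)..1, rectExt a b F' r u := by
    intro t ht
    have e1 : ∀ u ∈ uIcc (-1 : ℝ) 1, ∫ r in a..t, rectExt a b F' r u =
        rectExt a b F t u - rectExt a b F a u := by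
      intro u hu
      rw [uIcc_of_le (by norm_num)] at hu
      refine intervalIntegral.integral_eq_sub_of_hasDerivAt_of_le
        (f := fun r => rectExt a b F r u) ht.1 ?_ ?_ ?_
      · exact (hc.comp (Continuous.prodMk_left u)).continuousOn
      · intro r hr
        have hr' : r ∈ Icc a b := ⟨hr.1.le, hr.2.le.trans ht.2⟩
        have hn : Icc a b ∈ 𝓝 r := Icc_mem_nhds hr.1 (hr.2.trans_le ht.2)
        rw [rectExt_eq F' hr' hu]
        refine ((hd u hu r hr').hasDerivAt hn).congr_of_eventuallyEq ?_
        filter_upwards [hn] with x hx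
        exact rectExt_eq F hx hu
      · exact (hc'.comp (Continuous.prodMk_left u)).intervalIntegrable _ _
    have hsw : IntegrableOn (Function.uncurry (rectExt a b F')) (uIoc a t ×ˢ uIoc (-1) 1) :=
      (hc'.continuousOn.integrableOn_compact (isCompact_uIcc.prod isCompact_uIcc)).mono_set
        (prod_mono uIoc_subset_uIcc uIoc_subset_uIcc)
    rw [intervalIntegral_intervalIntegral_swap hsw, intervalIntegral.integral_congr e1, intervalIntegral.integral_sub (hint t) (hint a),
      intervalIntegral_rectExt F ht, intervalIntegral_rectExt F (left_mem_Icc.2 hab.le)]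
    ring
  have h1 := ((Continuous.integral_hasStrictDerivAt hi a s).hasDerivAt.const_add
    (∫ u in (-1 : ℝ)..1, F a u)).hasDerivWithinAt (s := Icc a b)
  rw [intervalIntegral_rectExt F' hs] at h1
  exact h1.congr key (key s hs)

lemma LocIcc.continuousOn_param {S : Set ℝ} (hS : LocIcc S) {F : ℝ → ℝ → ℂ}
    (hF : ContinuousOn (fun p : ℝ × ℝ => F p.1 p.2) (S ×ˢ Icc (-1) 1)) :
    ContinuousOn (fun s => ∫ u in (-1 : ℝ)..1, F s u) S := by
  intro s hs
  obtain ⟨a, b, hab, hs', hsub, hn⟩ := hS s hs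
  exact (continuousOn_Icc_param hab (hF.mono (prod_mono_left hsub)) s hs').mono_of_mem_nhdsWithin hn

lemma LocIcc.hasDerivWithinAt_param {S : Set ℝ} (hS : LocIcc S) {F F' : ℝ → ℝ → ℂ}
    (hF : ContinuousOn (fun p : ℝ × ℝ => F p.1 p.2) (S ×ˢ Icc (-1) 1))
    (hF' : ContinuousOn (fun p : ℝ × ℝ => F' p.1 p.2) (S ×ˢ Icc (-1) 1))
    (hd : ∀ u ∈ Icc (-1 : ℝ) 1, ∀ s ∈ S, HasDerivWithinAt (fun s => F s u) (F' s u) S s)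
    {s : ℝ} (hs : s ∈ S) :
    HasDerivWithinAt (fun s => ∫ u in (-1 : ℝ)..1, F s u) (∫ u in (-1 : ℝ)..1, F' s u) S s := by
  obtain ⟨a, b, hab, hs', hsub, hn⟩ := hS s hs
  exact (hasDerivWithinAt_Icc_param hab (hF.mono (prod_mono_left hsub))
    (hF'.mono (prod_mono_left hsub)) (fun u hu t ht => (hd u hu t (hsub ht)).mono hsub)
    hs').mono_of_mem_nhdsWithin hn

/-! ### Segment integrals, their derivatives and their asymptotics as s → 0. -/

/-- The integral of `upow x y` over the segment `[-1, 1] + i s`. -/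
def segInt (x y s : ℝ) : ℂ := ∫ u in (-1 : ℝ)..1, upow x y (u + s * I)

lemma add_mul_I_mem (u : ℝ) {s : ℝ} (hs : 0 < s) : (u : ℂ) + s * I ∈ slitPlane :=
  mem_slitPlane_of_im_pos (by simpa using hs)

lemma hasDerivAt_upow_vert (x y u : ℝ) {s : ℝ} (hs : 0 < s) :
    HasDerivAt (fun s : ℝ => upow x y (u + s * I))
      (-x * upow (x + 1) y (u + s * I) * I + y * upow x (y + 1) (u + s * I) * I) s := by
  have h : HasDerivAt (fun s : ℝ => (u : ℂ) + s * I) (1 * I) s :=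
    ((ofRealCLM.hasDerivAt (x := s)).mul_const I).const_add (u : ℂ)
  refine (hasDerivAt_upow x y h (add_mul_I_mem u hs)).congr_deriv ?_
  simp

lemma hasDerivAt_upow_horiz (x y u : ℝ) {s : ℝ} (hs : 0 < s) :
    HasDerivAt (fun u : ℝ => upow x y (u + s * I))
      (-x * upow (x + 1) y (u + s * I) - y * upow x (y + 1) (u + s * I)) u := by
  have h : HasDerivAt (fun u : ℝ => (u : ℂ) + s * I) 1 u :=
    (ofRealCLM.hasDerivAt (x := u)).add_const _
  refine (hasDerivAt_upow x y h (add_mul_I_mem u hs)).congr_deriv ?_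
  simp

lemma continuous_upow_horiz (x y : ℝ) {s : ℝ} (hs : 0 < s) :
    Continuous fun u : ℝ => upow x y (u + s * I) :=
  (continuousOn_upow x y).comp_continuous (by fun_prop) fun u => add_mul_I_mem u hs

lemma continuousOn_upow_rect (x y : ℝ) :
    ContinuousOn (fun p : ℝ × ℝ => upow x y (p.2 + p.1 * I)) (Ioi 0 ×ˢ Icc (-1) 1) :=
  (continuousOn_upow x y).comp (by fun_prop) fun p hp => add_mul_I_mem p.2 hp.1

/-- The iterated derivatives of the boundary terms `upow x y (1 + i s) - upow x y (-1 + i s)`. -/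
def bdryDeriv : ℕ → ℝ → ℝ → ℝ → ℂ
  | 0, x, y, s => upow x y ((1 : ℝ) + s * I) - upow x y ((-1 : ℝ) + s * I)
  | i + 1, x, y, s => -x * I * bdryDeriv i (x + 1) y s + y * I * bdryDeriv i x (y + 1) s

/-- The iterated derivatives of `segInt x y`. -/
def segDeriv : ℕ → ℝ → ℝ → ℝ → ℂ
  | 0, x, y, s => segInt x y s
  | i + 1, x, y, s => -(2 * I * x) * segDeriv i (x + 1) y s - I * bdryDeriv i x y s

lemma hasDerivAt_bdryDeriv (i : ℕ) : ∀ (x y : ℝ) {s : ℝ}, 0 < s →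
    HasDerivAt (bdryDeriv i x y) (bdryDeriv (i + 1) x y s) s := by
  induction i with
  | zero =>
    intro x y s hs
    refine ((hasDerivAt_upow_vert x y 1 hs).sub (hasDerivAt_upow_vert x y (-1) hs)).congr_deriv ?_
    simp only [bdryDeriv]; ring
  | succ i ih =>
    intro x y s hs
    exact ((ih (x + 1) y hs).const_mul _).add ((ih x (y + 1) hs).const_mul _)

/-- On z^{-x} z̄^{-y} the vertical derivative equals -2ix z^{-x-1} z̄^{-y} minus i times the
horizontal one. The latter integrates to boundary terms, so a single segment integral, with x raised
by one, is left. -/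
lemma hasDerivAt_segInt (x y : ℝ) {s : ℝ} (hs : 0 < s) :
    HasDerivAt (segInt x y) (segDeriv 1 x y s) s := by
  have h := (locIcc_Ioi.hasDerivWithinAt_param (F := fun s u => upow x y (u + s * I))
    (F' := fun s u => -x * upow (x + 1) y (u + s * I) * I + y * upow x (y + 1) (u + s * I) * I)
    (continuousOn_upow_rect x y)
    (((continuousOn_const.mul (continuousOn_upow_rect (x + 1) y)).mul continuousOn_const).add
      ((continuousOn_const.mul (continuousOn_upow_rect x (y + 1))).mul continuousOn_const))
    (fun u _ s hs => (hasDerivAt_upow_vert x y u hs).hasDerivWithinAt) hs).hasDerivAt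
    (Ioi_mem_nhds hs)
  refine h.congr_deriv ?_
  have hc1 := continuous_upow_horiz (x + 1) y hs
  have hc2 := continuous_upow_horiz x (y + 1) hs
  have e := intervalIntegral.integral_eq_sub_of_hasDerivAt (a := (-1 : ℝ)) (b := 1)
    (fun u _ => hasDerivAt_upow_horiz x y u hs)
    (((hc1.const_mul _).sub (hc2.const_mul _)).intervalIntegrable _ _)
  have e2 : ∀ u : ℝ, -x * upow (x + 1) y (u + s * I) * I + y * upow x (y + 1) (u + s * I) * I =
      -(2 * I * x) * upow (x + 1) y (u + s * I) -
        I * (-x * upow (x + 1) y (u + s * I) - y * upow x (y + 1) (u + s * I)) := by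
    intro u; ring
  simp_rw [e2]
  rw [intervalIntegral.integral_sub, intervalIntegral.integral_const_mul,
    intervalIntegral.integral_const_mul, e]
  · rfl
  · exact (hc1.const_mul _).intervalIntegrable _ _
  · exact ((((hc1.const_mul _).sub (hc2.const_mul _))).const_mul _).intervalIntegrable _ _

lemma hasDerivAt_segDeriv (i : ℕ) : ∀ (x y : ℝ) {s : ℝ}, 0 < s →
    HasDerivAt (segDeriv i x y) (segDeriv (i + 1) x y s) s := by
  induction i with
  | zero => intro x y s hs; exact hasDerivAt_segInt x y hs
  | succ i ih =>
    intro x y s hs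
    exact ((ih (x + 1) y hs).const_mul _).sub ((hasDerivAt_bdryDeriv i x y hs).const_mul _)

/-- The points ±1 + is stay away from the singularity at 0, so boundary terms never contribute to
the blow-up. -/
lemma exists_bound_upow_side (x y a : ℝ) (ha : |a| = 1) :
    ∃ B : ℝ, ∀ s ∈ Ioc (0 : ℝ) 1, ‖upow x y (a + s * I)‖ ≤ B := by
  have hc : ContinuousOn (fun s : ℝ => (1 + s ^ 2) ^ (-(x + y) / 2)) (Icc 0 1) :=
    ContinuousOn.rpow_const (by fun_prop) fun s _ => Or.inl (by positivity)
  obtain ⟨B, hB⟩ := (isCompact_Icc.image_of_continuousOn hc).bddAbove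
  refine ⟨B, fun s hs => ?_⟩
  have e : ‖(a : ℂ) + s * I‖ ^ 2 = 1 + s ^ 2 := by
    rw [← normSq_eq_norm_sq, normSq_apply]; simp
    nlinarith [sq_abs a]
  rw [norm_upow x y (slitPlane_ne_zero (add_mul_I_mem a hs.1))]
  have : ‖(a : ℂ) + s * I‖ ^ (-(x + y)) = (1 + s ^ 2) ^ (-(x + y) / 2) := by
    rw [← e, ← Real.rpow_natCast, ← Real.rpow_mul (norm_nonneg _)]
    congr 1; push_cast; ring
  rw [this]
  exact hB ⟨s, ⟨hs.1.le, hs.2⟩, rfl⟩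

lemma exists_bound_bdryDeriv (i : ℕ) : ∀ x y : ℝ,
    ∃ B : ℝ, ∀ s ∈ Ioc (0 : ℝ) 1, ‖bdryDeriv i x y s‖ ≤ B := by
  induction i with
  | zero =>
    intro x y
    obtain ⟨B₁, h₁⟩ := exists_bound_upow_side x y 1 (by simp)
    obtain ⟨B₂, h₂⟩ := exists_bound_upow_side x y (-1) (by simp)
    exact ⟨B₁ + B₂, fun s hs => (norm_sub_le _ _).trans (add_le_add (h₁ s hs) (h₂ s hs))⟩
  | succ i ih =>
    intro x y
    obtain ⟨B₁, h₁⟩ := ih (x + 1) y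
    obtain ⟨B₂, h₂⟩ := ih x (y + 1)
    refine ⟨‖-(x : ℂ) * I‖ * B₁ + ‖(y : ℂ) * I‖ * B₂, fun s hs => (norm_add_le _ _).trans ?_⟩
    rw [norm_mul, norm_mul (_ * I)]
    gcongr
    · exact h₁ s hs
    · exact h₂ s hs

lemma upow_scaled (x y u : ℝ) {s : ℝ} (hs : 0 < s) :
    upow x y (u + s * I) = ((s ^ (-(x + y)) : ℝ) : ℂ) * upow x y (((u / s : ℝ) : ℂ) + I) := by
  rw [← upow_ofReal_mul x y hs (slitPlane_ne_zero (add_I_mem _))]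
  congr 1
  have : (s : ℂ) ≠ 0 := ofReal_ne_zero.2 hs.ne'
  push_cast; field_simp

lemma integrable_upow_horiz {x y : ℝ} (h : 1 < x + y) {s : ℝ} (hs : 0 < s) :
    Integrable fun u : ℝ => upow x y (u + s * I) := by
  simp_rw [upow_scaled x y _ hs]
  exact ((integrable_upow h).comp_div hs.ne').const_mul _

lemma integral_upow_horiz (x y : ℝ) {s : ℝ} (hs : 0 < s) :
    ∫ u : ℝ, upow x y (u + s * I) = ((s ^ (1 - x - y) : ℝ) : ℂ) * lineInt x y := by
  simp_rw [upow_scaled x y _ hs]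
  rw [integral_const_mul, Measure.integral_comp_div (fun v : ℝ => upow x y (v + I)), abs_of_pos hs,
    real_smul, lineInt, ← mul_assoc, ← ofReal_mul, ← Real.rpow_add_one hs.ne']
  congr 3; ring

/-- The integral over the whole line scales exactly in s. The missing part has |u| ≥ 1, where u² +
s² ≥ (1 + u²)/2 gives an integrable majorant independent of s. -/
lemma segInt_asymp {x y : ℝ} (h : 1 < x + y) : ∃ B : ℝ, ∀ s ∈ Ioc (0 : ℝ) 1,
    ‖segInt x y s - ((s ^ (1 - x - y) : ℝ) : ℂ) * lineInt x y‖ ≤ B := by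
  have hint := integrable_rpow_neg_one_add_norm_sq (E := ℝ) (μ := volume) (r := x + y)
    (by simpa using h)
  refine ⟨∫ u : ℝ in (Ioc (-1) 1)ᶜ, 2 ^ ((x + y) / 2) * (1 + ‖u‖ ^ 2) ^ (-(x + y) / 2),
    fun s hs => ?_⟩
  have hi := integrable_upow_horiz h hs.1
  rw [← integral_upow_horiz x y hs.1, segInt, intervalIntegral.integral_of_le (by norm_num),
    ← integral_add_compl measurableSet_Ioc hi, sub_add_cancel_left, norm_neg]
  refine norm_integral_le_of_norm_le (hint.const_mul _).integrableOn ?_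
  filter_upwards [ae_restrict_mem measurableSet_Ioc.compl] with u hu
  have hu1 : 1 ≤ u ^ 2 := by
    by_contra hlt
    have := abs_lt.1 ((sq_lt_one_iff_abs_lt_one u).1 (not_le.1 hlt))
    exact hu ⟨this.1, this.2.le⟩
  have e : ‖(u : ℂ) + s * I‖ ^ 2 = u ^ 2 + s ^ 2 := by
    rw [← normSq_eq_norm_sq, normSq_apply]; simp; ring
  have e2 : ‖(u : ℂ) + s * I‖ ^ (-(x + y)) = (u ^ 2 + s ^ 2) ^ (-(x + y) / 2) := by
    rw [← e, ← Real.rpow_natCast, ← Real.rpow_mul (norm_nonneg _)]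
    congr 1; push_cast; ring
  rw [norm_upow x y (slitPlane_ne_zero (add_mul_I_mem u hs.1)), e2, Real.norm_eq_abs, sq_abs]
  have e3 : (2 : ℝ) ^ ((x + y) / 2) = (1 / 2) ^ (-(x + y) / 2) := by
    rw [one_div, Real.inv_rpow two_pos.le, ← Real.rpow_neg two_pos.le]; congr 1; ring
  rw [e3, ← Real.mul_rpow (by norm_num) (by positivity)]
  exact Real.rpow_le_rpow_of_nonpos (by positivity) (by nlinarith [sq_nonneg s]) (by linarith)

/-- The coefficient of the leading term of `segDeriv N x y`. -/
def asymCoef (N : ℕ) (x y : ℝ) : ℂ :=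
  (-1) ^ N * (Real.pi * cexp (I * ((Real.pi / 2 * (y - x) : ℝ) : ℂ)) *
    ((2 ^ (2 - x - y) * Real.Gamma (x + y + N - 1) *
      ((Real.Gamma x)⁻¹ * (Real.Gamma y)⁻¹) : ℝ) : ℂ))

lemma asymCoef_zero (x y : ℝ) : asymCoef 0 x y = betaVal x y := by
  simp [asymCoef, betaVal]

/-- Trading one derivative for one unit of x leaves Γ(x + y + N - 1) unchanged, so only the
functional equation of 1/Γ at x is used, and no condition on x + y appears. -/
lemma asymCoef_succ (N : ℕ) (x y : ℝ) :
    asymCoef (N + 1) x y = -(2 * I * x) * asymCoef N (x + 1) y := by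
  have e1 : cexp (I * ((Real.pi / 2 * (y - (x + 1)) : ℝ) : ℂ)) =
      -I * cexp (I * ((Real.pi / 2 * (y - x) : ℝ) : ℂ)) := by
    rw [show I * ((Real.pi / 2 * (y - (x + 1)) : ℝ) : ℂ) =
      I * ((Real.pi / 2 * (y - x) : ℝ) : ℂ) + -(Real.pi / 2 * I) by push_cast; ring,
      Complex.exp_add, Complex.exp_neg, exp_pi_div_two_mul_I, inv_I]; ring
  have e2 : (2 : ℝ) ^ (2 - x - y) = 2 * 2 ^ (2 - (x + 1) - y) := by
    rw [show 2 - x - y = 1 + (2 - (x + 1) - y) by ring, Real.rpow_add two_pos, Real.rpow_one]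
  have e3 : x + y + ((N + 1 : ℕ) : ℝ) - 1 = x + 1 + y + N - 1 := by push_cast; ring
  rw [asymCoef, asymCoef, e1, e2, e3, inv_Gamma_eq x, pow_succ]
  push_cast
  ring_nf
  simp only [I_sq]
  ring

/-- Each differentiation raises x by one up to a bounded term, and N of them bring the exponents
into the range where the line integral converges. The expansion is thus available even when x + y ≤
1 and Γ(x + y - 1) may have a pole. -/
lemma segDeriv_asymp (N : ℕ) : ∀ {x y : ℝ}, 1 < x + y + N → ∃ B : ℝ, ∀ s ∈ Ioc (0 : ℝ) 1,
    ‖segDeriv N x y s - ((s ^ (1 - x - y - N) : ℝ) : ℂ) * asymCoef N x y‖ ≤ B := by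
  induction N with
  | zero =>
    intro x y h
    obtain ⟨B, hB⟩ := segInt_asymp (x := x) (y := y) (by simpa using h)
    refine ⟨B, fun s hs => ?_⟩
    rw [asymCoef_zero, ← lineInt_eq (by simpa using h)]
    simpa [segDeriv] using hB s hs
  | succ N ih =>
    intro x y h
    push_cast at h
    obtain ⟨B, hB⟩ := ih (x := x + 1) (y := y) (by linarith)
    obtain ⟨B', hB'⟩ := exists_bound_bdryDeriv N x y
    refine ⟨‖-(2 * I * (x : ℂ))‖ * B + B', fun s hs => ?_⟩
    have e : segDeriv (N + 1) x y s -
        ((s ^ (1 - x - y - (N + 1 : ℕ)) : ℝ) : ℂ) * asymCoef (N + 1) x y =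
        -(2 * I * x) * (segDeriv N (x + 1) y s -
          ((s ^ (1 - (x + 1) - y - N) : ℝ) : ℂ) * asymCoef N (x + 1) y) -
        I * bdryDeriv N x y s := by
      rw [asymCoef_succ, segDeriv,
        show 1 - x - y - ((N + 1 : ℕ) : ℝ) = 1 - (x + 1) - y - N by push_cast; ring]
      ring
    rw [e]
    refine (norm_sub_le _ _).trans ?_
    rw [norm_mul, norm_mul I, norm_I, one_mul]
    gcongr
    · exact hB s hs
    · exact hB' s hs

/-! ### Geometry of the domain: compact, star-shaped, with unique derivatives. -/

lemma isClosed_domain (m : ℕ) : IsClosed (domain m) :=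
  (isClosed_Icc.preimage (continuous_re.comp (continuous_pow m))).inter
    (isClosed_Icc.preimage (continuous_im.comp (continuous_pow m)))

lemma norm_le_two_of_mem_domain {m : ℕ} (hm : m ≠ 0) {w : ℂ} (hw : w ∈ domain m) : ‖w‖ ≤ 2 := by
  by_contra! h
  have h1 : ‖w ^ m‖ ≤ 1 + 1 :=
    (norm_le_abs_re_add_abs_im _).trans (add_le_add (abs_le.2 hw.1) (abs_le.2 hw.2))
  rw [norm_pow] at h1
  have := le_self_pow₀ (by linarith : 1 ≤ ‖w‖) hm
  linarith

lemma isCompact_domain {m : ℕ} (hm : m ≠ 0) : IsCompact (domain m) :=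
  (isCompact_closedBall (0 : ℂ) 2).of_isClosed_subset (isClosed_domain m) fun w hw => by
    simpa using norm_le_two_of_mem_domain hm hw

/-- Scaling w by t < 1 scales w^m by t^m < 1. So the domain is star-shaped about 0, which provides
the paths for Taylor's formula, and it lies in the closure of its interior, which makes second
derivatives within it symmetric. -/
lemma mul_mem_interior_domain {m : ℕ} (hm : m ≠ 0) {w : ℂ} (hw : w ∈ domain m) {t : ℝ}
    (h0 : 0 ≤ t) (h1 : t < 1) : (t : ℂ) * w ∈ interior (domain m) := by
  have ho : IsOpen {w : ℂ | (w ^ m).re ∈ Ioo (-1 : ℝ) 1 ∧ (w ^ m).im ∈ Ioo (-1 : ℝ) 1} :=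
    (isOpen_Ioo.preimage (continuous_re.comp (continuous_pow m))).inter
      (isOpen_Ioo.preimage (continuous_im.comp (continuous_pow m)))
  have hsub : {w : ℂ | (w ^ m).re ∈ Ioo (-1 : ℝ) 1 ∧ (w ^ m).im ∈ Ioo (-1 : ℝ) 1} ⊆ domain m :=
    fun w hw => ⟨Ioo_subset_Icc_self hw.1, Ioo_subset_Icc_self hw.2⟩
  refine interior_maximal hsub ho ?_
  have ht : t ^ m < 1 := pow_lt_one₀ h0 h1 hm
  have ht0 : 0 ≤ t ^ m := pow_nonneg h0 m
  have key : ∀ r : ℝ, r ∈ Icc (-1 : ℝ) 1 → t ^ m * r ∈ Ioo (-1 : ℝ) 1 := by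
    intro r hr
    rw [mem_Ioo, ← abs_lt, abs_mul, abs_of_nonneg ht0]
    have := abs_le.2 hr
    nlinarith [abs_nonneg r]
  simp only [mem_ofPred_eq, mul_pow, ← ofReal_pow, re_ofReal_mul, im_ofReal_mul]
  exact ⟨key _ hw.1, key _ hw.2⟩

lemma zero_mem_domain {m : ℕ} (hm : m ≠ 0) : (0 : ℂ) ∈ domain m := by
  simp [domain, zero_pow hm]

lemma zero_mem_interior_domain {m : ℕ} (hm : m ≠ 0) : (0 : ℂ) ∈ interior (domain m) := by
  simpa using mul_mem_interior_domain hm (zero_mem_domain hm) le_rfl one_pos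

lemma mul_mem_domain {m : ℕ} (hm : m ≠ 0) {w : ℂ} (hw : w ∈ domain m) {t : ℝ}
    (ht : t ∈ Icc (0 : ℝ) 1) : (t : ℂ) * w ∈ domain m := by
  rcases ht.2.eq_or_lt with rfl | h
  · simpa using hw
  · exact interior_subset (mul_mem_interior_domain hm hw ht.1 h)

lemma mem_closure_interior_domain {m : ℕ} (hm : m ≠ 0) {w : ℂ} (hw : w ∈ domain m) :
    w ∈ closure (interior (domain m)) := by
  have hc : Tendsto (fun t : ℝ => (t : ℂ) * w) (𝓝[<] 1) (𝓝 w) := by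
    have : ContinuousAt (fun t : ℝ => (t : ℂ) * w) 1 := by fun_prop
    simpa using this.tendsto.mono_left nhdsWithin_le_nhds
  refine mem_closure_of_tendsto hc ?_
  filter_upwards [Ioo_mem_nhdsLT (zero_lt_one (α := ℝ))] with t ht
  exact mul_mem_interior_domain hm hw ht.1.le ht.2

/-- Near w ≠ 0 the square is carried into the domain by the root z ↦ w (z/w^m)^{1/m}, whose
derivative at w^m is invertible, so unique differentiability passes from the convex square. The root
may jump elsewhere; only its derivative at w^m and the fact that its m-th power is z matter. -/
lemma uniqueDiffOn_domain {m : ℕ} (hm : m ≠ 0) : UniqueDiffOn ℝ (domain m) := by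
  intro w hw
  rcases eq_or_ne w 0 with rfl | hw0
  · exact uniqueDiffWithinAt_of_mem_nhds (mem_interior_iff_mem_nhds.1 (zero_mem_interior_domain hm))
  have hsq : UniqueDiffOn ℝ (Icc (-1 : ℝ) 1 ×ℂ Icc (-1 : ℝ) 1) := by
    refine uniqueDiffOn_convex ?_ ⟨0, ?_⟩
    · exact ((convex_Icc (-1 : ℝ) 1).linear_preimage reLm).inter
        ((convex_Icc (-1 : ℝ) 1).linear_preimage imLm)
    · rw [interior_reProdIm, interior_Icc, mem_reProdIm]; simp
  have hz0 : w ^ m ≠ 0 := pow_ne_zero m hw0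
  have hd : HasDerivAt (fun z : ℂ => w * (z / w ^ m) ^ ((m : ℂ)⁻¹))
      (w * ((m : ℂ)⁻¹ * (w ^ m / w ^ m) ^ ((m : ℂ)⁻¹ - 1) * (1 / w ^ m))) (w ^ m) := by
    refine HasDerivAt.const_mul w (HasDerivAt.cpow_const ((hasDerivAt_id _).div_const _) ?_)
    simp [div_self hz0]
  set c := w * ((m : ℂ)⁻¹ * (w ^ m / w ^ m) ^ ((m : ℂ)⁻¹ - 1) * (1 / w ^ m)) with hc
  have hc0 : c ≠ 0 := by
    rw [hc, div_self hz0, one_cpow]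
    have : (m : ℂ) ≠ 0 := Nat.cast_ne_zero.2 hm
    exact mul_ne_zero hw0 (mul_ne_zero (mul_ne_zero (inv_ne_zero this) one_ne_zero)
      (one_div_ne_zero hz0))
  have hfd := (hd.hasFDerivAt.restrictScalars ℝ).hasFDerivWithinAt
    (s := Icc (-1 : ℝ) 1 ×ℂ Icc (-1 : ℝ) 1)
  have hu := hfd.uniqueDiffWithinAt (hsq (w ^ m) hw) (by
    refine Function.Surjective.denseRange fun v => ⟨v / c, ?_⟩
    simp [div_mul_cancel₀ v hc0])
  rw [div_self hz0, one_cpow, mul_one] at hu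
  refine hu.mono ?_
  rintro _ ⟨z, hz, rfl⟩
  have : (w * (z / w ^ m) ^ ((m : ℂ)⁻¹)) ^ m = z := by
    rw [mul_pow, cpow_nat_inv_pow _ hm]; field_simp
  simp only [domain, mem_ofPred_eq, this]
  exact hz

/-! ### Jets of Wirtinger derivatives within a set. -/

/-- The real linear map `v ↦ a v + b conj v`. -/
def wirt (a b : ℂ) : ℂ →L[ℝ] ℂ :=
  a • ContinuousLinearMap.id ℝ ℂ + b • conjCLE.toContinuousLinearMap

@[simp] lemma wirt_apply (a b v : ℂ) : wirt a b v = a * v + b * conj v := by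
  simp [wirt]

/-- A family of mixed Wirtinger derivatives up to order `N` on a set. -/
structure IsJet (N : ℕ) (S : Set ℂ) (F : ℕ → ℕ → ℂ → ℂ) : Prop where
  continuousOn : ∀ p q, p + q ≤ N → ContinuousOn (F p q) S
  hasFDeriv : ∀ p q, p + q < N → ∀ w ∈ S,
    HasFDerivWithinAt (F p q) (wirt (F (p + 1) q w) (F p (q + 1) w)) S w

/-- The evaluation `L ↦ (L 1 + c L i) / 2`. -/
def wirtEval (c : ℂ) : (ℂ →L[ℝ] ℂ) →L[ℝ] ℂ :=
  (2⁻¹ : ℂ) • (ContinuousLinearMap.apply ℝ ℂ (1 : ℂ) + c • ContinuousLinearMap.apply ℝ ℂ I)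

@[simp] lemma wirtEval_apply (c : ℂ) (L : ℂ →L[ℝ] ℂ) : wirtEval c L = (L 1 + c * L I) / 2 := by
  simp [wirtEval]; ring

lemma norm_wirtEval_le {c : ℂ} (hc : ‖c‖ = 1) : ‖wirtEval c‖ ≤ 1 := by
  refine ContinuousLinearMap.opNorm_le_bound _ zero_le_one fun L => ?_
  rw [wirtEval_apply, norm_div, Complex.norm_two]
  have h1 := L.le_opNorm 1
  have h2 := L.le_opNorm I
  rw [norm_one, mul_one] at h1
  rw [norm_I, mul_one] at h2
  have := norm_add_le (L 1) (c * L I)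
  rw [norm_mul, hc, one_mul] at this
  linarith

lemma wirt_wirtEval (L : ℂ →L[ℝ] ℂ) : wirt (wirtEval (-I) L) (wirtEval I L) = L := by
  ext v
  have hv : v = v.re • (1 : ℂ) + v.im • I := by simp [re_add_im]
  rw [hv, map_add, map_add, map_smul, map_smul, map_smul, map_smul]
  congr 2
  · simp; ring
  · simp; ring_nf; simp

/-- The Wirtinger derivative within a set: `c = -i` gives `∂/∂ω`, and `c = i` gives `∂/∂ω̄`. -/
def wirtDeriv (S : Set ℂ) (c : ℂ) (f : ℂ → ℂ) (w : ℂ) : ℂ := wirtEval c (fderivWithin ℝ f S w)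

lemma wirtDeriv_congr {S : Set ℂ} (c : ℂ) {f g : ℂ → ℂ} (h : EqOn f g S) :
    EqOn (wirtDeriv S c f) (wirtDeriv S c g) S := fun w hw => by
  rw [wirtDeriv, wirtDeriv, fderivWithin_congr h (h hw)]

lemma contDiffOn_wirtDeriv {S : Set ℂ} (hS : UniqueDiffOn ℝ S) (c : ℂ) {f : ℂ → ℂ} {n : ℕ}
    (hf : ContDiffOn ℝ (n + 1 : ℕ) f S) : ContDiffOn ℝ n (wirtDeriv S c f) S :=
  (wirtEval c).contDiff.comp_contDiffOn (hf.fderivWithin hS (by norm_cast))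

lemma norm_iteratedFDerivWithin_wirtDeriv_le {S : Set ℂ} (hS : UniqueDiffOn ℝ S) {c : ℂ}
    (hc : ‖c‖ = 1) {f : ℂ → ℂ} {n : ℕ} (hf : ContDiffOn ℝ (n + 1 : ℕ) f S) {w : ℂ} (hw : w ∈ S) :
    ‖iteratedFDerivWithin ℝ n (wirtDeriv S c f) S w‖ ≤
      ‖iteratedFDerivWithin ℝ (n + 1) f S w‖ := by
  have h := (wirtEval c).norm_iteratedFDerivWithin_comp_left (n := n)
    ((hf.fderivWithin hS (m := n) (by norm_cast)) w hw) hS hw le_rfl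
  rw [norm_iteratedFDerivWithin_fderivWithin hS hw] at h
  exact h.trans (mul_le_of_le_one_left (norm_nonneg _) (norm_wirtEval_le hc))

/-- Symmetry of the second derivative within a set, which needs every point to be a limit of
interior points. -/
lemma wirtDeriv_comm {S : Set ℂ} (hS : UniqueDiffOn ℝ S) (hS' : S ⊆ closure (interior S))
    (c d : ℂ) {f : ℂ → ℂ} (hf : ContDiffOn ℝ 2 f S) :
    EqOn (wirtDeriv S c (wirtDeriv S d f)) (wirtDeriv S d (wirtDeriv S c f)) S := by
  intro w hw
  have hsymm := (hf w hw).isSymmSndFDerivWithinAt (by simp) hS (hS' hw) hw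
  have hdiff : DifferentiableWithinAt ℝ (fderivWithin ℝ f S) S w :=
    (hf.fderivWithin hS (m := 1) (by norm_num)).differentiableOn one_ne_zero w hw
  have key : ∀ (c : ℂ) (v : ℂ), fderivWithin ℝ (wirtDeriv S c f) S w v =
      wirtEval c (fderivWithin ℝ (fderivWithin ℝ f S) S w v) := by
    intro c v
    have := ((wirtEval c).hasFDerivAt.comp_hasFDerivWithinAt w
      hdiff.hasFDerivWithinAt).fderivWithin (hS w hw)
    change fderivWithin ℝ (wirtEval c ∘ fderivWithin ℝ f S) S w v = _
    rw [this]; rfl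
  have e := hsymm 1 I
  simp only [wirtDeriv] at key ⊢
  simp only [wirtEval_apply] at key ⊢
  rw [key, key, key, key, e]
  ring

lemma contDiffOn_wirtDeriv_iterate {S : Set ℂ} (hS : UniqueDiffOn ℝ S) (c : ℂ) (p : ℕ) :
    ∀ {f : ℂ → ℂ} {n : ℕ}, ContDiffOn ℝ (n + p : ℕ) f S →
      ContDiffOn ℝ n ((wirtDeriv S c)^[p] f) S := by
  induction p with
  | zero => intro f n hf; simpa using hf
  | succ p ih =>
    intro f n hf
    rw [Function.iterate_succ_apply]
    exact ih (contDiffOn_wirtDeriv hS c hf)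

lemma wirtDeriv_comm_iterate {S : Set ℂ} (hS : UniqueDiffOn ℝ S)
    (hS' : S ⊆ closure (interior S)) (c d : ℂ) (p : ℕ) : ∀ {f : ℂ → ℂ},
    ContDiffOn ℝ (p + 1 : ℕ) f S →
    EqOn (wirtDeriv S d ((wirtDeriv S c)^[p] f)) ((wirtDeriv S c)^[p] (wirtDeriv S d f)) S := by
  induction p with
  | zero => intro f _ w _; rfl
  | succ p ih =>
    intro f hf w hw
    rw [Function.iterate_succ_apply', Function.iterate_succ_apply',
      wirtDeriv_comm hS hS' d c
        (contDiffOn_wirtDeriv_iterate hS c p (n := 2) (by convert hf using 2; ring)) hw]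
    exact wirtDeriv_congr c (ih (hf.of_le (by norm_cast; omega))) hw

/-- The mixed Wirtinger derivatives of a function within a set. -/
def jet (S : Set ℂ) (f : ℂ → ℂ) (p q : ℕ) : ℂ → ℂ :=
  (wirtDeriv S (-I))^[p] ((wirtDeriv S I)^[q] f)

lemma contDiffOn_jet {S : Set ℂ} (hS : UniqueDiffOn ℝ S) {f : ℂ → ℂ} {n p q : ℕ}
    (hf : ContDiffOn ℝ (n + p + q : ℕ) f S) : ContDiffOn ℝ n (jet S f p q) S :=
  contDiffOn_wirtDeriv_iterate hS _ p (contDiffOn_wirtDeriv_iterate hS _ q hf)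

/-- A new ∂/∂ω̄ arrives on the outside, whereas `jet` keeps these derivatives innermost; it is moved
past the p derivatives ∂/∂ω by commutation. -/
lemma isJet_jet {S : Set ℂ} (hS : UniqueDiffOn ℝ S) (hS' : S ⊆ closure (interior S))
    {f : ℂ → ℂ} {N : ℕ} (hf : ContDiffOn ℝ N f S) : IsJet N S (jet S f) := by
  refine ⟨fun p q h => ?_, fun p q h w hw => ?_⟩
  · exact (contDiffOn_jet hS (n := 0) (hf.of_le (by norm_cast; omega))).continuousOn
  · have h1 : ContDiffOn ℝ (1 : ℕ) (jet S f p q) S :=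
      contDiffOn_jet hS (hf.of_le (by norm_cast; omega))
    have h2 : jet S f p (q + 1) w = wirtDeriv S I (jet S f p q) w := by
      have := wirtDeriv_comm_iterate hS hS' (-I) I p (f := (wirtDeriv S I)^[q] f)
        (contDiffOn_wirtDeriv_iterate hS _ q (hf.of_le (by norm_cast; omega))) hw
      rw [jet, jet, this, Function.iterate_succ_apply']
    have h3 : jet S f (p + 1) q w = wirtDeriv S (-I) (jet S f p q) w := by
      rw [jet, jet, Function.iterate_succ_apply']
    rw [h2, h3, wirtDeriv, wirtDeriv, wirt_wirtEval]
    exact ((h1.differentiableOn (by simp)) w hw).hasFDerivWithinAt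

lemma norm_iteratedFDerivWithin_iterate_le {S : Set ℂ} (hS : UniqueDiffOn ℝ S) {c : ℂ}
    (hc : ‖c‖ = 1) (p : ℕ) : ∀ {f : ℂ → ℂ} {n : ℕ}, ContDiffOn ℝ (n + p : ℕ) f S →
    ∀ {w : ℂ}, w ∈ S → ‖iteratedFDerivWithin ℝ n ((wirtDeriv S c)^[p] f) S w‖ ≤
      ‖iteratedFDerivWithin ℝ (n + p) f S w‖ := by
  induction p with
  | zero => intro f n _ w _; rfl
  | succ p ih =>
    intro f n hf w hw
    rw [Function.iterate_succ_apply]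
    exact (ih (contDiffOn_wirtDeriv hS c hf) hw).trans
      (norm_iteratedFDerivWithin_wirtDeriv_le hS hc hf hw)

lemma norm_jet_le {S : Set ℂ} (hS : UniqueDiffOn ℝ S) {f : ℂ → ℂ} {p q : ℕ}
    (hf : ContDiffOn ℝ (p + q : ℕ) f S) {w : ℂ} (hw : w ∈ S) :
    ‖jet S f p q w‖ ≤ ‖iteratedFDerivWithin ℝ (p + q) f S w‖ := by
  rw [← norm_iteratedFDerivWithin_zero (𝕜 := ℝ) (s := S)]
  have h1 := norm_iteratedFDerivWithin_iterate_le hS (c := -I) (by simp) p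
    (f := (wirtDeriv S I)^[q] f) (n := 0)
    (by simpa using contDiffOn_wirtDeriv_iterate hS _ q hf) hw
  rw [zero_add] at h1
  exact h1.trans (norm_iteratedFDerivWithin_iterate_le hS (c := I) (by simp) q hf hw)

lemma wirtDeriv_eqOn_interior {S : Set ℂ} {c : ℂ} {D : (ℂ → ℂ) → ℂ → ℂ}
    (hD : ∀ f w, D f w = wirtEval c (fderiv ℝ f w)) {f g : ℂ → ℂ}
    (h : EqOn f g (interior S)) : EqOn (wirtDeriv S c f) (D g) (interior S) := by
  intro w hw
  have hn : S ∈ 𝓝 w := mem_interior_iff_mem_nhds.1 hw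
  have : f =ᶠ[𝓝 w] g := by
    filter_upwards [isOpen_interior.mem_nhds hw] with z hz using h hz
  rw [wirtDeriv, hD, fderivWithin_of_mem_nhds hn, this.fderiv_eq]

lemma wirtDeriv_iterate_eqOn_interior {S : Set ℂ} {c : ℂ} {D : (ℂ → ℂ) → ℂ → ℂ}
    (hD : ∀ f w, D f w = wirtEval c (fderiv ℝ f w)) (p : ℕ) {f g : ℂ → ℂ}
    (h : EqOn f g (interior S)) :
    EqOn ((wirtDeriv S c)^[p] f) (D^[p] g) (interior S) := by
  induction p with
  | zero => exact h
  | succ p ih =>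
    rw [Function.iterate_succ_apply', Function.iterate_succ_apply']
    exact wirtDeriv_eqOn_interior hD ih

lemma jet_zero_eq_mixedPartial {S : Set ℂ} (h0 : (0 : ℂ) ∈ interior S) (f : ℂ → ℂ) (p q : ℕ) :
    jet S f p q 0 = mixedPartial p q f := by
  refine wirtDeriv_iterate_eqOn_interior (fun f w => ?_) p
    (wirtDeriv_iterate_eqOn_interior (fun f w => ?_) q (eqOn_refl f _)) h0
  · simp [dOmega, sub_eq_add_neg]
  · simp [dOmegaBar]

lemma IsJet.sub {N : ℕ} {S : Set ℂ} {F G : ℕ → ℕ → ℂ → ℂ} (hF : IsJet N S F) (hG : IsJet N S G) :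
    IsJet N S (fun p q w => F p q w - G p q w) := by
  refine ⟨fun p q h => (hF.continuousOn p q h).sub (hG.continuousOn p q h), fun p q h w hw => ?_⟩
  refine ((hF.hasFDeriv p q h w hw).sub (hG.hasFDeriv p q h w hw)).congr_fderiv ?_
  ext v; simp; ring

/-! ### Taylor polynomials and remainder estimates. -/

/-- The coefficients `c p q` cut off beyond total order `k`. -/
def cutoff (k : ℕ) (c : ℕ → ℕ → ℂ) (p q : ℕ) : ℂ := if p + q ≤ k then c p q else 0

/-- The monomial `w ^ r / r! * conj w ^ t / t!`. -/
def divMono (r t : ℕ) (w : ℂ) : ℂ := w ^ r / (r ! : ℂ) * ((conj w) ^ t / (t ! : ℂ))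

/-- The jet of the polynomial with Wirtinger coefficients `c p q` at the origin. -/
def taylorJet (k : ℕ) (c : ℕ → ℕ → ℂ) (p q : ℕ) (w : ℂ) : ℂ :=
  ∑ r ∈ Finset.range (k + 1), ∑ t ∈ Finset.range (k + 1),
    cutoff k c (p + r) (q + t) * divMono r t w

lemma hasFDerivAt_divMono (r t : ℕ) (w : ℂ) :
    HasFDerivAt (divMono r t) (wirt (if r = 0 then 0 else divMono (r - 1) t w)
      (if t = 0 then 0 else divMono r (t - 1) w)) w := by
  have hp : ∀ r : ℕ, ∀ z : ℂ, HasDerivAt (fun z : ℂ => z ^ r / (r ! : ℂ))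
      (if r = 0 then 0 else z ^ (r - 1) / ((r - 1)! : ℂ)) z := by
    intro r z
    refine ((hasDerivAt_pow r z).div_const _).congr_deriv ?_
    rcases r with _ | r
    · simp
    · have : ((r + 1 : ℕ) : ℂ) ≠ 0 := Nat.cast_ne_zero.2 (by omega)
      have h2 : ((r ! : ℕ) : ℂ) ≠ 0 := Nat.cast_ne_zero.2 (Nat.factorial_ne_zero _)
      rw [if_neg (by omega), Nat.factorial_succ]
      simp only [Nat.add_sub_cancel]
      push_cast at this ⊢
      field_simp
  have h1 := (hp r w).hasFDerivAt.restrictScalars ℝ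
  have h2 := ((hp t (conj w)).hasFDerivAt.restrictScalars ℝ).comp w
    conjCLE.toContinuousLinearMap.hasFDerivAt
  refine (h1.mul h2).congr_fderiv ?_
  ext v
  simp only [divMono]
  split_ifs <;> simp <;> ring

lemma taylorJet_zero (k : ℕ) (c : ℕ → ℕ → ℂ) (p q : ℕ) :
    taylorJet k c p q 0 = cutoff k c p q := by
  rw [taylorJet, Finset.sum_eq_single 0, Finset.sum_eq_single 0]
  · simp [divMono]
  · intro t _ ht; simp [divMono, zero_pow ht]
  · simp
  · intro r _ hr
    exact Finset.sum_eq_zero fun t _ => by simp [divMono, zero_pow hr]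
  · simp

lemma isJet_taylorJet (k : ℕ) (c : ℕ → ℕ → ℂ) (N : ℕ) (S : Set ℂ) :
    IsJet N S (taylorJet k c) := by
  have key : ∀ p q w, HasFDerivAt (taylorJet k c p q)
      (wirt (taylorJet k c (p + 1) q w) (taylorJet k c p (q + 1) w)) w := by
    intro p q w
    have h := HasFDerivAt.fun_sum (u := Finset.range (k + 1)) (x := w) (𝕜 := ℝ)
      (A := fun r w => ∑ t ∈ Finset.range (k + 1), cutoff k c (p + r) (q + t) * divMono r t w)
      (fun r _ => HasFDerivAt.fun_sum fun t _ => (hasFDerivAt_divMono r t w).const_mul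
        (cutoff k c (p + r) (q + t)))
    refine h.congr_fderiv ?_
    have e1 : taylorJet k c (p + 1) q w = ∑ r ∈ Finset.range (k + 1), ∑ t ∈ Finset.range (k + 1),
        cutoff k c (p + r) (q + t) * (if r = 0 then 0 else divMono (r - 1) t w) := by
      -- Shifting r by one matches the two sums. The unmatched terms vanish: r = k by the cutoff,
      -- and r = 0 because that factor has no derivative.
      refine (Finset.sum_range_succ _ _).trans
        (Eq.trans ?_ (Finset.sum_range_succ' _ _).symm)
      congr 1
      · refine Finset.sum_congr rfl fun r _ => Finset.sum_congr rfl fun t _ => ?_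
        rw [if_neg (by omega), show p + 1 + r = p + (r + 1) by ring, Nat.add_sub_cancel]
      · exact (Finset.sum_eq_zero fun t _ => by rw [cutoff, if_neg (by omega), zero_mul]).trans
          (Finset.sum_eq_zero fun t _ => by simp).symm
    have e2 : taylorJet k c p (q + 1) w = ∑ r ∈ Finset.range (k + 1), ∑ t ∈ Finset.range (k + 1),
        cutoff k c (p + r) (q + t) * (if t = 0 then 0 else divMono r (t - 1) w) := by
      rw [taylorJet]
      refine Finset.sum_congr rfl fun r _ => ?_
      rw [Finset.sum_range_succ, Finset.sum_range_succ' _ k]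
      congr 1
      · refine Finset.sum_congr rfl fun t _ => ?_
        rw [if_neg (by omega), show q + 1 + t = q + (t + 1) by ring, Nat.add_sub_cancel]
      · rw [cutoff, if_neg (by omega), zero_mul]; simp
    ext v
    rw [e1, e2]
    simp only [_root_.sum_apply, _root_.smul_apply, wirt_apply,
      Finset.sum_mul, ← Finset.sum_add_distrib, smul_eq_mul]
    refine Finset.sum_congr rfl fun r _ => Finset.sum_congr rfl fun t _ => ?_
    ring
  exact ⟨fun p q _ w _ => (key p q w).continuousAt.continuousWithinAt,
    fun p q _ w _ => (key p q w).hasFDerivWithinAt⟩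

lemma norm_wirt_apply_le (a b v : ℂ) : ‖wirt a b v‖ ≤ (‖a‖ + ‖b‖) * ‖v‖ := by
  rw [wirt_apply]
  refine (norm_add_le _ _).trans ?_
  rw [norm_mul, norm_mul, RCLike.norm_conj, add_mul]

/-- Taylor estimate for a jet on the domain which vanishes at the origin below order `k`. -/
lemma IsJet.norm_le_of_vanish {m : ℕ} (hm : m ≠ 0) {N k : ℕ} (hk : k ≤ N)
    {G : ℕ → ℕ → ℂ → ℂ} (hG : IsJet N (domain m) G) (h0 : ∀ p q, p + q < k → G p q 0 = 0)
    {M r : ℝ} (hM : 0 ≤ M)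
    (hb : ∀ p q, p + q = k → ∀ w ∈ domain m, ‖w‖ ≤ r → ‖G p q w‖ ≤ M) (d : ℕ) :
    ∀ p q, p + q + d = k → ∀ w ∈ domain m, ‖w‖ ≤ r → ‖G p q w‖ ≤ 2 ^ d * M * ‖w‖ ^ d := by
  induction d with
  | zero => intro p q h w hw hr; simpa using hb p q h w hw hr
  | succ d ih =>
    intro p q h w hw hr
    have hmem : ∀ t ∈ Icc (0 : ℝ) 1, (t : ℂ) * w ∈ domain m := fun t ht => mul_mem_domain hm hw ht
    have hlin : ∀ t : ℝ, HasDerivAt (fun t : ℝ => (t : ℂ) * w) w t := fun t => by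
      simpa using (ofRealCLM.hasDerivAt (x := t)).mul_const w
    have hd : ∀ t ∈ Icc (0 : ℝ) 1, HasDerivWithinAt (fun t : ℝ => G p q ((t : ℂ) * w))
        (wirt (G (p + 1) q (t * w)) (G p (q + 1) (t * w)) w) (Icc 0 1) t := fun t ht =>
      (hG.hasFDeriv p q (by omega) _ (hmem t ht)).comp_hasDerivWithinAt t
        (hlin t).hasDerivWithinAt hmem
    -- The derivative along the ray has two Wirtinger terms, hence one factor 2 for each order.
    have hbd : ∀ t ∈ Ico (0 : ℝ) 1, ‖wirt (G (p + 1) q (t * w)) (G p (q + 1) (t * w)) w‖ ≤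
        2 ^ (d + 1) * M * ‖w‖ ^ (d + 1) := by
      intro t ht
      have ht' : t ∈ Icc (0 : ℝ) 1 := ⟨ht.1, ht.2.le⟩
      have hn : ‖(t : ℂ) * w‖ ≤ ‖w‖ := by
        rw [norm_mul, norm_real, Real.norm_of_nonneg ht.1]
        exact mul_le_of_le_one_left (norm_nonneg _) ht.2.le
      have b1 := ih (p + 1) q (by omega) _ (hmem t ht') (hn.trans hr)
      have b2 := ih p (q + 1) (by omega) _ (hmem t ht') (hn.trans hr)
      have b3 : 2 ^ d * M * ‖(t : ℂ) * w‖ ^ d ≤ 2 ^ d * M * ‖w‖ ^ d := by gcongr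
      calc _ ≤ _ := norm_wirt_apply_le _ _ _
        _ ≤ (2 ^ d * M * ‖w‖ ^ d + 2 ^ d * M * ‖w‖ ^ d) * ‖w‖ := by
          gcongr
          · exact b1.trans b3
          · exact b2.trans b3
        _ = _ := by ring
    have := norm_image_sub_le_of_norm_deriv_le_segment' hd hbd 1 (right_mem_Icc.2 zero_le_one)
    simpa [h0 p q (by omega)] using this

/-- Uniform remainder estimate. -/
lemma IsJet.remainder_bound {m : ℕ} (hm : m ≠ 0) (N k : ℕ) (hk : k ≤ N) : ∃ C : ℝ, 0 ≤ C ∧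
    ∀ F : ℕ → ℕ → ℂ → ℂ, IsJet N (domain m) F → ∀ A : ℝ, 0 ≤ A →
    (∀ p q, p + q ≤ N → ∀ w ∈ domain m, ‖F p q w‖ ≤ A) →
    ∀ p q, p + q ≤ N → ∀ w ∈ domain m, w ≠ 0 →
      ‖F p q w - taylorJet k (fun p q => F p q 0) p q w‖ ≤
        C * A * ‖w‖ ^ ((k : ℤ) - p - q) := by
  -- The first summand serves orders p + q ≤ k, where the order-k remainders are at most 2A. The
  -- second serves p + q > k: there the Taylor part vanishes, and |w| ≤ 2 bounds the negative power
  -- of |w| from below.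
  refine ⟨2 ^ k * 2 + 2 ^ N, by positivity, fun F hF A hA hFA => ?_⟩
  set c : ℕ → ℕ → ℂ := fun p q => F p q 0 with hc
  have hG := hF.sub (isJet_taylorJet k c N (domain m))
  have htop : ∀ p q, k ≤ p + q → ∀ w, taylorJet k c p q w = cutoff k c p q := by
    intro p q h w
    rw [← taylorJet_zero, taylorJet, taylorJet]
    refine Finset.sum_congr rfl fun r _ => Finset.sum_congr rfl fun t _ => ?_
    rcases Nat.eq_zero_or_pos (r + t) with h' | h'
    · obtain ⟨rfl, rfl⟩ : r = 0 ∧ t = 0 := by omega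
      simp [divMono]
    · rw [cutoff, if_neg (by omega), zero_mul, zero_mul]
  have hmain := hG.norm_le_of_vanish hm hk (r := 2) (M := 2 * A)
    (fun p q h => by
      simp only [taylorJet_zero, cutoff, if_pos h.le, hc, sub_self])
    (by positivity)
    (fun p q h w hw _ => by
      rw [htop p q h.ge, cutoff, if_pos h.le, two_mul]
      exact (norm_sub_le _ _).trans (add_le_add (hFA p q (by omega) w hw)
        (hFA p q (by omega) 0 (zero_mem_domain hm))))
  intro p q hpq w hw hw0
  have hwpos : 0 < ‖w‖ := norm_pos_iff.2 hw0
  have hw2 := norm_le_two_of_mem_domain hm hw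
  rcases le_or_gt (p + q) k with h | h
  · have := hmain (k - (p + q)) p q (by omega) w hw hw2
    refine this.trans ?_
    have e : ‖w‖ ^ ((k : ℤ) - p - q) = ‖w‖ ^ (k - (p + q)) := by
      rw [← zpow_natCast]; congr 1; omega
    rw [e]
    have h2 : (2 : ℝ) ^ (k - (p + q)) ≤ 2 ^ k := pow_le_pow_right₀ one_le_two (by omega)
    gcongr ?_ * _
    nlinarith [pow_pos (two_pos (α := ℝ)) N, mul_nonneg (sub_nonneg.2 h2) hA,
      mul_nonneg (pow_pos (two_pos (α := ℝ)) N).le hA]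
  · rw [htop p q h.le, cutoff, if_neg (by omega), sub_zero]
    have e : ‖w‖ ^ ((k : ℤ) - p - q) = (‖w‖ ^ (p + q - k))⁻¹ := by
      rw [← zpow_natCast, ← zpow_neg]; congr 1; omega
    rw [e, ← div_eq_mul_inv, le_div_iff₀ (by positivity)]
    have h2 : ‖w‖ ^ (p + q - k) ≤ 2 ^ N := (pow_le_pow_left₀ hwpos.le hw2 _).trans
      (pow_le_pow_right₀ one_le_two (by omega))
    have h3 := hFA p q hpq w hw
    calc ‖F p q w‖ * ‖w‖ ^ (p + q - k) ≤ A * 2 ^ N := by gcongr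
      _ ≤ _ := by nlinarith [mul_nonneg (pow_pos (two_pos (α := ℝ)) k).le hA]

/-- The remainder is negligible near the origin. -/
lemma IsJet.remainder_small {m : ℕ} (hm : m ≠ 0) {N k : ℕ} (hk : k ≤ N)
    {F : ℕ → ℕ → ℂ → ℂ} (hF : IsJet N (domain m) F) {A : ℝ} (hA : 0 ≤ A)
    (hFA : ∀ p q, p + q ≤ N → ∀ w ∈ domain m, ‖F p q w‖ ≤ A) {ε : ℝ} (hε : 0 < ε) :
    ∃ δ : ℝ, 0 < δ ∧ ∀ p q, p + q ≤ N → ∀ w ∈ domain m, w ≠ 0 → ‖w‖ ≤ δ →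
      ‖F p q w - taylorJet k (fun p q => F p q 0) p q w‖ ≤ ε * ‖w‖ ^ ((k : ℤ) - p - q) := by
  set c : ℕ → ℕ → ℂ := fun p q => F p q 0 with hc
  have hG := hF.sub (isJet_taylorJet k c N (domain m))
  have hvan : ∀ p q, p + q ≤ k → F p q 0 - taylorJet k c p q 0 = 0 := fun p q h => by
    simp only [taylorJet_zero, cutoff, if_pos h, hc, sub_self]
  have hloc : ∀ x ∈ Finset.range (k + 1), ∃ δ : ℝ, 0 < δ ∧ ∀ w ∈ domain m, ‖w‖ ≤ δ →
      ‖F x (k - x) w - taylorJet k c x (k - x) w‖ ≤ ε / 2 ^ k := by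
    intro x hx
    have hx' : x + (k - x) = k := by have := Finset.mem_range.1 hx; omega
    have hcont := hG.continuousOn x (k - x) (by omega) 0 (zero_mem_domain hm)
    have := Metric.continuousWithinAt_iff.1 hcont (ε / 2 ^ k) (by positivity)
    obtain ⟨δ, hδ, h⟩ := this
    refine ⟨δ / 2, by positivity, fun w hw hwδ => ?_⟩
    have := h hw (by simpa using lt_of_le_of_lt hwδ (by linarith))
    rw [hvan x (k - x) hx'.le, dist_zero_right] at this
    exact this.le
  choose! δ hδ hδ' using hloc
  obtain ⟨δ₀, hδ₀, hle⟩ : ∃ δ₀ : ℝ, 0 < δ₀ ∧ ∀ x ∈ Finset.range (k + 1), δ₀ ≤ δ x := by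
    refine ⟨(Finset.range (k + 1)).inf' (by simp) δ, ?_, fun x hx => Finset.inf'_le _ hx⟩
    rw [Finset.lt_inf'_iff]; exact hδ
  have hmain := hG.norm_le_of_vanish hm hk (r := δ₀) (M := ε / 2 ^ k)
    (fun p q h => hvan p q h.le) (by positivity)
    (fun p q h w hw hwδ => by
      have hp : p ∈ Finset.range (k + 1) := Finset.mem_range.2 (by omega)
      have hq : q = k - p := by omega
      rw [hq]
      exact hδ' p hp w hw (hwδ.trans (hle p hp)))
  -- The radius δ₀ comes from continuity at 0 of the derivatives of order exactly k. For orders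
  -- above k there is a spare factor |w|, and |w| ≤ ε/(A + 1) suffices.
  refine ⟨min δ₀ (min 1 (ε / (A + 1))), by positivity, fun p q hpq w hw hw0 hwδ => ?_⟩
  have hwpos : 0 < ‖w‖ := norm_pos_iff.2 hw0
  rcases le_or_gt (p + q) k with h | h
  · have := hmain (k - (p + q)) p q (by omega) w hw (hwδ.trans (min_le_left _ _))
    refine this.trans ?_
    have e : ‖w‖ ^ ((k : ℤ) - p - q) = ‖w‖ ^ (k - (p + q)) := by
      rw [← zpow_natCast]; congr 1; omega
    rw [e]
    have h2 : (2 : ℝ) ^ (k - (p + q)) ≤ 2 ^ k := pow_le_pow_right₀ one_le_two (by omega)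
    gcongr ?_ * _
    calc _ ≤ 2 ^ k * (ε / 2 ^ k) := by gcongr
      _ = ε := by field_simp
  · have hT : taylorJet k c p q w = 0 := by
      refine Finset.sum_eq_zero fun r _ => Finset.sum_eq_zero fun t _ => ?_
      rw [cutoff, if_neg (by omega), zero_mul]
    rw [hT, sub_zero]
    have e : ‖w‖ ^ ((k : ℤ) - p - q) = (‖w‖ ^ (p + q - k))⁻¹ := by
      rw [← zpow_natCast, ← zpow_neg]; congr 1; omega
    rw [e, ← div_eq_mul_inv, le_div_iff₀ (by positivity)]
    have h1 : ‖w‖ ≤ 1 := hwδ.trans ((min_le_right _ _).trans (min_le_left _ _))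
    have h2 : ‖w‖ ^ (p + q - k) ≤ ‖w‖ := pow_le_of_le_one hwpos.le h1 (by omega)
    have h3 := hFA p q hpq w hw
    have h4 : ‖w‖ ≤ ε / (A + 1) := hwδ.trans ((min_le_right _ _).trans (min_le_right _ _))
    rw [le_div_iff₀ (by linarith)] at h4
    calc ‖F p q w‖ * ‖w‖ ^ (p + q - k) ≤ A * ‖w‖ := by gcongr
      _ ≤ ε := by nlinarith

/-! ### Branches of the m-th root. -/

/-- The logarithm with imaginary part in `(0, 2π)`, off the real axis. -/
def upperLog (z : ℂ) : ℂ := if 0 < z.im then log z else log (-z) + Real.pi * I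

lemma upperLog_of_pos {z : ℂ} (h : 0 < z.im) : upperLog z = log z := if_pos h

lemma upperLog_of_neg {z : ℂ} (h : z.im < 0) : upperLog z = log (-z) + Real.pi * I :=
  if_neg (by linarith)

lemma ne_zero_of_im_ne {z : ℂ} (h : z.im ≠ 0) : z ≠ 0 := fun h' => h (by simp [h'])

lemma exp_upperLog {z : ℂ} (h : z.im ≠ 0) : cexp (upperLog z) = z := by
  have hz := ne_zero_of_im_ne h
  rcases lt_or_gt_of_ne h with h | h
  · rw [upperLog_of_neg h, Complex.exp_add, exp_log (neg_ne_zero.2 hz), exp_pi_mul_I]; ring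
  · rw [upperLog_of_pos h, exp_log hz]

lemma hasDerivAt_upperLog {z : ℂ} (h : z.im ≠ 0) : HasDerivAt upperLog z⁻¹ z := by
  rcases lt_or_gt_of_ne h with h | h
  · have h1 : HasDerivAt (fun z : ℂ => log (-z) + Real.pi * I) (-1 / -z) z :=
      ((hasDerivAt_id z).neg.clog (mem_slitPlane_of_im_pos (by simpa using h))).add_const _
    refine (h1.congr_deriv (by rw [neg_div_neg_eq, one_div])).congr_of_eventuallyEq ?_
    filter_upwards [(isOpen_Iio.preimage continuous_im).mem_nhds (show z.im ∈ Iio 0 from h)]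
      with w hw using upperLog_of_neg hw
  · refine (hasDerivAt_log (mem_slitPlane_of_im_pos h)).congr_of_eventuallyEq ?_
    filter_upwards [(isOpen_Ioi.preimage continuous_im).mem_nhds (show z.im ∈ Ioi 0 from h)]
      with w hw using upperLog_of_pos hw

lemma rootZero_eq {m : ℕ} {z : ℂ} (h : z.im ≠ 0) :
    rootZero m z = cexp (upperLog z / m) := by
  have hz := ne_zero_of_im_ne h
  have hn : 0 < ‖z‖ := norm_pos_iff.2 hz
  have e : upperLog z = (Real.log ‖z‖ : ℂ) + I * (argPos z : ℂ) := by
    rcases lt_or_gt_of_ne h with h | h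
    · rw [upperLog_of_neg h, argPos, if_pos (arg_neg_iff.2 h), log,
        arg_neg_eq_arg_add_pi_of_im_neg h, norm_neg]
      push_cast; ring
    · rw [upperLog_of_pos h, argPos, if_neg (not_lt.2 (arg_nonneg_iff.2 h.le)), log]; ring
  rw [e, rootZero, Real.rpow_def_of_pos hn, ofReal_exp, ← Complex.exp_add]
  congr 1
  push_cast
  ring

lemma root_eq {m l : ℕ} {z : ℂ} (h : z.im ≠ 0) :
    root m l z = cexp (2 * Real.pi * I / m) ^ l * cexp (upperLog z / m) := by
  rw [root, rootZero_eq h]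

lemma root_ne_zero {m l : ℕ} {z : ℂ} (h : z.im ≠ 0) : root m l z ≠ 0 := by
  rw [root_eq h]
  exact mul_ne_zero (pow_ne_zero _ (exp_ne_zero _)) (exp_ne_zero _)

lemma root_pow {m l : ℕ} (hm : m ≠ 0) {z : ℂ} (h : z.im ≠ 0) : root m l z ^ m = z := by
  have hm' : (m : ℂ) ≠ 0 := Nat.cast_ne_zero.2 hm
  rw [root_eq h, mul_pow, ← pow_mul, mul_comm l m, pow_mul, ← Complex.exp_nat_mul,
    mul_div_cancel₀ _ hm', exp_two_pi_mul_I, one_pow, one_mul, ← Complex.exp_nat_mul,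
    mul_div_cancel₀ _ hm', exp_upperLog h]

lemma norm_root_pow {m l : ℕ} (hm : m ≠ 0) {z : ℂ} (h : z.im ≠ 0) : ‖root m l z‖ ^ m = ‖z‖ := by
  rw [← norm_pow, root_pow hm h]

lemma root_mem_domain {m l : ℕ} (hm : m ≠ 0) {u s : ℝ} (hs : s ∈ punctured)
    (hu : u ∈ Icc (-1 : ℝ) 1) : root m l ⟨u, s⟩ ∈ domain m := by
  have h0 : s ≠ 0 := by rcases hs with h | h; exacts [h.2.ne, h.1.ne']
  rw [domain, mem_ofPred_eq, root_pow hm h0]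
  refine ⟨hu, ?_⟩
  rcases hs with h | h
  · exact ⟨h.1, by linarith [h.2]⟩
  · exact ⟨by linarith [h.1], h.2⟩

lemma inv_pow_pred {m : ℕ} (hm : m ≠ 0) {r : ℂ} (hr : r ≠ 0) : r⁻¹ ^ (m - 1) = r * (r ^ m)⁻¹ := by
  obtain ⟨n, rfl⟩ := Nat.exists_eq_succ_of_ne_zero hm
  rw [Nat.succ_eq_add_one, Nat.add_sub_cancel, pow_succ, inv_pow]
  field_simp

/-- From dw/dz = w/(mz) and z = w^m. The negative power of w is the form that keeps the integrands F
w^{-a} w̄^{-b} closed under differentiation. -/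
lemma hasDerivAt_root {m l : ℕ} (hm : m ≠ 0) {u s : ℝ} (h : s ≠ 0) :
    HasDerivAt (fun s : ℝ => root m l ⟨u, s⟩) (I / m * (root m l ⟨u, s⟩)⁻¹ ^ (m - 1)) s := by
  have hm' : (m : ℂ) ≠ 0 := Nat.cast_ne_zero.2 hm
  set z : ℂ := ⟨u, s⟩ with hz
  have hzi : z.im ≠ 0 := h
  have h1 : HasDerivAt (fun z => cexp (2 * Real.pi * I / m) ^ l * cexp (upperLog z / m))
      (cexp (2 * Real.pi * I / m) ^ l * (cexp (upperLog z / m) * (z⁻¹ / m))) z :=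
    (((hasDerivAt_upperLog hzi).div_const _).cexp).const_mul _
  have h2 : HasDerivAt (fun s : ℝ => (⟨u, s⟩ : ℂ)) I s := by
    have : HasDerivAt (fun s : ℝ => (u : ℂ) + s * I) (1 * I) s :=
      ((ofRealCLM.hasDerivAt (x := s)).mul_const I).const_add (u : ℂ)
    rw [one_mul] at this
    exact this.congr_of_eventuallyEq (Eventually.of_forall fun s => mk_eq_add_mul_I u s)
  have h3 := (HasDerivAt.comp s h1 h2)
  have h4 : HasDerivAt (fun s : ℝ => root m l ⟨u, s⟩) _ s := h3.congr_of_eventuallyEq (by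
    filter_upwards [isOpen_ne.mem_nhds h] with t ht
    exact root_eq (show (⟨u, t⟩ : ℂ).im ≠ 0 from ht))
  refine h4.congr_deriv ?_
  have hr := root_ne_zero (m := m) (l := l) hzi
  have hp := root_pow (l := l) hm hzi
  have hr' := root_eq (m := m) (l := l) hzi
  have hz0 := ne_zero_of_im_ne hzi
  have e : (root m l z)⁻¹ ^ (m - 1) = root m l z * z⁻¹ := by
    rw [inv_pow_pred hm hr, hp]
  rw [e, hr']
  ring

/-! ### Differentiating the integrand along a branch. -/

/-- The iterated derivatives along a branch of the root of `F p q w * w ^ (-a) * conj w ^ (-b)`. -/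
def branchDeriv (m : ℕ) (F : ℕ → ℕ → ℂ → ℂ) : ℕ → ℕ → ℕ → ℕ → ℕ → ℂ → ℂ
  | 0, p, q, a, b, w => F p q w * (w⁻¹ ^ a * (conj w)⁻¹ ^ b)
  | i + 1, p, q, a, b, w => I / m *
      ((branchDeriv m F i (p + 1) q (a + (m - 1)) b w - a * branchDeriv m F i p q (a + m) b w) -
        (branchDeriv m F i p (q + 1) a (b + (m - 1)) w - b * branchDeriv m F i p q a (b + m) w))

/-- Product and chain rule: w moves with velocity (i/m) w^{-(m-1)} and w̄ with its conjugate, which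
produces the opposite sign of the two groups in `branchDeriv`. -/
lemma hasDerivWithinAt_branchDeriv {m : ℕ} (hm : m ≠ 0) {N : ℕ} {D : Set ℂ} {F : ℕ → ℕ → ℂ → ℂ}
    (hF : IsJet N D F) {γ : ℝ → ℂ} {S : Set ℝ} {s : ℝ} (hs : s ∈ S)
    (hγ : HasDerivWithinAt γ (I / m * (γ s)⁻¹ ^ (m - 1)) S s)
    (hmaps : MapsTo γ S D) (h0 : γ s ≠ 0) (i : ℕ) : ∀ p q a b : ℕ, p + q + i < N →
    HasDerivWithinAt (fun s => branchDeriv m F i p q a b (γ s))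
      (branchDeriv m F (i + 1) p q a b (γ s)) S s := by
  have hm' : (m : ℂ) ≠ 0 := Nat.cast_ne_zero.2 hm
  have hc0 : conj (γ s) ≠ 0 := by simpa using h0
  induction i with
  | zero =>
    intro p q a b h
    have h1 := (hF.hasFDeriv p q h (γ s) (hmaps hs)).comp_hasDerivWithinAt s hγ hmaps
    have hpow : ∀ {w : ℝ → ℂ} {w' : ℂ} (_ : HasDerivWithinAt w w' S s) (_ : w s ≠ 0) (a : ℕ),
        HasDerivWithinAt (fun s => (w s)⁻¹ ^ a) (-(a * (w s)⁻¹ ^ (a + 1) * w')) S s := by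
      intro w w' hw hw0 a
      have := (hw.inv hw0).pow a
      refine this.congr_deriv ?_
      rcases a with _ | a
      · simp
      · simp only [Nat.add_sub_cancel]
        rw [pow_succ _ (a + 1), pow_succ _ a]
        simp only [Pi.inv_apply]
        field_simp
    have hconj : HasDerivWithinAt (fun s => conj (γ s))
        (conj (I / m * (γ s)⁻¹ ^ (m - 1))) S s :=
      conjCLE.toContinuousLinearMap.hasFDerivAt.comp_hasDerivWithinAt s hγ
    have h2 := hpow hγ h0 a
    have h3 := hpow hconj hc0 b
    refine (h1.mul (h2.mul h3)).congr_deriv ?_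
    obtain ⟨n, rfl⟩ := Nat.exists_eq_succ_of_ne_zero hm
    simp only [branchDeriv, wirt_apply, Function.comp_apply, map_mul, map_div₀, conj_I, map_pow,
      map_inv₀, Complex.conj_natCast, Nat.succ_eq_add_one, Nat.add_sub_cancel, pow_add, pow_one,
      Pi.mul_apply]
    ring
  | succ i ih =>
    intro p q a b h
    exact ((((ih (p + 1) q (a + (m - 1)) b (by omega)).sub
      ((ih p q (a + m) b (by omega)).const_mul _)).sub
      ((ih p (q + 1) a (b + (m - 1)) (by omega)).sub
      ((ih p q a (b + m) (by omega)).const_mul _))).const_mul _)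

lemma continuousOn_branchDeriv {m N : ℕ} {D : Set ℂ} {F : ℕ → ℕ → ℂ → ℂ} (hF : IsJet N D F)
    (i : ℕ) : ∀ p q a b : ℕ, p + q + i ≤ N →
    ContinuousOn (branchDeriv m F i p q a b) (D \ {0}) := by
  induction i with
  | zero =>
    intro p q a b h
    have h1 : ContinuousOn (fun w : ℂ => w⁻¹ ^ a) (D \ {0}) :=
      (continuousOn_inv₀.mono fun w hw => hw.2).pow a
    have h2 : ContinuousOn (fun w : ℂ => (conj w)⁻¹ ^ b) (D \ {0}) := by
      refine ContinuousOn.pow (ContinuousOn.inv₀ continuous_conj.continuousOn fun w hw => ?_) b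
      simpa using hw.2
    exact ((hF.continuousOn p q h).mono sdiff_subset).mul (h1.mul h2)
  | succ i ih =>
    intro p q a b h
    exact continuousOn_const.mul (((ih (p + 1) q (a + (m - 1)) b (by omega)).sub
      (continuousOn_const.mul (ih p q (a + m) b (by omega)))).sub
      ((ih p (q + 1) a (b + (m - 1)) (by omega)).sub
      (continuousOn_const.mul (ih p q a (b + m) (by omega)))))

/-- Homogeneity count: every term of one differentiation loses m powers of |w|, either one from the
jet and m - 1 from the velocity, or m from the weight. The constant is chosen before F, w, M and N.
-/
lemma norm_branchDeriv_le {m : ℕ} (hm : m ≠ 0) (i : ℕ) : ∀ a b : ℕ, ∃ C : ℝ, 0 ≤ C ∧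
    ∀ (F : ℕ → ℕ → ℂ → ℂ) (w : ℂ), w ≠ 0 → ∀ (M : ℝ) (κ : ℤ) (N : ℕ),
    (∀ p q, p + q ≤ N → ‖F p q w‖ ≤ M * ‖w‖ ^ (κ - p - q)) →
    ∀ p q, p + q + i ≤ N →
      ‖branchDeriv m F i p q a b w‖ ≤ C * M * ‖w‖ ^ (κ - p - q - a - b - m * i) := by
  induction i with
  | zero =>
    intro a b
    refine ⟨1, zero_le_one, fun F w hw M κ N hF p q h => ?_⟩
    have hw' : ‖w‖ ≠ 0 := norm_ne_zero_iff.2 hw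
    have e : ‖w‖ ^ (κ - p - q - a - b - m * ((0 : ℕ) : ℤ)) =
        ‖w‖ ^ (κ - p - q) * (‖w‖⁻¹ ^ a * ‖w‖⁻¹ ^ b) := by
      rw [show κ - p - q - a - b - m * ((0 : ℕ) : ℤ) = κ - p - q - a - b by simp,
        zpow_sub₀ hw', zpow_sub₀ hw', zpow_natCast, zpow_natCast, inv_pow, inv_pow]
      field_simp
    rw [e, branchDeriv, norm_mul, norm_mul, norm_pow, norm_pow, norm_inv, norm_inv,
      RCLike.norm_conj, one_mul]
    exact (mul_le_mul_of_nonneg_right (hF p q h) (by positivity)).trans_eq (by ring)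
  | succ i ih =>
    intro a b
    obtain ⟨C₁, h₁, H₁⟩ := ih (a + (m - 1)) b
    obtain ⟨C₂, h₂, H₂⟩ := ih (a + m) b
    obtain ⟨C₃, h₃, H₃⟩ := ih a (b + (m - 1))
    obtain ⟨C₄, h₄, H₄⟩ := ih a (b + m)
    refine ⟨‖I / (m : ℂ)‖ * ((C₁ + a * C₂) + (C₃ + b * C₄)), by positivity,
      fun F w hw M κ N hF p q h => ?_⟩
    have b₁ := H₁ F w hw M κ N hF (p + 1) q (by omega)
    have b₂ := H₂ F w hw M κ N hF p q (by omega)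
    have b₃ := H₃ F w hw M κ N hF p (q + 1) (by omega)
    have b₄ := H₄ F w hw M κ N hF p q (by omega)
    have hm1 : ((m - 1 : ℕ) : ℤ) = m - 1 := by omega
    rw [show κ - ((p + 1 : ℕ) : ℤ) - q - ((a + (m - 1) : ℕ) : ℤ) - b - m * i =
      κ - p - q - a - b - m * ((i + 1 : ℕ) : ℤ) by push_cast [hm1]; ring] at b₁
    rw [show κ - (p : ℤ) - q - ((a + m : ℕ) : ℤ) - b - m * i =
      κ - p - q - a - b - m * ((i + 1 : ℕ) : ℤ) by push_cast; ring] at b₂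
    rw [show κ - (p : ℤ) - ((q + 1 : ℕ) : ℤ) - a - ((b + (m - 1) : ℕ) : ℤ) - m * i =
      κ - p - q - a - b - m * ((i + 1 : ℕ) : ℤ) by push_cast [hm1]; ring] at b₃
    rw [show κ - (p : ℤ) - q - a - ((b + m : ℕ) : ℤ) - m * i =
      κ - p - q - a - b - m * ((i + 1 : ℕ) : ℤ) by push_cast; ring] at b₄
    set E := ‖w‖ ^ (κ - p - q - a - b - m * ((i + 1 : ℕ) : ℤ))
    rw [branchDeriv, norm_mul, mul_assoc, mul_assoc]
    gcongr
    calc _ ≤ (‖branchDeriv m F i (p + 1) q (a + (m - 1)) b w‖ +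
          a * ‖branchDeriv m F i p q (a + m) b w‖) +
          (‖branchDeriv m F i p (q + 1) a (b + (m - 1)) w‖ +
          b * ‖branchDeriv m F i p q a (b + m) w‖) := by
          refine (norm_sub_le _ _).trans (add_le_add ?_ ?_)
          · refine (norm_sub_le _ _).trans_eq ?_
            rw [norm_mul, Complex.norm_natCast]
          · refine (norm_sub_le _ _).trans_eq ?_
            rw [norm_mul, Complex.norm_natCast]
      _ ≤ (C₁ * M * E + a * (C₂ * M * E)) + (C₃ * M * E + b * (C₄ * M * E)) := by gcongr
      _ = _ := by ring

/-- The iterated derivatives of `phi`, in terms of a jet. -/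
def jetInt (m l : ℕ) (F : ℕ → ℕ → ℂ → ℂ) (i : ℕ) (s : ℝ) : ℂ :=
  ∫ u in (-1 : ℝ)..1, branchDeriv m F i 0 0 (m - 1) (m - 1) (root m l ⟨u, s⟩)

lemma ne_zero_of_mem_punctured {s : ℝ} (hs : s ∈ punctured) : s ≠ 0 := by
  rcases hs with h | h; exacts [h.2.ne, h.1.ne']

lemma continuousOn_root_rect (m l : ℕ) :
    ContinuousOn (fun p : ℝ × ℝ => root m l ⟨p.2, p.1⟩) (punctured ×ˢ Icc (-1) 1) := by
  intro p hp
  have hz : (⟨p.2, p.1⟩ : ℂ).im ≠ 0 := ne_zero_of_mem_punctured hp.1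
  have hc : ContinuousAt (fun p : ℝ × ℝ => (⟨p.2, p.1⟩ : ℂ)) p := by
    have : Continuous fun p : ℝ × ℝ => (p.2 : ℂ) + p.1 * I := by fun_prop
    refine this.continuousAt.congr (Eventually.of_forall fun p => ?_)
    simp [mk_eq_add_mul_I]
  have h1 : ContinuousAt (fun z => cexp (2 * Real.pi * I / m) ^ l * cexp (upperLog z / m))
      (⟨p.2, p.1⟩ : ℂ) :=
    ((((hasDerivAt_upperLog hz).div_const _).cexp).const_mul _).continuousAt
  have h2 : ContinuousWithinAt
      (fun p : ℝ × ℝ => cexp (2 * Real.pi * I / m) ^ l * cexp (upperLog ⟨p.2, p.1⟩ / m))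
      (punctured ×ˢ Icc (-1) 1) p :=
    (ContinuousAt.comp (x := p) (f := fun p : ℝ × ℝ => (⟨p.2, p.1⟩ : ℂ)) h1 hc).continuousWithinAt
  exact h2.congr (fun q hq => root_eq (ne_zero_of_mem_punctured hq.1)) (root_eq hz)

lemma continuousOn_branchDeriv_rect {m l N i : ℕ} (hm : m ≠ 0) {F : ℕ → ℕ → ℂ → ℂ}
    (hF : IsJet N (domain m) F) (hi : i ≤ N) :
    ContinuousOn (fun p : ℝ × ℝ => branchDeriv m F i 0 0 (m - 1) (m - 1) (root m l ⟨p.2, p.1⟩))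
      (punctured ×ˢ Icc (-1) 1) :=
  (continuousOn_branchDeriv hF i 0 0 (m - 1) (m - 1) (by omega)).comp (continuousOn_root_rect m l)
    fun _ hp => ⟨root_mem_domain hm hp.1 hp.2, root_ne_zero (ne_zero_of_mem_punctured hp.1)⟩

lemma continuousOn_jetInt {m l N i : ℕ} (hm : m ≠ 0) {F : ℕ → ℕ → ℂ → ℂ}
    (hF : IsJet N (domain m) F) (hi : i ≤ N) : ContinuousOn (jetInt m l F i) punctured :=
  locIcc_punctured.continuousOn_param
    (F := fun s u => branchDeriv m F i 0 0 (m - 1) (m - 1) (root m l ⟨u, s⟩))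
    (continuousOn_branchDeriv_rect hm hF hi)

lemma hasDerivWithinAt_jetInt {m l N i : ℕ} (hm : m ≠ 0) {F : ℕ → ℕ → ℂ → ℂ}
    (hF : IsJet N (domain m) F) (hi : i < N) {s : ℝ} (hs : s ∈ punctured) :
    HasDerivWithinAt (jetInt m l F i) (jetInt m l F (i + 1) s) punctured s :=
  locIcc_punctured.hasDerivWithinAt_param
    (F := fun s u => branchDeriv m F i 0 0 (m - 1) (m - 1) (root m l ⟨u, s⟩))
    (F' := fun s u => branchDeriv m F (i + 1) 0 0 (m - 1) (m - 1) (root m l ⟨u, s⟩))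
    (continuousOn_branchDeriv_rect hm hF hi.le) (continuousOn_branchDeriv_rect hm hF hi)
    (fun u hu s hs => hasDerivWithinAt_branchDeriv hm hF (γ := fun s => root m l ⟨u, s⟩) hs
      (hasDerivAt_root hm (ne_zero_of_mem_punctured hs)).hasDerivWithinAt
      (fun _ ht => root_mem_domain hm ht hu) (root_ne_zero (ne_zero_of_mem_punctured hs)) i 0 0 _ _
      (by omega)) hs

lemma norm_mk_sq (u s : ℝ) : ‖(⟨u, s⟩ : ℂ)‖ ^ 2 = u ^ 2 + s ^ 2 := by
  rw [← normSq_eq_norm_sq, normSq_mk]; ring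

/-- The denominator is (w w̄)^{m-1}, because |z| = |w|^m. -/
lemma phi_eq_jetInt {m l : ℕ} (hm : m ≠ 0) {f : ℂ → ℂ} {F : ℕ → ℕ → ℂ → ℂ} (hF : F 0 0 = f)
    {s : ℝ} (hs : s ∈ punctured) : phi m l f s = jetInt m l F 0 s := by
  refine intervalIntegral.integral_congr fun u _ => ?_
  have hz : (⟨u, s⟩ : ℂ).im ≠ 0 := ne_zero_of_mem_punctured hs
  have hm' : (m : ℝ) ≠ 0 := Nat.cast_ne_zero.2 hm
  set w := root m l ⟨u, s⟩ with hw
  have e : (u ^ 2 + s ^ 2) ^ (((m : ℝ) - 1) / m) = (‖w‖ ^ 2) ^ (m - 1) := by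
    rw [← norm_mk_sq, ← norm_root_pow (l := l) hm hz, ← hw, ← pow_mul, mul_comm m 2, pow_mul,
      ← Real.rpow_natCast (‖w‖ ^ 2) m, ← Real.rpow_mul (by positivity),
      ← Real.rpow_natCast (‖w‖ ^ 2) (m - 1)]
    congr 1
    rw [Nat.cast_sub (by omega)]
    field_simp
    simp
  rw [e, branchDeriv, hF, ofReal_pow, ofReal_pow, ← mul_conj', div_eq_mul_inv, ← inv_pow, mul_inv,
    mul_pow]

/-! ### Contribution of the Taylor remainder. -/

lemma bIdx_nonneg (m k : ℕ) : 0 ≤ bIdx m k := sub_nonneg.2 (Nat.le_ceil _)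

lemma bIdx_lt_one {m : ℕ} (hm : 2 ≤ m) (k : ℕ) : bIdx m k < 1 := by
  have hm' : (0 : ℝ) < m := by positivity
  rw [bIdx, nIdx]
  rcases le_or_gt (((k : ℝ) - ((m : ℝ) - 2)) / m) 0 with h | h
  · rw [Nat.ceil_eq_zero.2 h, Nat.cast_zero, zero_sub, neg_lt, lt_div_iff₀ hm']
    have : (0 : ℝ) ≤ k := by positivity
    linarith
  · linarith [Nat.ceil_lt_add_one h.le]

/-- As |z| ≥ |s|, the kernel is at most |s|^{-b} |z|^{-2}, and the integral of |z|^{-2} is an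
arctangent bounded by π/|s|. The constant M' absorbs the part of the integrand away from the
singularity. -/
lemma norm_integral_kernel_le {h : ℝ → ℂ} {b s M M' : ℝ} (hb : 0 ≤ b) (hs : s ≠ 0) (hM : 0 ≤ M)
    (hh : ∀ u ∈ Icc (-1 : ℝ) 1, ‖h u‖ ≤ M * ‖(⟨u, s⟩ : ℂ)‖ ^ (-(2 + b)) + M') :
    ‖∫ u in (-1 : ℝ)..1, h u‖ ≤ M * Real.pi * |s| ^ (-(1 + b)) + 2 * M' := by
  have hs' : 0 < |s| := abs_pos.2 hs
  have hpt : ∀ u ∈ Ioc (-1 : ℝ) 1, ‖h u‖ ≤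
      M * |s| ^ (-(2 + b)) * (1 + (u / |s|) ^ 2)⁻¹ + M' := by
    intro u hu
    refine (hh u ⟨hu.1.le, hu.2⟩).trans (add_le_add ?_ le_rfl)
    rw [mul_assoc]
    gcongr
    have hz : |s| ≤ ‖(⟨u, s⟩ : ℂ)‖ := abs_im_le_norm (⟨u, s⟩ : ℂ)
    have hzp : 0 < ‖(⟨u, s⟩ : ℂ)‖ := hs'.trans_le hz
    rw [neg_add, Real.rpow_add hzp, Real.rpow_add hs']
    have h1 : ‖(⟨u, s⟩ : ℂ)‖ ^ (-b) ≤ |s| ^ (-b) :=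
      Real.rpow_le_rpow_of_nonpos hs' hz (by linarith)
    have h2 : ‖(⟨u, s⟩ : ℂ)‖ ^ (-2 : ℝ) = |s| ^ (-2 : ℝ) * (1 + (u / |s|) ^ 2)⁻¹ := by
      rw [Real.rpow_neg hzp.le, Real.rpow_neg hs'.le, Real.rpow_two, Real.rpow_two, norm_mk_sq,
        ← mul_inv]
      congr 1
      field_simp
      rw [sq_abs]; ring
    rw [h2]
    calc _ ≤ |s| ^ (-2 : ℝ) * (1 + (u / |s|) ^ 2)⁻¹ * |s| ^ (-b) := by gcongr
      _ = _ := by ring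
  have hc : Continuous fun u : ℝ => (1 + (u / |s|) ^ 2)⁻¹ :=
    Continuous.inv₀ (by fun_prop) fun u => by positivity
  have hint : IntervalIntegrable (fun u : ℝ => M * |s| ^ (-(2 + b)) * (1 + (u / |s|) ^ 2)⁻¹)
      volume (-1) 1 := (hc.const_mul _).intervalIntegrable _ _
  have h1 := intervalIntegral.norm_integral_le_of_norm_le (by norm_num : (-1 : ℝ) ≤ 1)
    (ae_of_all _ fun u hu => hpt u hu) (hint.add (intervalIntegrable_const (c := M')))
  refine h1.trans ?_
  rw [intervalIntegral.integral_add hint intervalIntegrable_const,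
    intervalIntegral.integral_const_mul,
    intervalIntegral.integral_comp_div (fun v : ℝ => (1 + v ^ 2)⁻¹) hs'.ne',
    integral_inv_one_add_sq, intervalIntegral.integral_const, smul_eq_mul, smul_eq_mul]
  have ha : Real.arctan (1 / |s|) - Real.arctan (-1 / |s|) ≤ Real.pi := by
    linarith [Real.arctan_lt_pi_div_two (1 / |s|), Real.neg_pi_div_two_lt_arctan (-1 / |s|)]
  have e : |s| ^ (-(2 + b)) * |s| = |s| ^ (-(1 + b)) := by
    rw [← Real.rpow_add_one hs'.ne']; congr 1; ring
  rw [← e]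
  have : M * |s| ^ (-(2 + b)) * (|s| * (Real.arctan (1 / |s|) - Real.arctan (-1 / |s|))) ≤
      M * |s| ^ (-(2 + b)) * (|s| * Real.pi) := by gcongr
  linarith

/-- The identity k - 2(m-1) - m(n+1) = -m(2+b), which is where n and b come from. -/
lemma norm_root_zpow {m l : ℕ} (hm : 2 ≤ m) (k : ℕ) {z : ℂ} (hz : z.im ≠ 0) :
    ‖root m l z‖ ^ ((k : ℤ) - (0 : ℕ) - (0 : ℕ) - (m - 1 : ℕ) - (m - 1 : ℕ) -
      m * ((nIdx m k + 1 : ℕ) : ℤ)) = ‖z‖ ^ (-(2 + bIdx m k)) := by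
  have hm' : (m : ℝ) ≠ 0 := by positivity
  rw [← norm_root_pow (l := l) (by omega : m ≠ 0) hz, ← Real.rpow_natCast,
    ← Real.rpow_mul (norm_nonneg _), ← Real.rpow_intCast]
  congr 1
  rw [bIdx]
  push_cast [Nat.cast_sub (by omega : 1 ≤ m)]
  field_simp
  ring

/-- The bound `‖G p q w‖ ≤ M ‖w‖ ^ (k - p - q)` for a family of functions on a set. -/
def JetBound (N k : ℕ) (D : Set ℂ) (G : ℕ → ℕ → ℂ → ℂ) (M : ℝ) : Prop :=
  ∀ p q, p + q ≤ N → ∀ w ∈ D, w ≠ 0 → ‖G p q w‖ ≤ M * ‖w‖ ^ ((k : ℤ) - p - q)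

lemma JetBound.norm_jetInt_le {m : ℕ} (hm : 2 ≤ m) (k N : ℕ) (hN : nIdx m k + 1 ≤ N) :
    ∃ C : ℝ, 0 ≤ C ∧ ∀ (l : ℕ) (G : ℕ → ℕ → ℂ → ℂ) (M : ℝ), 0 ≤ M →
      JetBound N k (domain m) G M → ∀ s ∈ punctured,
      ‖jetInt m l G (nIdx m k + 1) s‖ ≤ C * M * |s| ^ (-(1 + bIdx m k)) := by
  have hm0 : m ≠ 0 := by omega
  obtain ⟨C, hC, H⟩ := norm_branchDeriv_le hm0 (nIdx m k + 1) (m - 1) (m - 1)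
  refine ⟨C * Real.pi, by positivity, fun l G M hM hG s hs => ?_⟩
  have hs0 := ne_zero_of_mem_punctured hs
  have := norm_integral_kernel_le (b := bIdx m k) (s := s) (M := C * M) (M' := 0)
    (h := fun u => branchDeriv m G (nIdx m k + 1) 0 0 (m - 1) (m - 1) (root m l ⟨u, s⟩))
    (bIdx_nonneg m k) hs0 (by positivity) (fun u hu => by
      have hz : (⟨u, s⟩ : ℂ).im ≠ 0 := hs0
      have h0 := root_ne_zero (m := m) (l := l) hz
      rw [← norm_root_zpow (l := l) hm k hz, add_zero]
      exact H G _ h0 M k N (fun p q h => hG p q h _ (root_mem_domain hm0 hs hu) h0) 0 0 (by omega))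
  rw [jetInt]
  refine this.trans_eq (by ring)

/-- For |s| = 1 one has |w| ≥ 1, so negative powers are harmless. These values are the initial data
when the top derivative is integrated down. -/
lemma JetBound.norm_jetInt_side_le {m : ℕ} (hm : 2 ≤ m) (k N i : ℕ) (hi : i ≤ N) :
    ∃ C : ℝ, 0 ≤ C ∧ ∀ (l : ℕ) (G : ℕ → ℕ → ℂ → ℂ) (M : ℝ), 0 ≤ M →
      JetBound N k (domain m) G M → ∀ s ∈ punctured, |s| = 1 → ‖jetInt m l G i s‖ ≤ C * M := by
  have hm0 : m ≠ 0 := by omega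
  obtain ⟨C, hC, H⟩ := norm_branchDeriv_le hm0 i (m - 1) (m - 1)
  refine ⟨C * 2 ^ k * 2, by positivity, fun l G M hM hG s hs hs1 => ?_⟩
  have hs0 := ne_zero_of_mem_punctured hs
  have := intervalIntegral.norm_integral_le_of_norm_le_const (a := -1) (b := 1) (C := C * M * 2 ^ k)
    (f := fun u => branchDeriv m G i 0 0 (m - 1) (m - 1) (root m l ⟨u, s⟩)) (fun u hu => by
      rw [uIoc_of_le (by norm_num)] at hu
      have hu' : u ∈ Icc (-1 : ℝ) 1 := ⟨hu.1.le, hu.2⟩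
      have hz : (⟨u, s⟩ : ℂ).im ≠ 0 := hs0
      have h0 := root_ne_zero (m := m) (l := l) hz
      have hD := root_mem_domain (l := l) hm0 hs hu'
      refine (H G _ h0 M k N (fun p q h => hG p q h _ hD h0) 0 0 (by omega)).trans ?_
      have h1 : 1 ≤ ‖root m l ⟨u, s⟩‖ := by
        by_contra! hlt
        have h2 : ‖root m l ⟨u, s⟩‖ ^ m < 1 := pow_lt_one₀ (norm_nonneg _) hlt hm0
        rw [norm_root_pow hm0 hz] at h2
        have := abs_im_le_norm (⟨u, s⟩ : ℂ)
        simp only at this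
        linarith
      gcongr
      calc _ ≤ ‖root m l ⟨u, s⟩‖ ^ (k : ℤ) := by
            apply zpow_le_zpow_right₀ h1
            have h3 : (0 : ℤ) ≤ m * i := by positivity
            omega
        _ ≤ 2 ^ k := by
            rw [zpow_natCast]
            exact pow_le_pow_left₀ (norm_nonneg _) (norm_le_two_of_mem_domain hm0 hD) k)
  rw [jetInt]
  refine this.trans_eq ?_
  norm_num; ring

/-- The integral is split at |w| = δ: the near part carries the small constant, and the far part is
bounded, hence killed by |s|^{1+b}. -/
lemma JetBound.tendsto_jetInt {m : ℕ} (hm : 2 ≤ m) {k N l : ℕ} (hN : nIdx m k + 1 ≤ N)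
    {G : ℕ → ℕ → ℂ → ℂ} {M : ℝ} (hM : 0 ≤ M) (hG : JetBound N k (domain m) G M)
    (hsmall : ∀ ε : ℝ, 0 < ε → ∃ δ : ℝ, 0 < δ ∧ ∀ p q, p + q ≤ N → ∀ w ∈ domain m, w ≠ 0 →
      ‖w‖ ≤ δ → ‖G p q w‖ ≤ ε * ‖w‖ ^ ((k : ℤ) - p - q)) :
    Tendsto (fun s : ℝ => ((|s| ^ (1 + bIdx m k) : ℝ) : ℂ) * jetInt m l G (nIdx m k + 1) s)
      (𝓝[punctured] 0) (𝓝 0) := by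
  have hm0 : m ≠ 0 := by omega
  have hb := bIdx_nonneg m k
  obtain ⟨C, hC, H⟩ := norm_branchDeriv_le hm0 (nIdx m k + 1) (m - 1) (m - 1)
  rw [Metric.tendsto_nhds]
  intro ε hε
  obtain ⟨δ, hδ, hδ'⟩ := hsmall (ε / (2 * (C * Real.pi + 1))) (by positivity)
  set η := ε / (2 * (C * Real.pi + 1)) with hη
  have hηpos : 0 < η := by positivity
  set M' := C * M * (δ ^ m) ^ (-(2 + bIdx m k)) with hM'
  have hlim : Tendsto (fun s : ℝ => 2 * M' * |s| ^ (1 + bIdx m k)) (𝓝[punctured] 0) (𝓝 0) := by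
    have hc : ContinuousAt (fun s : ℝ => 2 * M' * |s| ^ (1 + bIdx m k)) 0 :=
      continuousAt_const.mul (ContinuousAt.rpow_const continuous_abs.continuousAt
        (Or.inr (by linarith)))
    have := hc.tendsto.mono_left (nhdsWithin_le_nhds (s := punctured))
    rwa [abs_zero, Real.zero_rpow (by linarith), mul_zero] at this
  filter_upwards [self_mem_nhdsWithin, hlim.eventually (gt_mem_nhds (half_pos hε))] with s hs hsε
  have hs0 := ne_zero_of_mem_punctured hs
  have hs' : 0 < |s| := abs_pos.2 hs0
  have key := norm_integral_kernel_le (b := bIdx m k) (s := s) (M := C * η) (M' := M')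
    (h := fun u => branchDeriv m G (nIdx m k + 1) 0 0 (m - 1) (m - 1) (root m l ⟨u, s⟩))
    hb hs0 (by positivity) (fun u hu => by
      have hz : (⟨u, s⟩ : ℂ).im ≠ 0 := hs0
      have h0 := root_ne_zero (m := m) (l := l) hz
      have hD := root_mem_domain (l := l) hm0 hs hu
      rcases le_or_gt ‖root m l ⟨u, s⟩‖ δ with hle | hgt
      · refine le_add_of_le_of_nonneg ?_ (by positivity)
        rw [← norm_root_zpow (l := l) hm k hz]
        exact H G _ h0 η k N (fun p q h => hδ' p q h _ hD h0 hle) 0 0 (by omega)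
      · refine le_add_of_nonneg_of_le (by positivity) ?_
        refine (H G _ h0 M k N (fun p q h => hG p q h _ hD h0) 0 0 (by omega)).trans ?_
        rw [norm_root_zpow (l := l) hm k hz, hM']
        have hle : δ ^ m ≤ ‖(⟨u, s⟩ : ℂ)‖ := by
          rw [← norm_root_pow (l := l) hm0 hz]
          exact pow_le_pow_left₀ hδ.le hgt.le m
        exact mul_le_mul_of_nonneg_left
          (Real.rpow_le_rpow_of_nonpos (pow_pos hδ m) hle (by linarith)) (by positivity))
  rw [dist_zero_right, norm_mul, norm_real, Real.norm_of_nonneg (by positivity)]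
  have e : |s| ^ (1 + bIdx m k) * |s| ^ (-(1 + bIdx m k)) = 1 := by
    rw [← Real.rpow_add hs', add_neg_cancel, Real.rpow_zero]
  calc |s| ^ (1 + bIdx m k) * ‖jetInt m l G (nIdx m k + 1) s‖
      ≤ |s| ^ (1 + bIdx m k) * (C * η * Real.pi * |s| ^ (-(1 + bIdx m k)) + 2 * M') := by
        gcongr; exact key
    _ = C * η * Real.pi * (|s| ^ (1 + bIdx m k) * |s| ^ (-(1 + bIdx m k))) +
        2 * M' * |s| ^ (1 + bIdx m k) := by ring
    _ < ε / 2 + ε / 2 := by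
        rw [e, mul_one]
        refine add_lt_add ?_ hsε
        have : η * (2 * (C * Real.pi + 1)) = ε := by rw [hη]; field_simp
        nlinarith
    _ = ε := by ring

/-! ### Contribution of the monomials of the Taylor polynomial. -/

/-- The exponent `((m - 1) - j) / m`. -/
def expo (m j : ℕ) : ℝ := ((m : ℝ) - 1 - j) / m

/-- The angular factor `θ₀ ^ (L (r - t))`. -/
def angle (m L r t : ℕ) : ℂ := cexp (Real.pi * I / m) ^ ((L : ℤ) * ((r : ℤ) - t))

lemma norm_angle (m L r t : ℕ) : ‖angle m L r t‖ = 1 := by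
  rw [angle, norm_zpow, show (Real.pi : ℂ) * I / m = ((Real.pi / m : ℝ) : ℂ) * I by push_cast; ring,
    norm_exp_ofReal_mul_I, one_zpow]

/-- With w = θ₀^L ζ^{1/m} the weight w^{-(m-1)} w̄^{-(m-1)} shifts the exponents r/m and t/m to
`-expo m r` and `-expo m t`; since |θ₀| = 1 it leaves only the phase of r - t. -/
lemma branch_monomial {m : ℕ} (hm : m ≠ 0) (L r t : ℕ) {ζ : ℂ} (hζ : 0 < ζ.im) {w : ℂ}
    (hw : w = cexp (Real.pi * I / m) ^ L * cexp (log ζ / m)) :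
    w ^ r * (conj w) ^ t * (w⁻¹ ^ (m - 1) * (conj w)⁻¹ ^ (m - 1)) =
      angle m L r t * upow (expo m r) (expo m t) ζ := by
  have hm' : (m : ℂ) ≠ 0 := Nat.cast_ne_zero.2 hm
  have hζ0 := ne_zero_of_im_ne hζ.ne'
  have hζc : conj ζ ≠ 0 := by simpa using hζ0
  have harg : ζ.arg ≠ Real.pi := (mem_slitPlane_iff_arg.1 (mem_slitPlane_of_im_pos hζ)).1
  have e1 : w = cexp ((L * (Real.pi * I) + log ζ) / m) := by
    rw [hw, ← Complex.exp_nat_mul, ← Complex.exp_add]; congr 1; ring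
  have e2 : conj w = cexp ((-(L * (Real.pi * I)) + conj (log ζ)) / m) := by
    rw [e1, ← exp_conj]; congr 1; simp
  rw [e2, e1, ← Complex.exp_neg, ← Complex.exp_neg, ← Complex.exp_nat_mul, ← Complex.exp_nat_mul,
    ← Complex.exp_nat_mul, ← Complex.exp_nat_mul, angle, ← Complex.exp_int_mul, upow,
    cpow_def_of_ne_zero hζ0, cpow_def_of_ne_zero hζc, log_conj _ harg]
  simp only [← Complex.exp_add]
  congr 1
  rw [expo, expo]
  push_cast [Nat.cast_sub (by omega : 1 ≤ m)]
  field_simp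
  ring

/-- The iterated derivatives of `phi` for the monomial `w ^ r * conj w ^ t`. -/
def monoInt (m l r t i : ℕ) (s : ℝ) : ℂ :=
  if 0 < s then angle m (2 * l) r t * segDeriv i (expo m r) (expo m t) s
  else (-1) ^ i * angle m (2 * l + 1) r t * segDeriv i (expo m r) (expo m t) (-s)

lemma exp_two_pi_div_pow (m l : ℕ) :
    cexp (2 * Real.pi * I / m) ^ l = cexp (Real.pi * I / m) ^ (2 * l) := by
  rw [pow_mul, ← Complex.exp_nat_mul _ 2]
  congr 2
  push_cast; ring

lemma root_of_pos {m l : ℕ} {z : ℂ} (h : 0 < z.im) :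
    root m l z = cexp (Real.pi * I / m) ^ (2 * l) * cexp (log z / m) := by
  rw [root_eq h.ne', upperLog_of_pos h, exp_two_pi_div_pow]

lemma root_of_neg {m l : ℕ} {z : ℂ} (h : z.im < 0) :
    root m l z = cexp (Real.pi * I / m) ^ (2 * l + 1) * cexp (log (-z) / m) := by
  have e : cexp ((log (-z) + Real.pi * I) / m) =
      cexp (Real.pi * I / m) * cexp (log (-z) / m) := by
    rw [← Complex.exp_add]; congr 1; ring
  rw [root_eq h.ne, upperLog_of_neg h, exp_two_pi_div_pow, e, pow_succ]
  ring

/-- For s < 0 the point -z lies in the upper half plane and the branch acquires one more factor θ₀;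
the change u ↦ -u preserves [-1, 1]. -/
lemma monoInt_zero {m : ℕ} (hm : m ≠ 0) (l r t : ℕ) {s : ℝ} (hs : s ≠ 0) :
    ∫ u in (-1 : ℝ)..1, (root m l ⟨u, s⟩ ^ r * (conj (root m l ⟨u, s⟩)) ^ t *
      ((root m l ⟨u, s⟩)⁻¹ ^ (m - 1) * (conj (root m l ⟨u, s⟩))⁻¹ ^ (m - 1))) =
      monoInt m l r t 0 s := by
  rcases lt_or_gt_of_ne hs with h | h
  · rw [monoInt, if_neg (by linarith)]
    have e : ∀ u : ℝ, root m l ⟨u, s⟩ ^ r * (conj (root m l ⟨u, s⟩)) ^ t *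
      ((root m l ⟨u, s⟩)⁻¹ ^ (m - 1) * (conj (root m l ⟨u, s⟩))⁻¹ ^ (m - 1)) =
      angle m (2 * l + 1) r t *
        upow (expo m r) (expo m t) (((-u : ℝ) : ℂ) + ((-s : ℝ) : ℂ) * I) := by
      intro u
      have hz : -(⟨u, s⟩ : ℂ) = ((-u : ℝ) : ℂ) + ((-s : ℝ) : ℂ) * I := by
        rw [mk_eq_add_mul_I]; push_cast; ring
      rw [← hz]
      exact branch_monomial hm _ _ _ (by simpa using h) (root_of_neg h)
    simp_rw [e]
    rw [intervalIntegral.integral_const_mul, intervalIntegral.integral_comp_neg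
      (fun u : ℝ => upow (expo m r) (expo m t) ((u : ℂ) + ((-s : ℝ) : ℂ) * I))]
    simp [segDeriv, segInt]
  · rw [monoInt, if_pos h, segDeriv, segInt, ← intervalIntegral.integral_const_mul]
    refine intervalIntegral.integral_congr fun u _ => ?_
    have hz : (⟨u, s⟩ : ℂ) = (u : ℂ) + (s : ℂ) * I := mk_eq_add_mul_I _ _
    rw [← hz]
    exact branch_monomial hm _ _ _ h (root_of_pos h)

lemma hasDerivAt_monoInt (m l r t i : ℕ) {s : ℝ} (hs : s ≠ 0) :
    HasDerivAt (monoInt m l r t i) (monoInt m l r t (i + 1) s) s := by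
  rcases lt_or_gt_of_ne hs with h | h
  · have h1 : HasDerivAt (fun s : ℝ => (-1) ^ i * angle m (2 * l + 1) r t *
        segDeriv i (expo m r) (expo m t) (-s)) _ s :=
      ((hasDerivAt_segDeriv i (expo m r) (expo m t) (neg_pos.2 h)).scomp s
        (hasDerivAt_neg s)).const_mul _
    refine (h1.congr_deriv ?_).congr_of_eventuallyEq ?_
    · rw [monoInt, if_neg (by linarith), pow_succ]; simp
    · filter_upwards [Iio_mem_nhds h] with x hx
      exact if_neg (by have := mem_Iio.1 hx; linarith)
  · have h1 := (hasDerivAt_segDeriv i (expo m r) (expo m t) h).const_mul (angle m (2 * l) r t)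
    refine (h1.congr_deriv ?_).congr_of_eventuallyEq ?_
    · rw [monoInt, if_pos h]
    · filter_upwards [Ioi_mem_nhds h] with x hx
      exact if_pos hx

/-- The iterated derivatives of `phi` for a Taylor polynomial. -/
def polyInt (m l k : ℕ) (c : ℕ → ℕ → ℂ) (i : ℕ) (s : ℝ) : ℂ :=
  ∑ r ∈ Finset.range (k + 1), ∑ t ∈ Finset.range (k + 1),
    cutoff k c r t * ((r ! : ℂ)⁻¹ * (t ! : ℂ)⁻¹) * monoInt m l r t i s

lemma hasDerivAt_polyInt (m l k : ℕ) (c : ℕ → ℕ → ℂ) (i : ℕ) {s : ℝ} (hs : s ≠ 0) :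
    HasDerivAt (polyInt m l k c i) (polyInt m l k c (i + 1) s) s :=
  HasDerivAt.fun_sum fun r _ => HasDerivAt.fun_sum fun t _ =>
    (hasDerivAt_monoInt m l r t i hs).const_mul _

lemma jetInt_taylorJet {m : ℕ} (hm : m ≠ 0) (l k : ℕ) (c : ℕ → ℕ → ℂ) {s : ℝ}
    (hs : s ∈ punctured) : jetInt m l (taylorJet k c) 0 s = polyInt m l k c 0 s := by
  have hs0 := ne_zero_of_mem_punctured hs
  have hcr : ContinuousOn (fun u : ℝ => root m l ⟨u, s⟩) (uIcc (-1) 1) := by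
    rw [uIcc_of_le (by norm_num)]
    exact (continuousOn_root_rect m l).comp (f := fun u : ℝ => (s, u)) (by fun_prop)
      fun u hu => ⟨hs, hu⟩
  have hcc : ContinuousOn (fun u : ℝ => conj (root m l ⟨u, s⟩)) (uIcc (-1) 1) :=
    continuous_conj.comp_continuousOn hcr
  have h0 : ∀ u : ℝ, root m l ⟨u, s⟩ ≠ 0 := fun u => root_ne_zero hs0
  have hint : ∀ r t : ℕ, IntervalIntegrable (fun u : ℝ => cutoff k c r t *
      ((r ! : ℂ)⁻¹ * (t ! : ℂ)⁻¹) * (root m l ⟨u, s⟩ ^ r * (conj (root m l ⟨u, s⟩)) ^ t *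
      ((root m l ⟨u, s⟩)⁻¹ ^ (m - 1) * (conj (root m l ⟨u, s⟩))⁻¹ ^ (m - 1)))) volume (-1) 1 := by
    intro r t
    refine ContinuousOn.intervalIntegrable (continuousOn_const.mul (((hcr.pow r).mul
      (hcc.pow t)).mul (((hcr.inv₀ fun u _ => h0 u).pow _).mul ((hcc.inv₀ fun u _ => ?_).pow _))))
    simpa using h0 u
  have e : ∀ u : ℝ, branchDeriv m (taylorJet k c) 0 0 0 (m - 1) (m - 1) (root m l ⟨u, s⟩) =
      ∑ r ∈ Finset.range (k + 1), ∑ t ∈ Finset.range (k + 1), cutoff k c r t *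
      ((r ! : ℂ)⁻¹ * (t ! : ℂ)⁻¹) * (root m l ⟨u, s⟩ ^ r * (conj (root m l ⟨u, s⟩)) ^ t *
      ((root m l ⟨u, s⟩)⁻¹ ^ (m - 1) * (conj (root m l ⟨u, s⟩))⁻¹ ^ (m - 1))) := by
    intro u
    rw [branchDeriv, taylorJet, Finset.sum_mul]
    refine Finset.sum_congr rfl fun r _ => ?_
    rw [Finset.sum_mul]
    refine Finset.sum_congr rfl fun t _ => ?_
    rw [divMono, zero_add, zero_add]; ring
  rw [jetInt, polyInt]
  simp_rw [e]
  rw [intervalIntegral.integral_finsetSum fun r _ => by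
    have := IntervalIntegrable.sum (Finset.range (k + 1)) (fun t _ => hint r t)
    rwa [Finset.sum_fn] at this]
  refine Finset.sum_congr rfl fun r _ => ?_
  rw [intervalIntegral.integral_finsetSum fun t _ => hint r t]
  refine Finset.sum_congr rfl fun t _ => ?_
  rw [intervalIntegral.integral_const_mul, monoInt_zero hm l r t hs0]

/-! ### Collecting the coefficients of one order into the functionals ∂^k_j and 𝒞^k_l. -/

/-- The Gamma-free part of the coefficient `asymCoef`. -/
def betaCore (x y : ℝ) : ℂ :=
  Real.pi * cexp (I * ((Real.pi / 2 * (y - x) : ℝ) : ℂ)) *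
    ((2 ^ (2 - x - y) * ((Real.Gamma x)⁻¹ * (Real.Gamma y)⁻¹) : ℝ) : ℂ)

lemma asymCoef_eq (N : ℕ) (x y : ℝ) :
    asymCoef N x y = (-1) ^ N * (Real.Gamma (x + y + N - 1) : ℂ) * betaCore x y := by
  rw [asymCoef, betaCore]; push_cast; ring

lemma inv_Gamma_sub_nat (x : ℝ) (e : ℕ) :
    (Real.Gamma (x - e))⁻¹ = (∏ i ∈ Finset.range e, (x - 1 - i)) * (Real.Gamma x)⁻¹ := by
  induction e with
  | zero => simp
  | succ e ih =>
    rw [inv_Gamma_eq, Finset.prod_range_succ, mul_right_comm, ← ih,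
      show x - ((e + 1 : ℕ) : ℝ) + 1 = x - e by push_cast; ring]
    push_cast; ring

lemma inv_Gamma_add_nat (y : ℝ) (e : ℕ) :
    (Real.Gamma (y + e))⁻¹ * ∏ i ∈ Finset.range e, (-y - i) = (-1) ^ e * (Real.Gamma y)⁻¹ := by
  induction e with
  | zero => simp
  | succ e ih =>
    rw [inv_Gamma_eq (y + e)] at ih
    rw [Finset.prod_range_succ, pow_succ,
      show y + ((e + 1 : ℕ) : ℝ) = y + e + 1 by push_cast; ring]
    linear_combination -ih

/-- The functional equation of 1/Γ is applied e times in each argument; the sign (-1)^e from the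
phase cancels the one from Γ(y + e). The ratio is the weight in `invDist`. The condition on y keeps
the denominators nonzero. -/
lemma betaCore_shift (x y : ℝ) (e : ℕ) (hy : ∀ i : ℕ, y + i ≠ 0) :
    betaCore (x - e) (y + e) = ((gbinom (x - 1) e / gbinom (-y) e : ℝ) : ℂ) * betaCore x y := by
  have hne : ∏ i ∈ Finset.range e, (-y - (i : ℝ)) ≠ 0 :=
    Finset.prod_ne_zero_iff.2 fun i _ h => hy i (by linarith)
  have hf : (e ! : ℝ) ≠ 0 := Nat.cast_ne_zero.2 (Nat.factorial_ne_zero e)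
  have e1 : cexp (I * ((Real.pi / 2 * (y + e - (x - e)) : ℝ) : ℂ)) =
      (-1) ^ e * cexp (I * ((Real.pi / 2 * (y - x) : ℝ) : ℂ)) := by
    rw [show I * ((Real.pi / 2 * (y + e - (x - e)) : ℝ) : ℂ) =
      e * (Real.pi * I) + I * ((Real.pi / 2 * (y - x) : ℝ) : ℂ) by push_cast; ring,
      Complex.exp_add, Complex.exp_nat_mul, exp_pi_mul_I]
  have e2 : (Real.Gamma (y + e))⁻¹ =
      (-1) ^ e * (Real.Gamma y)⁻¹ / ∏ i ∈ Finset.range e, (-y - (i : ℝ)) := by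
    rw [eq_div_iff hne, inv_Gamma_add_nat]
  have e3 : gbinom (x - 1) e / gbinom (-y) e =
      (∏ i ∈ Finset.range e, (x - 1 - (i : ℝ))) / ∏ i ∈ Finset.range e, (-y - (i : ℝ)) := by
    rw [gbinom, gbinom, div_div_div_cancel_right₀ hf]
  have e4 : ((-1 : ℂ) ^ e) * (-1) ^ e = 1 := by rw [← mul_pow]; simp
  rw [betaCore, betaCore, e1, inv_Gamma_sub_nat, e2, e3,
    show 2 - (x - e) - (y + e) = 2 - x - y by ring]
  push_cast
  linear_combination (Real.pi * cexp (I * (Real.pi / 2 * (y - x))) *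
    (((2 ^ (2 - x - y) : ℝ) : ℂ) * ((∏ i ∈ Finset.range e, ((x : ℂ) - 1 - i)) *
    (Real.Gamma x : ℂ)⁻¹ * ((Real.Gamma y : ℂ)⁻¹ / ∏ i ∈ Finset.range e, (-(y : ℂ) - i))))) * e4

lemma Gamma_expo_eq_zero {m t e : ℕ} (hm : m ≠ 0) (h : t + 1 = m * (e + 1)) :
    Real.Gamma (expo m t) = 0 := by
  have hm' : (m : ℝ) ≠ 0 := Nat.cast_ne_zero.2 hm
  have : expo m t = -(e : ℝ) := by
    have h' : (t : ℝ) + 1 = m * (e + 1) := by exact_mod_cast h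
    rw [expo, div_eq_iff hm']; linarith
  rw [this, Real.Gamma_neg_nat_eq_zero]

lemma expo_add_nat_ne_zero {m t : ℕ} (hm : m ≠ 0) (h : ¬ m ∣ t + 1) (i : ℕ) :
    expo m t + i ≠ 0 := by
  intro h0
  have hm' : (m : ℝ) ≠ 0 := Nat.cast_ne_zero.2 hm
  rw [expo, div_add' _ _ _ hm', div_eq_zero_iff, or_iff_left hm'] at h0
  refine h ⟨i + 1, ?_⟩
  have : (t : ℝ) + 1 = m * (i + 1) := by linarith
  exact_mod_cast this

lemma modEq_iff_dvd {m j i : ℕ} (hi : i ≤ j) :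
    ((i : ℤ) ≡ (j : ℤ) - ((m : ℤ) - 1) [ZMOD (m : ℤ)]) ↔ m ∣ j - i + 1 := by
  rw [Int.modEq_iff_dvd, ← Int.natCast_dvd_natCast]
  have : ((j - i + 1 : ℕ) : ℤ) = (j : ℤ) - (m - 1) - i + m := by omega
  rw [this, dvd_add_self_right]

/-- Write r = i + em. Dropping r ≡ -1 mod m leaves i ≤ m - 2, and whether m divides j - r + 1
depends on i only. -/
lemma sum_residue {m : ℕ} (hm : 2 ≤ m) (j : ℕ) (G : ℕ → ℂ)
    (h1 : ∀ r ≤ j, m ∣ r + 1 → G r = 0) (h2 : ∀ r ≤ j, m ∣ j - r + 1 → G r = 0) :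
    ∑ r ∈ Finset.range (j + 1), G r =
      ∑ i ∈ (Finset.range (min j (m - 2) + 1)).filter
        (fun i : ℕ => ¬ ((i : ℤ) ≡ (j : ℤ) - ((m : ℤ) - 1) [ZMOD (m : ℤ)])),
        ∑ e ∈ Finset.range ((j - i) / m + 1), G (i + e * m) := by
  have hm0 : 0 < m := by omega
  have hdvd : ∀ i e : ℕ, i + e * m ≤ j → (m ∣ j - (i + e * m) + 1 ↔ m ∣ j - i + 1) := by
    intro i e h
    rw [show j - i + 1 = j - (i + e * m) + 1 + e * m by omega, Nat.dvd_add_left (dvd_mul_left m e)]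
  have hmod : ∀ r : ℕ, ¬ m ∣ r + 1 → r % m ≤ m - 2 := by
    intro r hr
    by_contra hlt
    have h3 : r % m = m - 1 := by have := Nat.mod_lt r hm0; omega
    apply hr
    have h4 := Nat.div_add_mod r m
    exact ⟨r / m + 1, by rw [mul_add, mul_one]; omega⟩
  rw [Finset.sum_sigma', ← Finset.sum_filter_of_ne (p := fun r => ¬ m ∣ r + 1 ∧ ¬ m ∣ j - r + 1)]
  · refine Finset.sum_nbij' (fun r => ⟨r % m, r / m⟩) (fun p => p.1 + p.2 * m) ?_ ?_ ?_ ?_ ?_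
    · intro r hr
      simp only [Finset.mem_filter, Finset.mem_range] at hr
      have h4 := Nat.div_add_mod r m
      have h5 := Nat.mod_le r m
      have h6 := hmod r hr.2.1
      have h7 : r % m + r / m * m = r := by rw [mul_comm]; omega
      simp only [Finset.mem_sigma, Finset.mem_filter, Finset.mem_range]
      refine ⟨⟨by omega, ?_⟩, ?_⟩
      · rw [modEq_iff_dvd (by omega), ← hdvd (r % m) (r / m) (by omega), h7]
        exact hr.2.2
      · rw [Nat.lt_succ_iff, Nat.le_div_iff_mul_le hm0]; omega
    · rintro ⟨i, e⟩ hp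
      simp only [Finset.mem_sigma, Finset.mem_filter, Finset.mem_range] at hp ⊢
      obtain ⟨⟨hi, hi'⟩, he⟩ := hp
      rw [Nat.lt_succ_iff, Nat.le_div_iff_mul_le hm0] at he
      have hij : i ≤ j := by omega
      rw [modEq_iff_dvd hij] at hi'
      refine ⟨by omega, ?_, ?_⟩
      · intro hd
        have : m ∣ i + 1 := by
          rw [show i + e * m + 1 = i + 1 + e * m by ring] at hd
          exact (Nat.dvd_add_left (dvd_mul_left m e)).1 hd
        have := Nat.le_of_dvd (by omega) this
        omega
      · rwa [hdvd i e (by omega)]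
    · intro r _
      simp only
      rw [mul_comm]; have := Nat.div_add_mod r m; omega
    · rintro ⟨i, e⟩ hp
      simp only [Finset.mem_sigma, Finset.mem_filter, Finset.mem_range] at hp
      have hi : i < m := by omega
      simp only [Nat.add_mul_mod_self_right, Nat.mod_eq_of_lt hi, Nat.add_mul_div_right _ _ hm0,
        Nat.div_eq_of_lt hi, zero_add]
    · intro r _
      simp only
      rw [mul_comm, Nat.mod_add_div]
  · intro r hr hG
    have hr' : r ≤ j := by have := Finset.mem_range.1 hr; omega
    exact ⟨fun h => hG (h1 r hr' h), fun h => hG (h2 r hr' h)⟩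

/-- The leading coefficient contributed by the Taylor coefficients of order `j`. -/
def orderCoef (m L j N : ℕ) (c : ℕ → ℕ → ℂ) : ℂ :=
  ∑ r ∈ Finset.range (j + 1), c r (j - r) * ((r ! : ℂ)⁻¹ * ((j - r)! : ℂ)⁻¹) *
    (angle m L r (j - r) * asymCoef N (expo m r) (expo m (j - r)))

/-- Passing from i to i + em changes the phase by θ₀^{2emL}, and θ₀^{2m} = 1. -/
lemma angle_eq {m : ℕ} (hm : m ≠ 0) (L : ℕ) {i e j : ℕ} (h : i + e * m ≤ j) :
    angle m L (i + e * m) (j - (i + e * m)) =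
      cexp (Real.pi * I / m) ^ ((L : ℤ) * (2 * (i : ℤ) - (j : ℤ))) := by
  have hm' : (m : ℂ) ≠ 0 := Nat.cast_ne_zero.2 hm
  have e1 : cexp (Real.pi * I / m) ^ ((2 * e * m * L : ℕ) : ℤ) = 1 := by
    rw [zpow_natCast, ← Complex.exp_nat_mul, exp_eq_one_iff]
    refine ⟨e * L, ?_⟩
    push_cast; field_simp
  rw [angle, show (L : ℤ) * (((i + e * m : ℕ) : ℤ) - ((j - (i + e * m) : ℕ) : ℤ)) =
    (L : ℤ) * (2 * (i : ℤ) - (j : ℤ)) + ((2 * e * m * L : ℕ) : ℤ) by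
      push_cast [Nat.cast_sub h]; ring, zpow_add₀ (exp_ne_zero _), e1, mul_one]

lemma expo_add_expo {m r j : ℕ} (hr : r ≤ j) :
    expo m r + expo m (j - r) = (2 * ((m : ℝ) - 1) - j) / m := by
  rw [expo, expo, Nat.cast_sub hr]; ring

/-- When r or j - r is ≡ -1 mod m, one of the arguments of 1/Γ is a nonpositive integer and the term
is zero. In a remaining class the phase and the Gamma factor are common, and `betaCore_shift`
together with the factorials gives the weights of `invDist`. -/
lemma orderCoef_eq {m : ℕ} (hm : 2 ≤ m) (L j N : ℕ) (f : ℂ → ℂ) :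
    orderCoef m L j N (fun p q => mixedPartial p q f) =
      (-1) ^ N * ((Real.Gamma ((2 * ((m : ℝ) - 1) - j) / m + N - 1) / (j ! : ℝ) : ℝ) : ℂ) *
      ∑ i ∈ (Finset.range (min j (m - 2) + 1)).filter
        (fun i : ℕ => ¬ ((i : ℤ) ≡ (j : ℤ) - ((m : ℤ) - 1) [ZMOD (m : ℤ)])),
        cexp (Real.pi * I / m) ^ ((L : ℤ) * (2 * (i : ℤ) - (j : ℤ))) *
          betaCore (expo m i) (expo m (j - i)) * invDist m j i f := by
  have hm0 : m ≠ 0 := by omega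
  have hm' : (m : ℝ) ≠ 0 := Nat.cast_ne_zero.2 hm0
  have hzero : ∀ t : ℕ, m ∣ t + 1 → Real.Gamma (expo m t) = 0 := by
    rintro t ⟨e, he⟩
    obtain ⟨e', rfl⟩ := Nat.exists_eq_succ_of_ne_zero (n := e) (by rintro rfl; omega)
    exact Gamma_expo_eq_zero hm0 he
  rw [orderCoef, sum_residue hm]
  · rw [Finset.mul_sum]
    refine Finset.sum_congr rfl fun i hi => ?_
    simp only [Finset.mem_filter, Finset.mem_range] at hi
    have hij : i ≤ j := by omega
    have hnd : ¬ m ∣ j - i + 1 := by rw [← modEq_iff_dvd hij]; exact hi.2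
    rw [invDist, Finset.mul_sum, Finset.mul_sum]
    refine Finset.sum_congr rfl fun e he => ?_
    rw [Finset.mem_range, Nat.lt_succ_iff, Nat.le_div_iff_mul_le (by omega)] at he
    have hle : i + e * m ≤ j := by omega
    have x1 : expo m (i + e * m) = expo m i - e := by
      rw [expo, expo]; push_cast; field_simp; ring
    have y1 : expo m (j - (i + e * m)) = expo m (j - i) + e := by
      rw [expo, expo, Nat.cast_sub hle, Nat.cast_sub hij]; push_cast; field_simp; ring
    have y2 : -expo m (j - i) = ((j : ℝ) - i - ((m : ℝ) - 1)) / m := by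
      rw [expo, Nat.cast_sub hij]; ring
    have hch : ((j.choose (i + e * m) : ℝ) : ℂ) =
        (j ! : ℂ) * (((i + e * m)! : ℂ)⁻¹ * ((j - (i + e * m))! : ℂ)⁻¹) := by
      rw [Nat.cast_choose ℝ hle]; push_cast; rw [div_eq_mul_inv, mul_inv]
    have hj : (j ! : ℂ) ≠ 0 := Nat.cast_ne_zero.2 (Nat.factorial_ne_zero j)
    rw [angle_eq hm0 L hle, asymCoef_eq, expo_add_expo hle, x1, y1, betaCore_shift _ _ _
      (expo_add_nat_ne_zero hm0 hnd), y2, show j - i - e * m = j - (i + e * m) by omega]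
    have x2 : expo m i - 1 = ((m : ℝ) - 1 - i) / m - 1 := rfl
    have hch2 : ∀ g g' : ℝ, ((j.choose (i + e * m) * g / g' : ℝ) : ℂ) =
        (j ! : ℂ) * (((i + e * m)! : ℂ)⁻¹ * ((j - (i + e * m))! : ℂ)⁻¹) * ((g / g' : ℝ) : ℂ) :=
      fun g g' => by rw [mul_div_assoc, ofReal_mul, hch]
    rw [x2, hch2]
    push_cast
    field_simp
  · intro r _ h
    rw [asymCoef_eq, betaCore, hzero r h]; simp
  · intro r _ h
    rw [asymCoef_eq, betaCore, hzero _ h]; simp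

lemma orderCoef_eq_zero {m : ℕ} (hm : 2 ≤ m) (L j N : ℕ) (f : ℂ → ℂ)
    (h : ∀ i : ℕ, i ≤ min j (m - 2) →
        ¬ ((i : ℤ) ≡ (j : ℤ) - ((m : ℤ) - 1) [ZMOD (m : ℤ)]) → invDist m j i f = 0) :
    orderCoef m L j N (fun p q => mixedPartial p q f) = 0 := by
  rw [orderCoef_eq hm, Finset.sum_eq_zero, mul_zero]
  intro i hi
  simp only [Finset.mem_filter, Finset.mem_range] at hi
  rw [h i (by omega) hi.2, mul_zero]

/-- For b > 0 this is b(b-1)⋯(b-n) Γ(b-n) = Γ(b+1). At b = 0 a zero of the binomial meets a pole of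
Γ, and the two conventions are matched so that the product keeps its limit Γ(1). -/
lemma cbinom_mul_gammaExt {b : ℝ} (hb : 0 ≤ b) (hb1 : b < 1) (n : ℕ) :
    ((n + 1)! : ℝ) * cbinom b (n + 1) * gammaExt (b - n) = Real.Gamma (b + 1) := by
  have hf : ((n + 1)! : ℝ) ≠ 0 := Nat.cast_ne_zero.2 (Nat.factorial_ne_zero _)
  rcases hb.eq_or_lt with rfl | hb
  · have hx : ∃ N : ℕ, (0 : ℝ) - n = -(N : ℝ) := ⟨n, by ring⟩
    rw [cbinom, if_pos rfl, gammaExt, if_pos hx]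
    have hfl : ⌊-((0 : ℝ) - n)⌋₊ = n := by simp
    have key : ∀ n : ℕ, (n ! : ℝ) * (-1) ^ n * ∏ i ∈ Finset.range n, (-((i : ℝ) + 1))⁻¹ = 1 := by
      intro n
      induction n with
      | zero => simp
      | succ n ih =>
        have h1 : ((n : ℝ) + 1) * (-((n : ℝ) + 1))⁻¹ = -1 := by
          have : (n : ℝ) + 1 ≠ 0 := by positivity
          rw [inv_neg, mul_neg, mul_inv_cancel₀ this]
        rw [Finset.prod_range_succ, Nat.factorial_succ, pow_succ]
        push_cast
        linear_combination ih - (n ! : ℝ) * (-1) ^ n *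
          (∏ i ∈ Finset.range n, (-((i : ℝ) + 1))⁻¹) * h1
    have h1 : (n : ℝ) + 1 ≠ 0 := by positivity
    rw [hfl, zero_add, Real.Gamma_one, Nat.factorial_succ, Nat.add_sub_cancel]
    refine Eq.trans ?_ (key n)
    push_cast
    field_simp
  · have hx : ¬ ∃ N : ℕ, b - n = -(N : ℝ) := by
      rintro ⟨N, hN⟩
      have h1 : (N : ℝ) < n := by linarith
      have h2 : (n : ℝ) < N + 1 := by linarith
      have h1' : N < n := by exact_mod_cast h1
      have h2' : n < N + 1 := by exact_mod_cast h2
      omega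
    rw [cbinom, if_neg hb.ne', gammaExt, if_neg hx, gbinom, mul_div_cancel₀ _ hf]
    have hn : ∀ i : ℕ, b - i ≠ 0 ∨ i = 0 := by
      intro i
      rcases i with _ | i
      · right; rfl
      · left
        push_cast
        have : (0 : ℝ) ≤ i := by positivity
        linarith
    have key : ∀ n : ℕ, (∏ i ∈ Finset.range (n + 1), (b - (i : ℝ))) * Real.Gamma (b - n) =
        Real.Gamma (b + 1) := by
      intro n
      induction n with
      | zero => simp [Real.Gamma_add_one hb.ne']
      | succ n ih =>
        have hne : b - ((n + 1 : ℕ) : ℝ) ≠ 0 := (hn (n + 1)).resolve_right (by omega)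
        rw [Finset.prod_range_succ, mul_assoc, ← Real.Gamma_add_one hne, ← ih]
        congr 2; push_cast; ring
    exact key n

/-- Here x + y - 1 = b - n. Since i ≤ m - 2 gives x > 0 and the divisibility condition keeps y off
the nonpositive integers, the zero branch of `betaLike` does not occur. -/
lemma betaLike_eq {m k i : ℕ} (hm : 2 ≤ m) (hi : i ≤ m - 2) (hik : i ≤ k) (h : ¬ m ∣ k - i + 1) :
    betaLike (((m : ℝ) - 1 - i) / m) (((m : ℝ) - 1 - ((k : ℝ) - i)) / m) =
      (gammaExt (bIdx m k - nIdx m k) : ℂ) * betaCore (expo m i) (expo m (k - i)) := by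
  have hm0 : m ≠ 0 := by omega
  have hm' : (0 : ℝ) < m := by positivity
  have hx : 0 < expo m i := by
    refine div_pos ?_ hm'
    have h1 : i + 2 ≤ m := by omega
    have : (i : ℝ) + 2 ≤ m := by exact_mod_cast h1
    linarith
  have ex : ((m : ℝ) - 1 - i) / m = expo m i := rfl
  have ey : ((m : ℝ) - 1 - ((k : ℝ) - i)) / m = expo m (k - i) := by
    rw [expo, Nat.cast_sub hik]
  have hneg : ¬ ((∃ N : ℕ, expo m i = -(N : ℝ)) ∨ ∃ N : ℕ, expo m (k - i) = -(N : ℝ)) := by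
    rintro (⟨N, hN⟩ | ⟨N, hN⟩)
    · have : (0 : ℝ) ≤ N := by positivity
      linarith
    · exact expo_add_nat_ne_zero hm0 h N (by rw [hN]; ring)
  have hs : expo m i + expo m (k - i) - 1 = bIdx m k - nIdx m k := by
    rw [expo_add_expo hik, bIdx]; field_simp; ring
  rw [ex, ey, betaLike, if_neg hneg, hs, betaCore]
  have h2 : (2 : ℝ) ^ (2 - expo m i - expo m (k - i)) =
      (2 ^ (expo m i + expo m (k - i) - 2))⁻¹ := by
    rw [← Real.rpow_neg two_pos.le]; congr 1; ring
  rw [h2]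
  push_cast
  ring

lemma orderCoef_top {m : ℕ} (hm : 2 ≤ m) (L k : ℕ) (f : ℂ → ℂ) :
    orderCoef m L k (nIdx m k + 1) (fun p q => mixedPartial p q f) =
      (-1) ^ (nIdx m k + 1) * (((((nIdx m k + 1)! : ℝ) / (k ! : ℝ)) *
        cbinom (bIdx m k) (nIdx m k + 1) : ℝ) : ℂ) * angDist m k L f := by
  have hm' : (m : ℝ) ≠ 0 := by positivity
  have hG : (2 * ((m : ℝ) - 1) - k) / m + ((nIdx m k + 1 : ℕ) : ℝ) - 1 = bIdx m k + 1 := by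
    rw [bIdx]; push_cast; field_simp; ring
  rw [orderCoef_eq hm, hG, ← cbinom_mul_gammaExt (bIdx_nonneg m k) (bIdx_lt_one hm k) (nIdx m k),
    angDist, Finset.mul_sum, Finset.mul_sum]
  refine Finset.sum_congr rfl fun i hi => ?_
  simp only [Finset.mem_filter, Finset.mem_range] at hi
  have hik : i ≤ k := by omega
  have hnd : ¬ m ∣ k - i + 1 := by rw [← modEq_iff_dvd hik]; exact hi.2
  rw [betaLike_eq hm (by omega) hik hnd]
  push_cast
  ring

/-! ### From a bound on the top derivative to the norm of C^{n+P_b}. -/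

lemma LocIcc.uniqueDiffOn {S : Set ℝ} (hS : LocIcc S) : UniqueDiffOn ℝ S := by
  intro s hs
  obtain ⟨a, b, hab, h1, h2, -⟩ := hS s hs
  exact ((uniqueDiffOn_Icc hab) s h1).mono h2

lemma iteratedDerivWithin_eq_of_tower {S : Set ℝ} (hS : UniqueDiffOn ℝ S) {N : ℕ}
    {Φ : ℕ → ℝ → ℂ} {f : ℝ → ℂ} (hf : EqOn f (Φ 0) S)
    (h : ∀ i < N, ∀ s ∈ S, HasDerivWithinAt (Φ i) (Φ (i + 1) s) S s) :
    ∀ i ≤ N, EqOn (iteratedDerivWithin i f S) (Φ i) S := by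
  intro i
  induction i with
  | zero => intro _; rwa [iteratedDerivWithin_zero]
  | succ i ih =>
    intro hi s hs
    rw [iteratedDerivWithin_succ, derivWithin_congr (ih (by omega)) (ih (by omega) hs)]
    exact (h i hi s hs).derivWithin (hS s hs)

lemma contDiffOn_of_tower {S : Set ℝ} (hS : UniqueDiffOn ℝ S) {N : ℕ}
    {Φ : ℕ → ℝ → ℂ} {f : ℝ → ℂ} (hf : EqOn f (Φ 0) S)
    (h : ∀ i < N, ∀ s ∈ S, HasDerivWithinAt (Φ i) (Φ (i + 1) s) S s)
    (hc : ContinuousOn (Φ N) S) : ContDiffOn ℝ ((N : ℕ) : ℕ∞) f S := by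
  have key := iteratedDerivWithin_eq_of_tower hS hf h
  refine contDiffOn_of_continuousOn_differentiableOn_deriv (fun i hi => ?_) fun i hi => ?_
  · have hi' : i ≤ N := by exact_mod_cast hi
    refine ContinuousOn.congr ?_ (key i hi')
    rcases hi'.eq_or_lt with rfl | hlt
    · exact hc
    · exact fun s hs => (h i hlt s hs).continuousWithinAt
  · have hi' : i < N := by exact_mod_cast hi
    exact DifferentiableOn.congr (fun s hs => (h i hi' s hs).differentiableWithinAt) (key i hi'.le)

lemma norm_le_of_norm_deriv_le_right {f f' : ℝ → ℂ} {c M M₁ : ℝ} (hc : 0 < c)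
    (hf : ∀ s ∈ Ioc (0 : ℝ) 1, HasDerivWithinAt f (f' s) (Ioc 0 1) s)
    (hf' : ContinuousOn f' (Ioc 0 1)) (hM : ∀ s ∈ Ioc (0 : ℝ) 1, ‖f' s‖ ≤ M * s ^ (-(1 + c)))
    (h1 : ‖f 1‖ ≤ M₁) {s : ℝ} (hs : s ∈ Ioc (0 : ℝ) 1) (hM0 : 0 ≤ M) :
    ‖f s‖ ≤ M₁ + M / c * s ^ (-c) := by
  have hsub : Icc s 1 ⊆ Ioc 0 1 := fun t ht => ⟨hs.1.trans_le ht.1, ht.2⟩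
  have h0 : (0 : ℝ) ∉ uIcc s 1 := by
    rw [uIcc_of_le hs.2]; exact fun h => absurd h.1 (not_le.2 hs.1)
  have key := intervalIntegral.integral_eq_sub_of_hasDerivAt_of_le hs.2
    (fun t ht => (hf t (hsub ht)).continuousWithinAt.mono hsub)
    (fun t ht => (hf t (hsub ⟨ht.1.le, ht.2.le⟩)).hasDerivAt
      (Ioc_mem_nhds (hs.1.trans ht.1) ht.2))
    ((hf'.mono (by rw [uIcc_of_le hs.2]; exact hsub)).intervalIntegrable)
  have h2 := intervalIntegral.norm_integral_le_of_norm_le hs.2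
    (ae_of_all volume fun t ht => hM t ⟨hs.1.trans ht.1, ht.2⟩)
    ((intervalIntegral.intervalIntegrable_rpow (Or.inr h0)).const_mul M)
  rw [key, intervalIntegral.integral_const_mul,
    integral_rpow (Or.inr ⟨by linarith, h0⟩), Real.one_rpow,
    show -(1 + c) + 1 = -c by ring] at h2
  have h3 : f s = f 1 - (f 1 - f s) := by ring
  have h4 : M * ((1 - s ^ (-c)) / -c) = M / c * s ^ (-c) - M / c := by field_simp; ring
  rw [h3]
  refine (norm_sub_le _ _).trans ?_
  have : 0 ≤ M / c := by positivity
  linarith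

lemma norm_le_of_norm_deriv_le {f f' : ℝ → ℂ} {c M : ℝ} (hc : 0 < c) (hM0 : 0 ≤ M)
    (hf : ∀ s ∈ punctured, HasDerivWithinAt f (f' s) punctured s)
    (hf' : ContinuousOn f' punctured) (hM : ∀ s ∈ punctured, ‖f' s‖ ≤ M * |s| ^ (-(1 + c)))
    {M₁ : ℝ} (h1 : ∀ s ∈ punctured, |s| = 1 → ‖f s‖ ≤ M₁) {s : ℝ} (hs : s ∈ punctured) :
    ‖f s‖ ≤ M₁ + M / c * |s| ^ (-c) := by
  have hr : Ioc (0 : ℝ) 1 ⊆ punctured := subset_union_right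
  have hl : ∀ t ∈ Ioc (0 : ℝ) 1, -t ∈ punctured := fun t ht =>
    Or.inl ⟨by linarith [ht.2], by linarith [ht.1]⟩
  rcases hs with hs | hs
  · have hs' : -s ∈ Ioc (0 : ℝ) 1 := ⟨by linarith [hs.2], by linarith [hs.1]⟩
    rw [abs_of_neg hs.2]
    have := norm_le_of_norm_deriv_le_right (f := fun t => f (-t)) (f' := fun t => -f' (-t))
      (M := M) (M₁ := M₁) hc (fun t ht => ?_) ?_ (fun t ht => ?_) ?_ hs' hM0
    · simpa using this
    · have h := (hf (-t) (hl t ht)).scomp t ((hasDerivAt_neg t).hasDerivWithinAt (s := Ioc 0 1)) hl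
      exact h.congr_deriv (by simp)
    · exact (hf'.comp continuous_neg.continuousOn hl).neg
    · rw [norm_neg]
      have := hM (-t) (hl t ht)
      rwa [abs_neg, abs_of_pos ht.1] at this
    · exact h1 _ (hl 1 ⟨one_pos, le_rfl⟩) (by simp)
  · rw [abs_of_pos hs.1]
    refine norm_le_of_norm_deriv_le_right hc (fun t ht => (hf t (hr ht)).mono hr) (hf'.mono hr)
      (fun t ht => ?_) (h1 1 (hr ⟨one_pos, le_rfl⟩) (by simp)) hs hM0
    have := hM t (hr ht)
    rwa [abs_of_pos ht.1] at this

lemma abs_pos_of_mem_punctured {s : ℝ} (hs : s ∈ punctured) : 0 < |s| :=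
  abs_pos.2 (ne_zero_of_mem_punctured hs)

lemma abs_le_one_of_mem_punctured {s : ℝ} (hs : s ∈ punctured) : |s| ≤ 1 := by
  rw [abs_le]
  rcases hs with h | h
  · exact ⟨h.1, by linarith [h.2]⟩
  · exact ⟨by linarith [h.1], h.2⟩

/-- Integrating |s|^{-(1+c)} inwards from |s| = 1 gives |s|^{-c}, which is weakened to |s|^{-(1+c)}
before the next step. Keeping the same exponent at all orders is enough, as only integrability is
wanted. -/
lemma norm_tower_le {n : ℕ} {c M : ℝ} (hc : 0 < c) (hM0 : 0 ≤ M) {Φ : ℕ → ℝ → ℂ}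
    (h : ∀ i < n + 1, ∀ s ∈ punctured, HasDerivWithinAt (Φ i) (Φ (i + 1) s) punctured s)
    (hcont : ContinuousOn (Φ (n + 1)) punctured)
    (htop : ∀ s ∈ punctured, ‖Φ (n + 1) s‖ ≤ M * |s| ^ (-(1 + c)))
    (hside : ∀ i ≤ n, ∀ s ∈ punctured, |s| = 1 → ‖Φ i s‖ ≤ M) (j : ℕ) (hj : j ≤ n) :
    ∀ s ∈ punctured, ‖Φ (n - j) s‖ ≤ (1 + 1 / c) ^ (j + 1) * M * |s| ^ (-c) := by
  have hone : ∀ s ∈ punctured, 1 ≤ |s| ^ (-c) := fun s hs =>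
    Real.one_le_rpow_of_pos_of_le_one_of_nonpos (abs_pos_of_mem_punctured hs)
      (abs_le_one_of_mem_punctured hs) (by linarith)
  induction j with
  | zero =>
    intro s hs
    refine (norm_le_of_norm_deriv_le hc hM0 (h n (by omega)) hcont htop (hside n le_rfl)
      hs).trans ?_
    have := mul_le_mul_of_nonneg_left (hone s hs) hM0
    calc _ ≤ M * |s| ^ (-c) + M / c * |s| ^ (-c) := by linarith
      _ = _ := by ring
  | succ j ih =>
    intro s hs
    have e : n - (j + 1) + 1 = n - j := by omega
    have hd := h (n - (j + 1)) (by omega)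
    rw [e] at hd
    have hp : 1 ≤ (1 + 1 / c) ^ (j + 1) := one_le_pow₀ (by have : 0 < 1 / c := by positivity
                                                           linarith)
    refine (norm_le_of_norm_deriv_le (M := (1 + 1 / c) ^ (j + 1) * M) hc (by positivity) hd
      (fun t ht => (h (n - j) (by omega) t ht).continuousWithinAt) (fun t ht => ?_)
      (hside _ (by omega)) hs).trans ?_
    · refine (ih (by omega) t ht).trans ?_
      exact mul_le_mul_of_nonneg_left (Real.rpow_le_rpow_of_exponent_ge
        (abs_pos_of_mem_punctured ht) (abs_le_one_of_mem_punctured ht) (by linarith))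
        (by positivity)
    · have h1 : M ≤ (1 + 1 / c) ^ (j + 1) * M * |s| ^ (-c) := by
        calc M = 1 * M * 1 := by ring
          _ ≤ _ := by gcongr; exact hone s hs
      calc _ ≤ (1 + 1 / c) ^ (j + 1) * M * |s| ^ (-c) +
            (1 + 1 / c) ^ (j + 1) * M / c * |s| ^ (-c) := by linarith
        _ = _ := by rw [pow_succ _ (j + 1)]; ring

lemma lintegral_abs_rpow_lt_top {c : ℝ} (hc : c < 1) :
    ∫⁻ s in punctured, ENNReal.ofReal (|s| ^ (-c)) < ⊤ := by
  have h1 : IntegrableOn (fun s : ℝ => |s| ^ (-c)) (Ioc 0 1) := by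
    refine IntegrableOn.congr_fun ((intervalIntegrable_iff_integrableOn_Ioc_of_le
      zero_le_one).1 (intervalIntegral.intervalIntegrable_rpow' (r := -c) (by linarith)))
      (fun s hs => ?_) measurableSet_Ioc
    rw [abs_of_pos hs.1]
  have h2 : IntegrableOn (fun s : ℝ => |s| ^ (-c)) (Ico (-1) 0) := by
    have := (Measure.measurePreserving_neg (volume : Measure ℝ)).integrableOn_comp_preimage
      (Homeomorph.neg ℝ).measurableEmbedding (f := fun s : ℝ => |s| ^ (-c)) (s := Ioc 0 1)
    have := this.2 h1
    simpa [Function.comp_def] using this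
  have h3 : IntegrableOn (fun s : ℝ => |s| ^ (-c)) punctured := h2.union h1
  have h4 := h3.hasFiniteIntegral
  rw [hasFiniteIntegral_iff_ofReal (ae_of_all _ fun s => by positivity)] at h4
  exact h4

lemma pSemi_le {n : ℕ} {b M : ℝ} {g Φ : ℝ → ℂ}
    (hg : EqOn (iteratedDerivWithin (n + 1) g punctured) Φ punctured)
    (htop : ∀ s ∈ punctured, ‖Φ s‖ ≤ M * |s| ^ (-(1 + b))) :
    pSemi n b g ≤ ENNReal.ofReal M := by
  refine iSup₂_le fun s hs => ?_
  have hs' := abs_pos_of_mem_punctured hs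
  rw [hg hs, ← ofReal_norm, ← ENNReal.ofReal_mul (by positivity)]
  refine ENNReal.ofReal_le_ofReal ?_
  calc |s| ^ (1 + b) * ‖Φ s‖ ≤ |s| ^ (1 + b) * (M * |s| ^ (-(1 + b))) := by
        gcongr; exact htop s hs
    _ = M * (|s| ^ (1 + b) * |s| ^ (-(1 + b))) := by ring
    _ = M := by rw [← Real.rpow_add hs', add_neg_cancel, Real.rpow_zero, mul_one]

lemma exists_pNorm_le (n : ℕ) {b : ℝ} (hb : 0 ≤ b) (hb1 : b < 1) : ∃ C : ℝ, 0 < C ∧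
    ∀ (Φ : ℕ → ℝ → ℂ) (g : ℝ → ℂ) (M : ℝ), 0 ≤ M → EqOn g (Φ 0) punctured →
    (∀ i < n + 1, ∀ s ∈ punctured, HasDerivWithinAt (Φ i) (Φ (i + 1) s) punctured s) →
    ContinuousOn (Φ (n + 1)) punctured →
    (∀ s ∈ punctured, ‖Φ (n + 1) s‖ ≤ M * |s| ^ (-(1 + b))) →
    (∀ i ≤ n, ∀ s ∈ punctured, |s| = 1 → ‖Φ i s‖ ≤ M) →
    pNorm n b g ≤ ENNReal.ofReal (C * M) := by
  -- Any c in (0, 1) with c ≥ b would do: c < 1 makes |s|^{-c} integrable, and c > 0 avoids the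
  -- logarithm that b = 0 would produce.
  set c : ℝ := (1 + b) / 2 with hc
  have hc0 : 0 < c := by rw [hc]; linarith
  have hc1 : c < 1 := by rw [hc]; linarith
  set K : ℝ := (∫⁻ s in punctured, ENNReal.ofReal (|s| ^ (-c))).toReal with hK
  have hKe : ∫⁻ s in punctured, ENNReal.ofReal (|s| ^ (-c)) = ENNReal.ofReal K :=
    (ENNReal.ofReal_toReal (lintegral_abs_rpow_lt_top hc1).ne).symm
  have hK0 : 0 ≤ K := ENNReal.toReal_nonneg
  set D : ℝ := (1 + 1 / c) ^ (n + 1) with hD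
  have hD0 : 0 < D := by positivity
  refine ⟨(n + 1 : ℕ) * (D * K) + 1, by positivity, fun Φ g M hM hg h hcont htop hside => ?_⟩
  have hS := locIcc_punctured.uniqueDiffOn
  have hder := iteratedDerivWithin_eq_of_tower hS hg h
  have htop' : ∀ s ∈ punctured, ‖Φ (n + 1) s‖ ≤ M * |s| ^ (-(1 + c)) := by
    intro s hs
    refine (htop s hs).trans ?_
    exact mul_le_mul_of_nonneg_left (Real.rpow_le_rpow_of_exponent_ge
      (abs_pos_of_mem_punctured hs) (abs_le_one_of_mem_punctured hs) (by linarith)) hM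
  have hL : ∀ i ∈ Finset.range (n + 1), ∫⁻ s in punctured,
      ‖iteratedDerivWithin i g punctured s‖ₑ ≤ ENNReal.ofReal (D * K * M) := by
    intro i hi
    have hi' : i ≤ n := by have := Finset.mem_range.1 hi; omega
    calc ∫⁻ s in punctured, ‖iteratedDerivWithin i g punctured s‖ₑ
        ≤ ∫⁻ s in punctured, ENNReal.ofReal (D * M) * ENNReal.ofReal (|s| ^ (-c)) := by
          refine setLIntegral_mono' (measurableSet_Ico.union measurableSet_Ioc) fun s hs => ?_
          rw [hder i (by omega) hs, ← ofReal_norm, ← ENNReal.ofReal_mul (by positivity)]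
          refine ENNReal.ofReal_le_ofReal ?_
          have := norm_tower_le hc0 hM h hcont htop' hside (n - i) (by omega) s hs
          rw [show n - (n - i) = i by omega] at this
          refine this.trans ?_
          gcongr
          exact pow_le_pow_right₀ (by have : 0 < 1 / c := by positivity
                                      linarith) (by omega)
      _ = ENNReal.ofReal (D * K * M) := by
          rw [lintegral_const_mul' _ _ ENNReal.ofReal_ne_top, hKe,
            ← ENNReal.ofReal_mul (by positivity)]
          congr 1; ring
  rw [pNorm]
  calc _ ≤ ∑ _i ∈ Finset.range (n + 1), ENNReal.ofReal (D * K * M) + ENNReal.ofReal M :=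
        add_le_add (Finset.sum_le_sum hL) (pSemi_le (hder (n + 1) le_rfl) htop)
    _ = _ := by
        rw [Finset.sum_const, Finset.card_range, nsmul_eq_mul, ← ENNReal.ofReal_natCast,
          ← ENNReal.ofReal_mul (by positivity), ← ENNReal.ofReal_add (by positivity) hM]
        congr 1; ring

/-! ### Asymptotics of the whole Taylor polynomial. -/

lemma sum_cutoff (k : ℕ) (c : ℕ → ℕ → ℂ) (X : ℕ → ℕ → ℂ) :
    ∑ r ∈ Finset.range (k + 1), ∑ t ∈ Finset.range (k + 1), cutoff k c r t * X r t =
      ∑ j ∈ Finset.range (k + 1), ∑ r ∈ Finset.range (j + 1), c r (j - r) * X r (j - r) := by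
  rw [Finset.sum_sigma', Finset.sum_sigma',
    ← Finset.sum_filter_of_ne (p := fun p : Σ _ : ℕ, ℕ => p.1 + p.2 ≤ k)]
  · refine Finset.sum_nbij' (fun p => ⟨p.1 + p.2, p.1⟩) (fun p => ⟨p.2, p.1 - p.2⟩) ?_ ?_ ?_ ?_ ?_
    · rintro ⟨r, t⟩ h
      simp only [Finset.mem_filter, Finset.mem_sigma, Finset.mem_range] at h ⊢
      omega
    · rintro ⟨j, r⟩ h
      simp only [Finset.mem_filter, Finset.mem_sigma, Finset.mem_range] at h ⊢
      omega
    · rintro ⟨r, t⟩ _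
      simp
    · rintro ⟨j, r⟩ h
      simp only [Finset.mem_sigma, Finset.mem_range] at h
      simp only [Sigma.mk.injEq, heq_eq_eq, and_true]
      omega
    · rintro ⟨r, t⟩ h
      simp only [Finset.mem_filter] at h
      simp [cutoff, h.2]
  · rintro ⟨r, t⟩ _ h
    by_contra hlt
    exact h (by simp only [cutoff]; rw [if_neg hlt, zero_mul])

/-- The index of the half-plane containing `s`, counted through all branches. -/
def sheet (l : ℕ) (s : ℝ) : ℕ := if 0 < s then 2 * l else 2 * l + 1

/-- The sign picked up by an `i`-th derivative under reflection to the upper half plane. -/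
def sheetSign (i : ℕ) (s : ℝ) : ℂ := if 0 < s then 1 else (-1) ^ i

lemma norm_sheetSign (i : ℕ) (s : ℝ) : ‖sheetSign i s‖ = 1 := by
  rw [sheetSign]; split_ifs <;> simp

lemma monoInt_eq {m l r t i : ℕ} {s : ℝ} (hs : s ≠ 0) : monoInt m l r t i s =
    sheetSign i s * angle m (sheet l s) r t * segDeriv i (expo m r) (expo m t) |s| := by
  rw [monoInt, sheetSign, sheet]
  split_ifs with h
  · rw [abs_of_pos h, one_mul]
  · rw [abs_of_neg (lt_of_le_of_ne (not_lt.1 h) hs)]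

lemma abs_mem_of_mem_punctured {s : ℝ} (hs : s ∈ punctured) : |s| ∈ Ioc (0 : ℝ) 1 :=
  ⟨abs_pos_of_mem_punctured hs, abs_le_one_of_mem_punctured hs⟩

lemma exists_norm_polyInt_side_le (m k i : ℕ) : ∃ C : ℝ, 0 ≤ C ∧ ∀ (l : ℕ) (c : ℕ → ℕ → ℂ) (A : ℝ),
    0 ≤ A → (∀ p q, p + q ≤ k → ‖c p q‖ ≤ A) → ∀ s ∈ punctured, |s| = 1 →
    ‖polyInt m l k c i s‖ ≤ C * A := by
  refine ⟨∑ r ∈ Finset.range (k + 1), ∑ t ∈ Finset.range (k + 1),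
    ‖(r ! : ℂ)⁻¹‖ * ‖(t ! : ℂ)⁻¹‖ * ‖segDeriv i (expo m r) (expo m t) 1‖,
    Finset.sum_nonneg fun r _ => Finset.sum_nonneg fun t _ => by positivity,
    fun l c A hA hc s hs hs1 => ?_⟩
  rw [polyInt, Finset.sum_mul]
  refine norm_sum_le_of_le _ fun r _ => ?_
  rw [Finset.sum_mul]
  refine norm_sum_le_of_le _ fun t _ => ?_
  have hcut : ‖cutoff k c r t‖ ≤ A := by
    rw [cutoff]; split_ifs with h
    · exact hc _ _ h
    · simpa using hA
  rw [monoInt_eq (ne_zero_of_mem_punctured hs), hs1]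
  simp only [norm_mul, norm_sheetSign, norm_angle, one_mul]
  calc _ ≤ A * (‖(r ! : ℂ)⁻¹‖ * ‖(t ! : ℂ)⁻¹‖) * ‖segDeriv i (expo m r) (expo m t) 1‖ := by gcongr
    _ = _ := by ring

/-- At r + t = k the left-over sum is exactly b + 2, and smaller orders only increase it; so n + 1
derivatives suffice for `segDeriv_asymp` at all orders up to k. -/
lemma one_lt_expo_sum {m : ℕ} (hm : 2 ≤ m) {k r t : ℕ} (h : r + t ≤ k) :
    1 < expo m r + expo m t + ((nIdx m k + 1 : ℕ) : ℝ) := by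
  have hm' : (0 : ℝ) < m := by positivity
  have h1 : expo m r + expo m t = (2 * ((m : ℝ) - 1) - (r + t)) / m := by rw [expo, expo]; ring
  have h2 : (2 * ((m : ℝ) - 1) - k) / m + ((nIdx m k + 1 : ℕ) : ℝ) = bIdx m k + 2 := by
    rw [bIdx]; push_cast; field_simp; ring
  have h3 : (2 * ((m : ℝ) - 1) - k) / m ≤ (2 * ((m : ℝ) - 1) - (r + t)) / m := by
    have : (r : ℝ) + t ≤ k := by exact_mod_cast h
    gcongr
  linarith [bIdx_nonneg m k]

/-- Order j carries |s| to the power 1 - (2(m-1)-j)/m - (n+1). For j < k this is more singular than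
|s|^{-(1+b)} but has coefficient zero, and j = k gives the exponent -(1+b) itself. -/
lemma exists_polyInt_asymp {m : ℕ} (hm : 2 ≤ m) (k : ℕ) : ∃ B : ℝ, 0 ≤ B ∧
    ∀ (l : ℕ) (c : ℕ → ℕ → ℂ) (A : ℝ), 0 ≤ A → (∀ p q, p + q ≤ k → ‖c p q‖ ≤ A) →
    (∀ L j, j < k → orderCoef m L j (nIdx m k + 1) c = 0) → ∀ s ∈ punctured,
    ‖polyInt m l k c (nIdx m k + 1) s - ((|s| ^ (-(1 + bIdx m k)) : ℝ) : ℂ) *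
      (sheetSign (nIdx m k + 1) s * orderCoef m (sheet l s) k (nIdx m k + 1) c)‖ ≤ B * A := by
  have hm' : (m : ℝ) ≠ 0 := by positivity
  set N := nIdx m k + 1 with hN
  have hseg : ∀ r t : ℕ, ∃ B : ℝ, r + t ≤ k → ∀ s ∈ Ioc (0 : ℝ) 1,
      ‖segDeriv N (expo m r) (expo m t) s - ((s ^ (1 - expo m r - expo m t - N) : ℝ) : ℂ) *
        asymCoef N (expo m r) (expo m t)‖ ≤ B := by
    intro r t
    by_cases h : r + t ≤ k
    · obtain ⟨B, hB⟩ := segDeriv_asymp N (one_lt_expo_sum hm h)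
      exact ⟨B, fun _ => hB⟩
    · exact ⟨0, fun h' => absurd h' h⟩
  choose B hB using hseg
  refine ⟨∑ r ∈ Finset.range (k + 1), ∑ t ∈ Finset.range (k + 1),
    ‖(r ! : ℂ)⁻¹‖ * ‖(t ! : ℂ)⁻¹‖ * |B r t|,
    Finset.sum_nonneg fun r _ => Finset.sum_nonneg fun t _ => by positivity,
    fun l c A hA hc hzero s hs => ?_⟩
  have key : ∑ r ∈ Finset.range (k + 1), ∑ t ∈ Finset.range (k + 1), cutoff k c r t *
      ((r ! : ℂ)⁻¹ * (t ! : ℂ)⁻¹ * (sheetSign N s * angle m (sheet l s) r t *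
        (((|s| ^ (1 - expo m r - expo m t - N) : ℝ) : ℂ) * asymCoef N (expo m r) (expo m t)))) =
      ((|s| ^ (-(1 + bIdx m k)) : ℝ) : ℂ) * (sheetSign N s * orderCoef m (sheet l s) k N c) := by
    have horder : ∀ j, ∑ r ∈ Finset.range (j + 1), c r (j - r) *
        ((r ! : ℂ)⁻¹ * ((j - r)! : ℂ)⁻¹ * (sheetSign N s * angle m (sheet l s) r (j - r) *
        (((|s| ^ (1 - expo m r - expo m (j - r) - N) : ℝ) : ℂ) *
          asymCoef N (expo m r) (expo m (j - r))))) =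
        ((|s| ^ (1 - (2 * ((m : ℝ) - 1) - j) / m - N) : ℝ) : ℂ) *
          (sheetSign N s * orderCoef m (sheet l s) j N c) := by
      intro j
      rw [orderCoef, Finset.mul_sum, Finset.mul_sum]
      refine Finset.sum_congr rfl fun r hr => ?_
      rw [← expo_add_expo (Nat.lt_succ_iff.1 (Finset.mem_range.1 hr)), ← sub_sub]
      ring
    rw [sum_cutoff, Finset.sum_congr rfl fun j _ => horder j, Finset.sum_range_succ,
      Finset.sum_eq_zero, zero_add]
    · congr 4
      rw [hN, bIdx]; push_cast; field_simp; ring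
    · intro j hj
      rw [hzero _ _ (Finset.mem_range.1 hj), mul_zero, mul_zero]
  rw [← key, polyInt, ← Finset.sum_sub_distrib, Finset.sum_mul]
  refine norm_sum_le_of_le _ fun r _ => ?_
  rw [← Finset.sum_sub_distrib, Finset.sum_mul]
  refine norm_sum_le_of_le _ fun t _ => ?_
  rw [cutoff]
  split_ifs with h
  · rw [monoInt_eq (ne_zero_of_mem_punctured hs),
      show ∀ a b d e f g : ℂ, a * b * (d * e * f) - a * (b * (d * e * g)) =
        a * b * (d * e) * (f - g) by intros; ring]
    simp only [norm_mul _ (_ - _), norm_mul _ (_ * _), norm_mul _ (_⁻¹), norm_mul _ (angle _ _ _ _),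
      norm_sheetSign, norm_angle, mul_one]
    calc _ ≤ A * (‖(r ! : ℂ)⁻¹‖ * ‖(t ! : ℂ)⁻¹‖) * |B r t| := by
          gcongr
          · exact hc _ _ h
          · exact (hB r t h _ (abs_mem_of_mem_punctured hs)).trans (le_abs_self _)
      _ = _ := by ring
  · simp only [zero_mul, sub_zero, norm_zero]
    positivity

lemma exists_norm_orderCoef_le (m k N : ℕ) : ∃ C : ℝ, 0 ≤ C ∧ ∀ (L : ℕ) (c : ℕ → ℕ → ℂ) (A : ℝ),
    0 ≤ A → (∀ p q, p + q ≤ k → ‖c p q‖ ≤ A) → ‖orderCoef m L k N c‖ ≤ C * A := by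
  refine ⟨∑ r ∈ Finset.range (k + 1), ‖(r ! : ℂ)⁻¹‖ * ‖((k - r)! : ℂ)⁻¹‖ *
    ‖asymCoef N (expo m r) (expo m (k - r))‖,
    Finset.sum_nonneg fun r _ => by positivity, fun L c A hA hc => ?_⟩
  rw [orderCoef, Finset.sum_mul]
  refine norm_sum_le_of_le _ fun r hr => ?_
  have hr' := Finset.mem_range.1 hr
  simp only [norm_mul, norm_angle, one_mul]
  calc _ ≤ A * (‖(r ! : ℂ)⁻¹‖ * ‖((k - r)! : ℂ)⁻¹‖) *
        ‖asymCoef N (expo m r) (expo m (k - r))‖ := by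
        gcongr
        exact hc _ _ (by omega)
    _ = _ := by ring

lemma exists_norm_polyInt_le {m : ℕ} (hm : 2 ≤ m) (k : ℕ) : ∃ C : ℝ, 0 ≤ C ∧
    ∀ (l : ℕ) (c : ℕ → ℕ → ℂ) (A : ℝ), 0 ≤ A → (∀ p q, p + q ≤ k → ‖c p q‖ ≤ A) →
    (∀ L j, j < k → orderCoef m L j (nIdx m k + 1) c = 0) → ∀ s ∈ punctured,
    ‖polyInt m l k c (nIdx m k + 1) s‖ ≤ C * A * |s| ^ (-(1 + bIdx m k)) := by
  obtain ⟨B, hB, H⟩ := exists_polyInt_asymp hm k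
  obtain ⟨C, hC, H'⟩ := exists_norm_orderCoef_le m k (nIdx m k + 1)
  refine ⟨B + C, by positivity, fun l c A hA hc hz s hs => ?_⟩
  have h1 := H l c A hA hc hz s hs
  have h2 := H' (sheet l s) c A hA hc
  have h3 : 1 ≤ |s| ^ (-(1 + bIdx m k)) :=
    Real.one_le_rpow_of_pos_of_le_one_of_nonpos (abs_pos_of_mem_punctured hs)
      (abs_le_one_of_mem_punctured hs) (by linarith [bIdx_nonneg m k])
  refine (norm_le_norm_sub_add _ _).trans (add_le_add h1 le_rfl) |>.trans ?_
  rw [norm_mul, norm_mul, norm_sheetSign, one_mul, norm_real, Real.norm_of_nonneg (by positivity)]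
  calc _ ≤ B * A * |s| ^ (-(1 + bIdx m k)) + |s| ^ (-(1 + bIdx m k)) * (C * A) := by
        exact add_le_add (le_mul_of_one_le_right (by positivity) h3)
          (mul_le_mul_of_nonneg_left h2 (by positivity))
    _ = _ := by ring

lemma tendsto_of_asymp {e B : ℝ} (he : 0 < e) {U : Set ℝ} (hU : U ⊆ punctured) {g : ℝ → ℂ} {Z : ℂ}
    (h : ∀ s ∈ U, ‖g s - ((|s| ^ (-e) : ℝ) : ℂ) * Z‖ ≤ B) :
    Tendsto (fun s : ℝ => ((|s| ^ e : ℝ) : ℂ) * g s) (𝓝[U] 0) (𝓝 Z) := by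
  have hlim : Tendsto (fun s : ℝ => |s| ^ e * B) (𝓝[U] 0) (𝓝 0) := by
    have hc : ContinuousAt (fun s : ℝ => |s| ^ e * B) 0 :=
      (ContinuousAt.rpow_const continuous_abs.continuousAt (Or.inr he.le)).mul continuousAt_const
    have := hc.tendsto.mono_left (nhdsWithin_le_nhds (s := U))
    rwa [abs_zero, Real.zero_rpow he.ne', zero_mul] at this
  rw [tendsto_iff_norm_sub_tendsto_zero]
  refine squeeze_zero' (Eventually.of_forall fun s => norm_nonneg _) ?_ hlim
  filter_upwards [self_mem_nhdsWithin] with s hs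
  have hs' := abs_pos_of_mem_punctured (hU hs)
  have e1 : ((|s| ^ e : ℝ) : ℂ) * ((|s| ^ (-e) : ℝ) : ℂ) = 1 := by
    rw [← ofReal_mul, ← Real.rpow_add hs', add_neg_cancel, Real.rpow_zero, ofReal_one]
  have e2 : ((|s| ^ e : ℝ) : ℂ) * g s - Z =
      ((|s| ^ e : ℝ) : ℂ) * (g s - ((|s| ^ (-e) : ℝ) : ℂ) * Z) := by
    linear_combination Z * e1
  rw [e2, norm_mul, norm_real, Real.norm_of_nonneg (by positivity)]
  gcongr
  exact h s hs

/-! ### Assembling remainder and Taylor polynomial. -/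

lemma jetInt_sub {m l N : ℕ} (hm : m ≠ 0) {F T : ℕ → ℕ → ℂ → ℂ} (hF : IsJet N (domain m) F)
    (hT : IsJet N (domain m) T) {s : ℝ} (hs : s ∈ punctured) :
    jetInt m l (fun p q w => F p q w - T p q w) 0 s = jetInt m l F 0 s - jetInt m l T 0 s := by
  have hint : ∀ {F : ℕ → ℕ → ℂ → ℂ}, IsJet N (domain m) F → IntervalIntegrable
      (fun u : ℝ => branchDeriv m F 0 0 0 (m - 1) (m - 1) (root m l ⟨u, s⟩)) volume (-1) 1 := by
    intro F hF
    refine ContinuousOn.intervalIntegrable ?_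
    rw [uIcc_of_le (by norm_num)]
    exact (continuousOn_branchDeriv_rect (i := 0) (l := l) hm hF (Nat.zero_le _)).comp
      (f := fun u : ℝ => (s, u)) (by fun_prop) fun u hu => ⟨hs, hu⟩
  rw [jetInt, jetInt, jetInt, ← intervalIntegral.integral_sub (hint hF) (hint hT)]
  refine intervalIntegral.integral_congr fun u _ => ?_
  simp only [branchDeriv]
  ring

lemma iteratedFDerivWithin_le_ckNorm {m K : ℕ} (f : ℂ → ℂ) {j : ℕ} (hj : j ≤ K) {w : ℂ}
    (hw : w ∈ domain m) : ‖iteratedFDerivWithin ℝ j f (domain m) w‖ₑ ≤ ckNorm m K f :=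
  (le_iSup₂ (f := fun w _ => ‖iteratedFDerivWithin ℝ j f (domain m) w‖ₑ) w hw).trans
    (Finset.single_le_sum (f := fun j => ⨆ w ∈ domain m,
      ‖iteratedFDerivWithin ℝ j f (domain m) w‖ₑ) (fun _ _ => bot_le)
      (Finset.mem_range.2 (by omega)))

lemma ckNorm_lt_top {m K : ℕ} (hm : m ≠ 0) {f : ℂ → ℂ} (hf : ContDiffOn ℝ K f (domain m)) :
    ckNorm m K f < ⊤ := by
  refine ENNReal.sum_lt_top.2 fun j hj => ?_
  have hc := (hf.continuousOn_iteratedFDerivWithin (m := j)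
    (by exact_mod_cast Nat.lt_succ_iff.1 (Finset.mem_range.1 hj)) (uniqueDiffOn_domain hm))
  obtain ⟨B, hB⟩ := (isCompact_domain hm).exists_bound_of_continuousOn hc
  refine lt_of_le_of_lt (iSup₂_le fun w hw => ?_) (ENNReal.ofReal_lt_top (r := B))
  rw [← ofReal_norm]
  exact ENNReal.ofReal_le_ofReal (hB w hw)

/-- The Taylor remainder of order `k` at the origin of a jet. -/
def remJet (k : ℕ) (F : ℕ → ℕ → ℂ → ℂ) (p q : ℕ) (w : ℂ) : ℂ :=
  F p q w - taylorJet k (fun p q => F p q 0) p q w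

/-- The iterated derivatives of `phi`, split along the Taylor polynomial of order `k`. -/
def phiDeriv (m l k : ℕ) (F : ℕ → ℕ → ℂ → ℂ) (i : ℕ) (s : ℝ) : ℂ :=
  jetInt m l (remJet k F) i s + polyInt m l k (fun p q => F p q 0) i s

lemma IsJet.remJet {N k : ℕ} {S : Set ℂ} {F : ℕ → ℕ → ℂ → ℂ} (hF : IsJet N S F) :
    IsJet N S (remJet k F) := hF.sub (isJet_taylorJet _ _ _ _)

section

variable {m N : ℕ} {F : ℕ → ℕ → ℂ → ℂ}

lemma phi_eqOn_phiDeriv (hm : m ≠ 0) (l k : ℕ) (hF : IsJet N (domain m) F) {f : ℂ → ℂ}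
    (hf : F 0 0 = f) : EqOn (phi m l f) (phiDeriv m l k F 0) punctured := by
  intro s hs
  have h := jetInt_sub (l := l) hm hF (isJet_taylorJet k (fun p q => F p q 0) N _) hs
  rw [phi_eq_jetInt hm hf hs, phiDeriv, ← jetInt_taylorJet hm l k _ hs]
  exact (sub_eq_iff_eq_add.1 h.symm)

lemma hasDerivWithinAt_phiDeriv (hm : m ≠ 0) (l k : ℕ) (hF : IsJet N (domain m) F) {i : ℕ}
    (hi : i < N) {s : ℝ} (hs : s ∈ punctured) :
    HasDerivWithinAt (phiDeriv m l k F i) (phiDeriv m l k F (i + 1) s) punctured s :=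
  (hasDerivWithinAt_jetInt hm hF.remJet hi hs).add
    (hasDerivAt_polyInt m l k _ i (ne_zero_of_mem_punctured hs)).hasDerivWithinAt

lemma continuousOn_phiDeriv (hm : m ≠ 0) (l k : ℕ) (hF : IsJet N (domain m) F) {i : ℕ}
    (hi : i ≤ N) : ContinuousOn (phiDeriv m l k F i) punctured :=
  (continuousOn_jetInt hm hF.remJet hi).add fun _ hs =>
    (hasDerivAt_polyInt m l k _ i (ne_zero_of_mem_punctured hs)).continuousAt.continuousWithinAt

lemma exists_norm_phiDeriv_le (hm : 2 ≤ m) (k : ℕ) (hk : k ≤ N) (hN : nIdx m k + 1 ≤ N) :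
    ∃ C : ℝ, 0 ≤ C ∧ ∀ (l : ℕ) (F : ℕ → ℕ → ℂ → ℂ) (A : ℝ), 0 ≤ A → IsJet N (domain m) F →
    (∀ p q, p + q ≤ N → ∀ w ∈ domain m, ‖F p q w‖ ≤ A) →
    (∀ L j, j < k → orderCoef m L j (nIdx m k + 1) (fun p q => F p q 0) = 0) →
    (∀ s ∈ punctured, ‖phiDeriv m l k F (nIdx m k + 1) s‖ ≤ C * A * |s| ^ (-(1 + bIdx m k))) ∧
    ∀ i ≤ nIdx m k, ∀ s ∈ punctured, |s| = 1 → ‖phiDeriv m l k F i s‖ ≤ C * A := by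
  have hm0 : m ≠ 0 := by omega
  obtain ⟨C₁, h₁, H₁⟩ := IsJet.remainder_bound hm0 N k hk
  obtain ⟨C₂, h₂, H₂⟩ := JetBound.norm_jetInt_le hm k N hN
  obtain ⟨C₃, h₃, H₃⟩ := exists_norm_polyInt_le hm k
  choose! C₄ h₄ H₄ using fun (i : ℕ) (hi : i ≤ N) => JetBound.norm_jetInt_side_le hm k N i hi
  choose C₅ h₅ H₅ using fun i => exists_norm_polyInt_side_le m k i
  have hpos : ∀ i ∈ Finset.range (nIdx m k + 1), 0 ≤ C₄ i * C₁ + C₅ i := by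
    intro i hi
    have := h₄ i (by have := Finset.mem_range.1 hi; omega)
    have := h₅ i
    positivity
  refine ⟨C₂ * C₁ + C₃ + ∑ i ∈ Finset.range (nIdx m k + 1), (C₄ i * C₁ + C₅ i),
    add_nonneg (by positivity) (Finset.sum_nonneg hpos), fun l F A hA hF hFA hz => ?_⟩
  have hrem : JetBound N k (domain m) (remJet k F) (C₁ * A) := H₁ F hF A hA hFA
  have hc : ∀ p q, p + q ≤ k → ‖F p q 0‖ ≤ A := fun p q h =>
    hFA p q (h.trans hk) 0 (zero_mem_domain hm0)
  refine ⟨fun s hs => ?_, fun i hi s hs hs1 => ?_⟩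
  · refine (norm_add_le _ _).trans ((add_le_add (H₂ l _ _ (by positivity) hrem s hs)
      (H₃ l _ A hA hc hz s hs)).trans ?_)
    have : 0 ≤ ∑ i ∈ Finset.range (nIdx m k + 1), (C₄ i * C₁ + C₅ i) := Finset.sum_nonneg hpos
    calc _ = (C₂ * C₁ + C₃) * A * |s| ^ (-(1 + bIdx m k)) := by ring
      _ ≤ _ := mul_le_mul_of_nonneg_right
        (mul_le_mul_of_nonneg_right (le_add_of_nonneg_right this) hA) (by positivity)
  · refine (norm_add_le _ _).trans ((add_le_add (H₄ i (by omega) l _ _ (by positivity) hrem s hs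
      hs1) (H₅ i l _ A hA hc s hs hs1)).trans ?_)
    have := Finset.single_le_sum hpos (Finset.mem_range.2 (Nat.lt_succ_iff.2 hi))
    calc _ = (C₄ i * C₁ + C₅ i) * A := by ring
      _ ≤ _ := mul_le_mul_of_nonneg_right (this.trans (le_add_of_nonneg_left (by positivity))) hA

/-- The remainder contributes 0 and the Taylor polynomial contributes Z. The set U stands for either
half of the punctured interval, on which sheet and sign are constant. -/
lemma tendsto_phiDeriv (hm : 2 ≤ m) {k : ℕ} (l : ℕ) (hk : k ≤ N) (hN : nIdx m k + 1 ≤ N)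
    (hF : IsJet N (domain m) F) {A : ℝ} (hA : 0 ≤ A)
    (hFA : ∀ p q, p + q ≤ N → ∀ w ∈ domain m, ‖F p q w‖ ≤ A)
    (hz : ∀ L j, j < k → orderCoef m L j (nIdx m k + 1) (fun p q => F p q 0) = 0)
    {U : Set ℝ} (hU : U ⊆ punctured) {Z : ℂ}
    (hZ : ∀ s ∈ U, sheetSign (nIdx m k + 1) s *
      orderCoef m (sheet l s) k (nIdx m k + 1) (fun p q => F p q 0) = Z) :
    Tendsto (fun s : ℝ => ((|s| ^ (1 + bIdx m k) : ℝ) : ℂ) * phiDeriv m l k F (nIdx m k + 1) s)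
      (𝓝[U] 0) (𝓝 Z) := by
  have hm0 : m ≠ 0 := by omega
  obtain ⟨C₁, h₁, H₁⟩ := IsJet.remainder_bound hm0 N k hk
  obtain ⟨B, -, HB⟩ := exists_polyInt_asymp hm k
  have hrem : JetBound N k (domain m) (remJet k F) (C₁ * A) := H₁ F hF A hA hFA
  have hc : ∀ p q, p + q ≤ k → ‖F p q 0‖ ≤ A := fun p q h =>
    hFA p q (h.trans hk) 0 (zero_mem_domain hm0)
  have t1 := (JetBound.tendsto_jetInt (l := l) hm hN (by positivity) hrem fun ε hε =>
    IsJet.remainder_small hm0 hk hF hA hFA hε).mono_left (nhdsWithin_mono 0 hU)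
  have t2 := tendsto_of_asymp (by linarith [bIdx_nonneg m k] : 0 < 1 + bIdx m k) hU
    (g := polyInt m l k (fun p q => F p q 0) (nIdx m k + 1)) (Z := Z) (B := B * A) fun s hs => by
      rw [← hZ s hs]
      exact HB l _ A hA hc hz s (hU hs)
  refine (zero_add Z ▸ t1.add t2).congr fun s => ?_
  rw [phiDeriv]; ring

end

end Saddle

end

theorem mainTheorem5 (m : ℕ) (hm : 2 ≤ m) (k : ℕ) :
    ∃ C : ℝ, 0 < C ∧ ∀ l : ℕ, l < m → ∀ f : ℂ → ℂ,
      ContDiffOn ℝ ((max k (Saddle.nIdx m k + 1) : ℕ) : ℕ∞) f (Saddle.domain m) →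
      (∀ j : ℕ, j < k → ∀ i : ℕ, i ≤ min j (m - 2) →
        ¬ ((i : ℤ) ≡ (j : ℤ) - ((m : ℤ) - 1) [ZMOD (m : ℤ)]) → Saddle.invDist m j i f = 0) →
      Saddle.MemP (Saddle.nIdx m k) (Saddle.bIdx m k) (Saddle.phi m l f) ∧
      Saddle.pNorm (Saddle.nIdx m k) (Saddle.bIdx m k) (Saddle.phi m l f) ≤
        ENNReal.ofReal C * Saddle.ckNorm m (max k (Saddle.nIdx m k + 1)) f ∧
      Tendsto (fun s : ℝ => ((|s| ^ (Saddle.bIdx m k + 1) : ℝ) : ℂ) *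
          iteratedDerivWithin (Saddle.nIdx m k + 1) (Saddle.phi m l f) Saddle.punctured s)
        (𝓝[>] 0)
        (𝓝 ((((-1) ^ (Saddle.nIdx m k + 1) * (((Saddle.nIdx m k + 1)! : ℝ) / (k ! : ℝ)) *
            Saddle.cbinom (Saddle.bIdx m k) (Saddle.nIdx m k + 1) : ℝ) : ℂ) *
          Saddle.angDist m k (2 * l) f)) ∧
      Tendsto (fun s : ℝ => ((|s| ^ (Saddle.bIdx m k + 1) : ℝ) : ℂ) *
          iteratedDerivWithin (Saddle.nIdx m k + 1) (Saddle.phi m l f) Saddle.punctured s)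
        (𝓝[<] 0)
        (𝓝 ((((((Saddle.nIdx m k + 1)! : ℝ) / (k ! : ℝ)) *
            Saddle.cbinom (Saddle.bIdx m k) (Saddle.nIdx m k + 1) : ℝ) : ℂ) *
          Saddle.angDist m k (2 * l + 1) f)) := by
  open Saddle in
  have hm0 : m ≠ 0 := by omega
  set K := max k (nIdx m k + 1) with hK
  have hk : k ≤ K := le_max_left _ _
  have hN : nIdx m k + 1 ≤ K := le_max_right _ _
  obtain ⟨D, hD, HD⟩ := exists_norm_phiDeriv_le hm k hk hN
  obtain ⟨E, hE, HE⟩ := exists_pNorm_le (nIdx m k) (bIdx_nonneg m k) (bIdx_lt_one hm k)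
  -- The summand 1 only ensures positivity, since D may vanish.
  refine ⟨E * D + 1, by positivity, fun l _ f hf hinv => ?_⟩
  have hf' : ContDiffOn ℝ (K : ℕ) f (domain m) := by exact_mod_cast hf
  have hU := uniqueDiffOn_domain hm0
  have hF : IsJet K (domain m) (jet (domain m) f) :=
    isJet_jet hU (fun w hw => mem_closure_interior_domain hm0 hw) hf'
  have hA := ckNorm_lt_top hm0 hf'
  have hA' : ENNReal.ofReal (ckNorm m K f).toReal = ckNorm m K f := ENNReal.ofReal_toReal hA.ne
  set A : ℝ := (ckNorm m K f).toReal with hAdef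
  have hA0 : 0 ≤ A := ENNReal.toReal_nonneg
  have hFA : ∀ p q, p + q ≤ K → ∀ w ∈ domain m, ‖jet (domain m) f p q w‖ ≤ A := by
    intro p q h w hw
    refine (norm_jet_le hU (hf'.of_le (by exact_mod_cast h)) hw).trans ?_
    have := ENNReal.toReal_mono hA.ne (iteratedFDerivWithin_le_ckNorm f h hw)
    rwa [toReal_enorm] at this
  have hc : (fun p q => jet (domain m) f p q 0) = fun p q => mixedPartial p q f :=
    funext₂ fun p q => jet_zero_eq_mixedPartial (zero_mem_interior_domain hm0) f p q
  have hz : ∀ L j, j < k → orderCoef m L j (nIdx m k + 1)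
      (fun p q => jet (domain m) f p q 0) = 0 := by
    intro L j hj
    rw [hc]
    exact orderCoef_eq_zero hm L j _ f (hinv j hj)
  obtain ⟨htop, hside⟩ := HD l _ A hA0 hF hFA hz
  have h0 := phi_eqOn_phiDeriv hm0 l k hF (f := f) rfl
  have hder : ∀ i < nIdx m k + 1, ∀ s ∈ punctured,
      HasDerivWithinAt (phiDeriv m l k (jet (domain m) f) i)
        (phiDeriv m l k (jet (domain m) f) (i + 1) s) punctured s :=
    fun i hi s hs => hasDerivWithinAt_phiDeriv hm0 l k hF (by omega) hs
  have hcont := continuousOn_phiDeriv hm0 l k hF hN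
  have hS := locIcc_punctured.uniqueDiffOn
  have hiter := iteratedDerivWithin_eq_of_tower hS h0 hder _ le_rfl
  have lim : ∀ {U : Set ℝ} {Z : ℂ}, U ⊆ punctured → (∀ s ∈ U, sheetSign (nIdx m k + 1) s *
      orderCoef m (sheet l s) k (nIdx m k + 1) (fun p q => mixedPartial p q f) = Z) →
      Tendsto (fun s : ℝ => ((|s| ^ (bIdx m k + 1) : ℝ) : ℂ) *
        iteratedDerivWithin (nIdx m k + 1) (phi m l f) punctured s) (𝓝[U] 0) (𝓝 Z) := by
    intro U Z hU' hZ
    refine (tendsto_phiDeriv hm l hk hN hF hA0 hFA hz hU' (by rwa [hc])).congr' ?_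
    filter_upwards [self_mem_nhdsWithin] with s hs
    rw [hiter (hU' hs), add_comm]
  have right := lim (U := Ioc 0 1) subset_union_right (fun s hs => by
    rw [sheetSign, sheet, if_pos hs.1, if_pos hs.1, one_mul, orderCoef_top hm])
  -- On the left the reflection sign (-1)^{n+1} cancels the one in the leading coefficient.
  have left := lim (U := Ico (-1) 0) subset_union_left (fun s hs => by
    rw [sheetSign, sheet, if_neg (not_lt.2 hs.2.le), if_neg (not_lt.2 hs.2.le), orderCoef_top hm,
      ← mul_assoc, ← mul_assoc, ← mul_pow, neg_mul_neg, one_mul, one_pow, one_mul])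
  rw [nhdsWithin_Ioc_eq_nhdsGT (by norm_num)] at right
  rw [nhdsWithin_Ico_eq_nhdsLT (by norm_num)] at left
  refine ⟨⟨contDiffOn_of_tower hS h0 hder hcont, (pSemi_le hiter htop).trans_lt
    ENNReal.ofReal_lt_top, ⟨_, by simpa only [add_comm] using right⟩,
    ⟨_, by simpa only [add_comm] using left⟩⟩, ?_, ?_, left⟩
  · refine (HE _ _ (D * A) (by positivity) h0 hder hcont htop hside).trans ?_
    rw [← hA', ← ENNReal.ofReal_mul (by positivity)]
    refine ENNReal.ofReal_le_ofReal ?_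
    nlinarith
  · convert right using 2
    push_cast
    ring
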